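/- Let $k$ be an algebraically closed field. A tensor category is an additive $k$-linear monoidal category whose tensor product is $k$-bilinear on morphisms; a tensor functor is a $k$-linear (strong) monoidal functor; $\mathrm{Funct}_\otimes(\mathcal A,\mathcal B)$ is the category of tensor functors and monoidal natural transformations. A fusion category is a semisimple abelian tensor category with finite-dimensional spaces of morphisms, finitely many isomorphism classes of simple objects and a simple unit object. For a finite group $G$, let $\mathcal V(G)$ be the tensor category of finite-dimensional $G$-graded vector spaces with trivial associator, with simple objects $\delta_g$, $g\in G$, and $\delta_g\otimes\delta_h=\delta_{gh}$. For semisimple tensor categories as above, $\mathcal C\boxtimes\mathcal D$ denotes the tensor category whose objects are finite direct sums of objects $X\boxtimes Y$, with $\mathrm{Hom}(X\boxtimes Y,X'\boxtimes Y')=\mathrm{Hom}(X,X')\otimes_k\mathrm{Hom}(Y,Y')$ and $(X\boxtimes Y)\otimes(X'\boxtimes Y')=(X\otimes X')\boxtimes(Y\otimes Y')$. Let $\mathcal D$ be a tensor category. A tensor functor $F:\mathcal V(G)\to\mathcal D$ defines an action of $G$ on $\mathcal D$ by the tensor autoequivalences $F_g(X)=F(\delta_g)\otimes X\otimes F(\delta_{g^{-1}})$.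 The tensor structure of $F_g$ and the isomorphisms $F_g\circ F_h\cong F_{gh}$ and $\mathrm{Id}\cong F_1$ are obtained from the monoidal structure of $F$; here $F(\delta_{g^{-1}})$ is the dual of $F(\delta_g)$, with the evaluation $\mathrm{ev}_g:F(\delta_{g^{-1}})\otimes F(\delta_g)\cong I$ and the coevaluation $\mathrm{coev}_g:I\cong F(\delta_g)\otimes F(\delta_{g^{-1}})$ given by the monoidal structure. Let $\mathcal D^G$ (which depends on $F$) be the tensor category of $G$-equivariant objects: objects $X$ with isomorphisms $x_g:X\to F_g(X)$ such that $x_{gh}$ is the composite $X\xrightarrow{x_g}F_g(X)\xrightarrow{F_g(x_h)}F_g(F_h(X))\cong F_{gh}(X)$. Let $\mathcal P$ be the category of pairs $(F,H)$ of a tensor functor $F:\mathcal V(G)\to\mathcal D$ and a tensor functor $H:\mathcal C\to\mathcal D^G$, for the $G$-action defined by $F$. Write $\bar H:\mathcal C\to\mathcal D$ for the composite of $H$ with the forgetful functor and $x_g:\bar H(X)\to F(\delta_g)\otimes\bar H(X)\otimes F(\delta_{g^{-1}})$ for the equivariant structure of $H(X)$. A morphism $(F,H)\to(F',H')$ in $\mathcal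 P$ is a pair of monoidal natural transformations $\alpha:F\to F'$, $\beta:\bar H\to\bar H'$ such that $x'_g\circ\beta_X=(\alpha_{\delta_g}\otimes\beta_X\otimes\alpha_{\delta_{g^{-1}}})\circ x_g$ for all $X\in\mathcal C$ and $g\in G$. **Theorem.** Let $\mathcal C$ be a fusion category, $G$ a finite group and $\mathcal D$ a tensor category. Then the data of a tensor functor $\mathcal C\boxtimes\mathcal V(G)\to\mathcal D$ amounts to a tensor functor $F:\mathcal V(G)\to\mathcal D$ together with a tensor functor $H:\mathcal C\to\mathcal D^G$. Precisely, there is an equivalence of categories $$\mathrm{Funct}_\otimes(\mathcal C\boxtimes\mathcal V(G),\mathcal D)\;\simeq\;\mathcal P,\qquad \Phi\mapsto(F,H),$$ together with isomorphisms of tensor functors $\varphi:F\cong\Phi(I\boxtimes-)$ and $\psi:\bar H\cong\Phi(-\boxtimes I)$, natural in $\Phi$, which identify, for all $X\in\mathcal C$ and $g\in G$, the morphism $$(1\otimes 1\otimes\mathrm{ev}_g)\circ(x_g\otimes 1):\ \bar H(X)\otimes F(\delta_g)\longrightarrow F(\delta_g)\otimes\bar H(X)$$ with the isomorphism $\Phi(X\boxtimes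 I)\otimes\Phi(I\boxtimes\delta_g)\cong\Phi(X\boxtimes\delta_g)\cong\Phi(I\boxtimes\delta_g)\otimes\Phi(X\boxtimes I)$ given by the monoidal structure of $\Phi$ and the canonical isomorphisms $(X\boxtimes I)\otimes(I\boxtimes\delta_g)\cong X\boxtimes\delta_g\cong(I\boxtimes\delta_g)\otimes(X\boxtimes I)$. -/

import Mathlib

open CategoryTheory MonoidalCategory Limits
open scoped TensorProduct
noncomputable section
namespace TensorCategory
open Functor.LaxMonoidal Functor.OplaxMonoidal Functor.Monoidal

section TensorFunctors

/-- A tensor functor: a `k`-linear (strong) monoidal functor. -/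
structure TensorFunctor (k : Type*) [Field k]
    (C : Type*) [Category C] [Preadditive C] [Linear k C] [MonoidalCategory C]
    (D : Type*) [Category D] [Preadditive D] [Linear k D] [MonoidalCategory D]
    extends C ⥤ D where
  monoidal : toFunctor.Monoidal := by infer_instance
  additive : toFunctor.Additive := by infer_instance
  linear : toFunctor.Linear k := by infer_instance

attribute [instance] TensorFunctor.monoidal TensorFunctor.additive TensorFunctor.linear

variable {k : Type*} [Field k]
  {B : Type*} [Category B] [Preadditive B] [Linear k B] [MonoidalCategory B]
  {C : Type*} [Category C] [Preadditive C] [Linear k C] [MonoidalCategory C]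
  {D : Type*} [Category D] [Preadditive D] [Linear k D] [MonoidalCategory D]
  {E : Type*} [Category E] [Preadditive E] [Linear k E] [MonoidalCategory E]

namespace TensorFunctor

/-- A tensor natural transformation: a monoidal natural transformation. -/
@[ext]
structure Hom (F G : TensorFunctor k C D) where
  hom : F.toFunctor ⟶ G.toFunctor
  isMonoidal : NatTrans.IsMonoidal hom := by infer_instance

attribute [instance] Hom.isMonoidal

/-- The category of tensor functors and tensor natural transformations. -/
instance : Category (TensorFunctor k C D) where
  Hom := Hom
  id F := ⟨𝟙 F.toFunctor, inferInstance⟩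
  comp α β := ⟨α.hom ≫ β.hom, inferInstance⟩

@[ext] lemma hom_ext {F G : TensorFunctor k C D} {α β : F ⟶ G}
    (h : ∀ X, α.hom.app X = β.hom.app X) : α = β :=
  Hom.ext (NatTrans.ext (funext h))

@[simp] lemma id_hom (F : TensorFunctor k C D) : Hom.hom (𝟙 F) = 𝟙 F.toFunctor := rfl

@[simp] lemma comp_hom {F G H : TensorFunctor k C D} (α : F ⟶ G) (β : G ⟶ H) :
    (α ≫ β).hom = α.hom ≫ β.hom := rfl

/-- An isomorphism of functors with monoidal direct part is one of tensor functors. -/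
@[simps] def isoMk {F G : TensorFunctor k C D} (e : F.toFunctor ≅ G.toFunctor)
    (h : NatTrans.IsMonoidal e.hom) : F ≅ G where
  hom := ⟨e.hom, h⟩
  inv := ⟨e.inv, inferInstance⟩

/-- Composition of tensor functors, `F` first. -/
@[simps toFunctor] def comp (F : TensorFunctor k C D) (G : TensorFunctor k D E) :
    TensorFunctor k C E where
  toFunctor := F.toFunctor ⋙ G.toFunctor

variable (k C) in
/-- The identity tensor functor. -/
@[simps toFunctor] def id : TensorFunctor k C C where
  toFunctor := 𝟭 C

/-- Restriction of tensor functors along a tensor functor `I`. -/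
@[simps] def precomp (I : TensorFunctor k C D) (E : Type*) [Category E] [Preadditive E]
    [Linear k E] [MonoidalCategory E] : TensorFunctor k D E ⥤ TensorFunctor k C E where
  obj F := I.comp F
  map α := ⟨Functor.whiskerLeft I.toFunctor α.hom, NatTrans.IsMonoidal.whiskerLeft _⟩

/-- Composition of tensor functors with a tensor functor `I`. -/
@[simps] def postcomp (B : Type*) [Category B] [Preadditive B]
    [Linear k B] [MonoidalCategory B] (I : TensorFunctor k C D) :
    TensorFunctor k B C ⥤ TensorFunctor k B D where
  obj F := F.comp I
  map α := ⟨Functor.whiskerRight α.hom I.toFunctor, NatTrans.IsMonoidal.whiskerRight _⟩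

/-- Tensor endofunctors form a monoidal category under composition: `F ⊗ G` is `F ∘ G`. -/
instance : MonoidalCategory (TensorFunctor k C C) where
  tensorObj F G := G.comp F
  tensorUnit := id k C
  whiskerLeft F _ _ β := ⟨Functor.whiskerRight β.hom F.toFunctor,
    NatTrans.IsMonoidal.whiskerRight _⟩
  whiskerRight α H := ⟨Functor.whiskerLeft H.toFunctor α.hom,
    NatTrans.IsMonoidal.whiskerLeft _⟩
  tensorHom α β := ⟨β.hom ◫ α.hom, NatTrans.IsMonoidal.hcomp _ _⟩
  associator F G H := isoMk (Functor.associator H.toFunctor G.toFunctor F.toFunctor).symm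
    (inferInstanceAs (NatTrans.IsMonoidal (Functor.associator _ _ _).inv))
  leftUnitor F := isoMk (Functor.rightUnitor F.toFunctor)
    (inferInstanceAs (NatTrans.IsMonoidal (Functor.rightUnitor F.toFunctor).hom))
  rightUnitor F := isoMk (Functor.leftUnitor F.toFunctor)
    (inferInstanceAs (NatTrans.IsMonoidal (Functor.leftUnitor F.toFunctor).hom))
  tensorHom_def {F F' G G'} α β := Hom.ext (show β.hom ◫ α.hom =
    Functor.whiskerLeft G.toFunctor α.hom ≫ Functor.whiskerRight β.hom F'.toFunctor by
      ext; simp)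
  id_tensorHom_id F G := Hom.ext (show 𝟙 G.toFunctor ◫ 𝟙 F.toFunctor =
    𝟙 (G.toFunctor ⋙ F.toFunctor) by ext; simp)
  tensorHom_comp_tensorHom α α' β β' := Hom.ext (show (α'.hom ◫ α.hom) ≫ (β'.hom ◫ β.hom) =
    (α'.hom ≫ β'.hom) ◫ (α.hom ≫ β.hom) by ext; simp)
  whiskerLeft_id F G := Hom.ext (show Functor.whiskerRight (𝟙 G.toFunctor) F.toFunctor =
    𝟙 (G.toFunctor ⋙ F.toFunctor) by ext; simp)
  id_whiskerRight F G := Hom.ext (show Functor.whiskerLeft G.toFunctor (𝟙 F.toFunctor) =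
    𝟙 (G.toFunctor ⋙ F.toFunctor) by ext; simp)
  associator_naturality α β γ := hom_ext fun X => by
    refine (Category.comp_id _).trans (Eq.trans ?_ (Category.id_comp _).symm)
    change (γ.hom ◫ (β.hom ◫ α.hom)).app X = ((γ.hom ◫ β.hom) ◫ α.hom).app X
    simp
  leftUnitor_naturality α := hom_ext fun X =>
    (Category.comp_id _).trans (Category.id_comp _).symm
  rightUnitor_naturality α := hom_ext fun X =>
    (Category.comp_id _).trans (Category.id_comp _).symm
  pentagon F G H K := hom_ext fun X =>
    show 𝟙 _ ≫ 𝟙 _ ≫ F.map (𝟙 _) = 𝟙 _ ≫ 𝟙 _ by simp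
  triangle F G := hom_ext fun X =>
    show 𝟙 _ ≫ F.map (𝟙 _) = 𝟙 _ by simp

@[simp] lemma tensorObj_toFunctor (F G : TensorFunctor k C C) :
    (F ⊗ G).toFunctor = G.toFunctor ⋙ F.toFunctor := rfl
@[simp] lemma tensorUnit_toFunctor : (𝟙_ (TensorFunctor k C C)).toFunctor = 𝟭 C := rfl

end TensorFunctor

end TensorFunctors

section Aux

variable {C : Type*} [Category C] [MonoidalCategory C] (F : C ⥤ C) [F.Monoidal]

lemma aux_tensorHom {X X' Y Y' : C} (f : X ⟶ X') (g : Y ⟶ Y') (x : X ⟶ F.obj X)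
    (x' : X' ⟶ F.obj X') (y : Y ⟶ F.obj Y) (y' : Y' ⟶ F.obj Y') (hf : x ≫ F.map f = f ≫ x')
    (hg : y ≫ F.map g = g ≫ y') :
    ((x ⊗ₘ y) ≫ μ F X Y) ≫ F.map (f ⊗ₘ g) = (f ⊗ₘ g) ≫ (x' ⊗ₘ y') ≫ μ F X' Y' := by
  rw [Category.assoc, ← μ_natural, tensorHom_comp_tensorHom_assoc,
    tensorHom_comp_tensorHom_assoc, hf, hg]

lemma aux_associator {X Y Z : C} (x : X ⟶ F.obj X) (y : Y ⟶ F.obj Y) (z : Z ⟶ F.obj Z) :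
    ((((x ⊗ₘ y) ≫ μ F X Y) ⊗ₘ z) ≫ μ F (X ⊗ Y) Z) ≫ F.map (α_ X Y Z).hom =
      (α_ X Y Z).hom ≫ (x ⊗ₘ ((y ⊗ₘ z) ≫ μ F Y Z)) ≫ μ F X (Y ⊗ Z) := by
  rw [← tensorHom_comp_whiskerRight, ← tensorHom_comp_whiskerLeft, Category.assoc,
    Category.assoc, Category.assoc, Functor.LaxMonoidal.associativity,
    associator_naturality_assoc]

lemma aux_leftUnitor {X : C} (x : X ⟶ F.obj X) :
    ((ε F ⊗ₘ x) ≫ μ F (𝟙_ C) X) ≫ F.map (λ_ X).hom = (λ_ X).hom ≫ x := by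
  rw [tensorHom_def', Category.assoc, Category.assoc, ← Functor.LaxMonoidal.left_unitality, leftUnitor_naturality]

lemma aux_rightUnitor {X : C} (x : X ⟶ F.obj X) :
    ((x ⊗ₘ ε F) ≫ μ F X (𝟙_ C)) ≫ F.map (ρ_ X).hom = (ρ_ X).hom ≫ x := by
  rw [MonoidalCategory.tensorHom_def, Category.assoc, Category.assoc, ← Functor.LaxMonoidal.right_unitality,
    rightUnitor_naturality]

end Aux

section Equivariant

variable {k : Type*} [Field k] {G : Type*} [Group G]
  {C : Type*} [Category C] [Preadditive C] [Linear k C] [MonoidalCategory C]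

variable (k G C) in
/-- An action of a group `G` on `C`: a monoidal functor `g ↦ F_g` from the discrete monoidal
category of `G` to tensor endofunctors of `C` (all the `F_g` are then autoequivalences). Its
structure morphisms are `μ g h : F_g ∘ F_h ⟶ F_{gh}` and `ε : Id ⟶ F_1`. -/
structure GroupAction extends Discrete G ⥤ TensorFunctor k C C where
  monoidal : toFunctor.Monoidal := by infer_instance

attribute [instance] GroupAction.monoidal

namespace GroupAction

/-- The isomorphism `F_g (F_h X) ⟶ F_{gh} X` of an action. -/
def mulApp (A : GroupAction k G C) (g h : Discrete G) (X : C) :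
    (A.obj g).obj ((A.obj h).obj X) ⟶ (A.obj (g ⊗ h)).obj X :=
  (μ A.toFunctor g h).hom.app X

variable (A : GroupAction k G C)

lemma mulApp_natural (g h : Discrete G) {X Y : C} (f : X ⟶ Y) :
    (A.obj g).map ((A.obj h).map f) ≫ A.mulApp g h Y =
      A.mulApp g h X ≫ (A.obj (g ⊗ h)).map f :=
  (μ A.toFunctor g h).hom.naturality f

lemma mulApp_tensor (g h : Discrete G) (X Y : C) :
    (μ (A.obj g).toFunctor _ _ ≫ (A.obj g).map (μ (A.obj h).toFunctor X Y)) ≫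
        A.mulApp g h (X ⊗ Y) =
      (A.mulApp g h X ⊗ₘ A.mulApp g h Y) ≫ μ (A.obj (g ⊗ h)).toFunctor X Y :=
  NatTrans.IsMonoidal.tensor (τ := (μ A.toFunctor g h).hom) X Y

lemma mulApp_unit (g h : Discrete G) :
    (ε (A.obj g).toFunctor ≫ (A.obj g).map (ε (A.obj h).toFunctor)) ≫ A.mulApp g h (𝟙_ C) =
      ε (A.obj (g ⊗ h)).toFunctor :=
  NatTrans.IsMonoidal.unit (τ := (μ A.toFunctor g h).hom)

end GroupAction

/-- A `G`-equivariant object: an object `X` with isomorphisms `x_g : X ≅ F_g X` such that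
`x_{gh}` is the composite `X ⟶ F_g X ⟶ F_g (F_h X) ⟶ F_{gh} X`. -/
structure EquivariantObj (A : GroupAction k G C) where
  obj : C
  iso (g : Discrete G) : obj ≅ (A.obj g).obj obj
  iso_mul (g h : Discrete G) : (iso (g ⊗ h)).hom =
    (iso g).hom ≫ (A.obj g).map (iso h).hom ≫ A.mulApp g h obj

namespace EquivariantObj

variable {A : GroupAction k G C}

/-- A `G`-equivariant morphism. -/
@[ext]
structure Hom (X Y : EquivariantObj A) where
  hom : X.obj ⟶ Y.obj
  comm (g : Discrete G) : (X.iso g).hom ≫ (A.obj g).map hom = hom ≫ (Y.iso g).hom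

attribute [simp] Hom.comm

/-- The category `C^G` of `G`-equivariant objects. -/
instance : Category (EquivariantObj A) where
  Hom := Hom
  id X := ⟨𝟙 X.obj, by simp⟩
  comp f g := ⟨f.hom ≫ g.hom, fun t => by
    rw [Functor.map_comp, ← Category.assoc, f.comm, Category.assoc, g.comm, Category.assoc]⟩

@[ext] lemma hom_ext {X Y : EquivariantObj A} {f g : X ⟶ Y} (h : f.hom = g.hom) : f = g :=
  Hom.ext h

@[simp] lemma id_hom (X : EquivariantObj A) : Hom.hom (𝟙 X) = 𝟙 X.obj := rfl
@[simp] lemma comp_hom {X Y Z : EquivariantObj A} (f : X ⟶ Y) (g : Y ⟶ Z) :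
    (f ≫ g).hom = f.hom ≫ g.hom := rfl

/-- An isomorphism in `C` which is equivariant is an isomorphism in `C^G`. -/
@[simps] def isoMk {X Y : EquivariantObj A} (e : X.obj ≅ Y.obj)
    (h : ∀ g, (X.iso g).hom ≫ (A.obj g).map e.hom = e.hom ≫ (Y.iso g).hom) : X ≅ Y where
  hom := ⟨e.hom, h⟩
  inv := ⟨e.inv, fun g => by
    rw [Iso.eq_inv_comp, ← Category.assoc, ← h g, Category.assoc, ← Functor.map_comp]
    simp⟩

/-- `C^G` inherits the structure of a `k`-linear category from `C`. -/
instance : Preadditive (EquivariantObj A) where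
  homGroup X Y :=
    letI : Zero (X ⟶ Y) := ⟨⟨0, by simp⟩⟩
    letI : Add (X ⟶ Y) := ⟨fun f g => ⟨f.hom + g.hom, by simp⟩⟩
    letI : Neg (X ⟶ Y) := ⟨fun f => ⟨-f.hom, by simp⟩⟩
    letI : Sub (X ⟶ Y) := ⟨fun f g => ⟨f.hom - g.hom, by simp [Preadditive.comp_sub]⟩⟩
    letI : SMul ℕ (X ⟶ Y) := ⟨fun n f => ⟨n • f.hom, by simp⟩⟩
    letI : SMul ℤ (X ⟶ Y) := ⟨fun n f => ⟨n • f.hom, by simp⟩⟩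
    Function.Injective.addCommGroup (fun f : X ⟶ Y => f.hom) (fun _ _ h => Hom.ext h)
      rfl (fun _ _ => rfl) (fun _ => rfl) (fun _ _ => rfl) (fun _ _ => rfl) (fun _ _ => rfl)
  add_comp _ _ _ f f' g := Hom.ext (Preadditive.add_comp _ _ _ f.hom f'.hom g.hom)
  comp_add _ _ _ f g g' := Hom.ext (Preadditive.comp_add _ _ _ f.hom g.hom g'.hom)

@[simp] lemma add_hom {X Y : EquivariantObj A} (f g : X ⟶ Y) :
    (f + g).hom = f.hom + g.hom := rfl

instance : Linear k (EquivariantObj A) where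
  homModule X Y :=
    letI : SMul k (X ⟶ Y) := ⟨fun r f => ⟨r • f.hom, by simp⟩⟩
    Function.Injective.module k
      (⟨⟨fun f : X ⟶ Y => f.hom, rfl⟩, fun _ _ => rfl⟩ : (X ⟶ Y) →+ (X.obj ⟶ Y.obj))
      (fun _ _ h => Hom.ext h) (fun _ _ => rfl)
  smul_comp _ _ _ r f g := Hom.ext (Linear.smul_comp _ _ _ r f.hom g.hom)
  comp_smul _ _ _ f r g := Hom.ext (Linear.comp_smul _ _ _ f.hom r g.hom)

@[simp] lemma smul_hom {X Y : EquivariantObj A} (r : k) (f : X ⟶ Y) :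
    (r • f).hom = r • f.hom := rfl

/-- The tensor product of equivariant objects: the structure isomorphisms are
`X ⊗ Y ⟶ F_g X ⊗ F_g Y ⟶ F_g (X ⊗ Y)`. -/
@[simps] def tensorObj (X Y : EquivariantObj A) : EquivariantObj A where
  obj := X.obj ⊗ Y.obj
  iso g := (X.iso g ⊗ᵢ Y.iso g) ≪≫ μIso (A.obj g).toFunctor X.obj Y.obj
  iso_mul g h := by
    simp only [Iso.trans_hom, tensorIso_hom, μIso_hom, Functor.map_comp, Category.assoc,
      X.iso_mul, Y.iso_mul, ← tensorHom_comp_tensorHom, ← A.mulApp_tensor, μ_natural_assoc]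

/-- The unit equivariant object, with the unit isomorphisms `I ⟶ F_g I`. -/
@[simps] def tensorUnit : EquivariantObj A where
  obj := 𝟙_ C
  iso g := εIso (A.obj g).toFunctor
  iso_mul g h := by
    simp [← A.mulApp_unit]

/-- The tensor category `C^G`. -/
instance : MonoidalCategory (EquivariantObj A) where
  tensorObj := tensorObj
  tensorUnit := tensorUnit
  whiskerLeft X _ _ f := ⟨X.obj ◁ f.hom, fun g => by
    rw [← id_tensorHom]
    exact aux_tensorHom _ _ _ _ _ _ _ (by simp) (f.comm g)⟩
  whiskerRight f X := ⟨f.hom ▷ X.obj, fun g => by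
    rw [← tensorHom_id]
    exact aux_tensorHom _ _ _ _ _ _ _ (f.comm g) (by simp)⟩
  tensorHom f f' := ⟨f.hom ⊗ₘ f'.hom, fun g =>
    aux_tensorHom _ _ _ _ _ _ _ (f.comm g) (f'.comm g)⟩
  associator X Y Z := isoMk (α_ X.obj Y.obj Z.obj) fun _ => aux_associator _ _ _ _
  leftUnitor X := isoMk (λ_ X.obj) fun _ => aux_leftUnitor _ _
  rightUnitor X := isoMk (ρ_ X.obj) fun _ => aux_rightUnitor _ _
  tensorHom_def f g := Hom.ext (MonoidalCategory.tensorHom_def f.hom g.hom)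
  id_tensorHom_id X Y := Hom.ext (MonoidalCategory.id_tensorHom_id X.obj Y.obj)
  tensorHom_comp_tensorHom f f' g g' :=
    Hom.ext (MonoidalCategory.tensorHom_comp_tensorHom f.hom f'.hom g.hom g'.hom)
  whiskerLeft_id X Y := Hom.ext (MonoidalCategory.whiskerLeft_id X.obj Y.obj)
  id_whiskerRight X Y := Hom.ext (MonoidalCategory.id_whiskerRight X.obj Y.obj)
  associator_naturality f g h :=
    Hom.ext (MonoidalCategory.associator_naturality f.hom g.hom h.hom)
  leftUnitor_naturality f := Hom.ext (MonoidalCategory.leftUnitor_naturality f.hom)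
  rightUnitor_naturality f := Hom.ext (MonoidalCategory.rightUnitor_naturality f.hom)
  pentagon W X Y Z := Hom.ext (MonoidalCategory.pentagon W.obj X.obj Y.obj Z.obj)
  triangle X Y := Hom.ext (MonoidalCategory.triangle X.obj Y.obj)

variable (A) in
/-- The forgetful tensor functor `C^G ⥤ C`. -/
@[simps toFunctor] def forget : TensorFunctor k (EquivariantObj A) C where
  toFunctor :=
    { obj X := X.obj
      map f := f.hom }
  monoidal := Functor.CoreMonoidal.toMonoidal
    { εIso := Iso.refl (𝟙_ C)
      μIso X Y := Iso.refl (X.obj ⊗ Y.obj)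
      μIso_hom_natural_left _ _ := (Category.comp_id _).trans (Category.id_comp _).symm
      μIso_hom_natural_right _ _ := (Category.comp_id _).trans (Category.id_comp _).symm
      associativity X Y Z :=
        show 𝟙 (X.obj ⊗ Y.obj) ▷ Z.obj ≫ 𝟙 _ ≫ (α_ X.obj Y.obj Z.obj).hom =
          (α_ X.obj Y.obj Z.obj).hom ≫ X.obj ◁ 𝟙 (Y.obj ⊗ Z.obj) ≫ 𝟙 _ by simp
      left_unitality X :=
        show (λ_ X.obj).hom = 𝟙 (𝟙_ C) ▷ X.obj ≫ 𝟙 _ ≫ (λ_ X.obj).hom by simp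
      right_unitality X :=
        show (ρ_ X.obj).hom = X.obj ◁ 𝟙 (𝟙_ C) ≫ 𝟙 _ ≫ (ρ_ X.obj).hom by simp }
  additive := {}
  linear := {}

end EquivariantObj

end Equivariant

section AdditiveEnvelope

namespace Mat

variable {T : Type*} [Category T] [Preadditive T]

instance {k : Type*} [Field k] [Linear k T] : Linear k (Mat_ T) where
  homModule M N := inferInstanceAs (Module k (∀ i j, M.X i ⟶ N.X j))
  smul_comp M N K r f g := Mat_.hom_ext _ _ fun i j => by
    change ∑ l, (r • f i l) ≫ g l j = r • ∑ l, f i l ≫ g l j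
    simp [Finset.smul_sum]
  comp_smul M N K f r g := Mat_.hom_ext _ _ fun i j => by
    change ∑ l, f i l ≫ (r • g l j) = r • ∑ l, f i l ≫ g l j
    simp [Finset.smul_sum]

@[simp] lemma smul_apply {k : Type*} [Field k] [Linear k T] {M N : Mat_ T} (r : k) (f : M ⟶ N)
    (i : M.ι) (j : N.ι) : (r • f) i j = r • f i j := rfl

open scoped Classical in
/-- The (generalised) permutation matrix of a map of index sets and morphisms of entries. -/
def perm {M N : Mat_ T} (e : M.ι → N.ι) (φ : ∀ i, M.X i ⟶ N.X (e i)) : M ⟶ N :=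
  fun i j => if h : e i = j then φ i ≫ eqToHom (congrArg N.X h) else 0

lemma perm_apply_self {M N : Mat_ T} (e : M.ι → N.ι) (φ : ∀ i, M.X i ⟶ N.X (e i)) (i : M.ι) :
    perm e φ i (e i) = φ i := by
  simp [perm]

lemma perm_apply_of_ne {M N : Mat_ T} (e : M.ι → N.ι) (φ : ∀ i, M.X i ⟶ N.X (e i))
    (i : M.ι) (j : N.ι) (h : e i ≠ j) : perm e φ i j = 0 := by
  simp [perm, h]

lemma perm_comp_apply {M N K : Mat_ T} (e : M.ι → N.ι) (φ : ∀ i, M.X i ⟶ N.X (e i))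
    (f : N ⟶ K) (i : M.ι) (l : K.ι) : (perm e φ ≫ f) i l = φ i ≫ f (e i) l := by
  rw [Mat_.comp_apply, Finset.sum_eq_single (e i), perm_apply_self]
  · intro j _ hj
    rw [perm_apply_of_ne _ _ _ _ (Ne.symm hj), zero_comp]
  · simp

lemma comp_perm_apply {M N K : Mat_ T} (f : M ⟶ N) (e : N.ι → K.ι)
    (he : Function.Injective e) (φ : ∀ i, N.X i ⟶ K.X (e i)) (i : M.ι) (j : N.ι) :
    (f ≫ perm e φ) i (e j) = f i j ≫ φ j := by
  rw [Mat_.comp_apply, Finset.sum_eq_single j, perm_apply_self]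
  · intro j' _ hj
    rw [perm_apply_of_ne _ _ _ _ (fun h => hj (he h)), comp_zero]
  · simp

lemma perm_ext {M N : Mat_ T} (e : M.ι → N.ι) (φ : ∀ i, M.X i ⟶ N.X (e i)) (f : M ⟶ N)
    (h₁ : ∀ i, f i (e i) = φ i) (h₂ : ∀ i j, e i ≠ j → f i j = 0) : f = perm e φ := by
  refine Mat_.hom_ext _ _ fun i j => ?_
  by_cases h : e i = j
  · subst h
    rw [perm_apply_self, h₁]
  · rw [perm_apply_of_ne _ _ _ _ h, h₂ _ _ h]

lemma id_eq_perm (M : Mat_ T) : 𝟙 M = perm (fun i => i) (fun i => 𝟙 (M.X i)) :=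
  perm_ext _ _ _ (fun i => Mat_.id_apply_self M i) (fun i j h => Mat_.id_apply_of_ne M i j h)

lemma perm_comp_perm {M N K : Mat_ T} (e : M.ι → N.ι) (φ : ∀ i, M.X i ⟶ N.X (e i))
    (e' : N.ι → K.ι) (φ' : ∀ i, N.X i ⟶ K.X (e' i)) :
    perm e φ ≫ perm e' φ' = perm (fun i => e' (e i)) (fun i => φ i ≫ φ' (e i)) := by
  refine perm_ext _ _ _ (fun i => ?_) (fun i j h => ?_)
  · rw [perm_comp_apply, perm_apply_self]
  · rw [perm_comp_apply, perm_apply_of_ne _ _ _ _ h, comp_zero]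

/-- The isomorphism of two families given by a bijection of index sets and isomorphisms of
entries. -/
@[simps hom] def permIso {M N : Mat_ T} (e : M.ι ≃ N.ι) (φ : ∀ i, M.X i ≅ N.X (e i)) :
    M ≅ N where
  hom := perm e (fun i => (φ i).hom)
  inv := perm e.symm (fun j => eqToHom (by simp) ≫ (φ (e.symm j)).inv)
  hom_inv_id := by
    refine (perm_comp_perm _ _ _ _).trans (perm_ext _ _ _ (fun i => ?_) (fun i j h => ?_)).symm
    · rw [Mat_.id_apply, dif_pos (by simp)]
      generalize_proofs h₁ h₂
      revert h₂
      have key : ∀ (i' : M.ι) (h : i' = i) (h₁ : M.X i = M.X i') (h₂ : N.X (e i) = N.X (e i')),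
          eqToHom h₁ = (φ i).hom ≫ eqToHom h₂ ≫ (φ i').inv := by
        rintro i' rfl h₁ h₂
        simp
      exact fun h₂ => key _ (by simp) _ _
    · exact Mat_.id_apply_of_ne _ _ _ (by simpa using h)
  inv_hom_id := by
    refine (perm_comp_perm _ _ _ _).trans (perm_ext _ _ _ (fun i => ?_) (fun i j h => ?_)).symm
    · rw [Mat_.id_apply, dif_pos (by simp)]
      simp
    · exact Mat_.id_apply_of_ne _ _ _ (by simpa using h)

/-- The family with one member. -/
abbrev single (X : T) : Mat_ T := ⟨PUnit, fun _ => X⟩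

lemma embedding_map {X Y : T} (f : X ⟶ Y) : (Mat_.embedding T).map f =
    perm (M := single X) (N := single Y) (fun i => i) (fun _ => f) :=
  perm_ext (M := single X) (N := single Y) _ _ _ (fun _ => rfl) (fun _ _ h => (h rfl).elim)

variable [MonoidalCategory T]

/-- The tensor product of families: `(X_i) ⊗ (Y_j) = (X_i ⊗ Y_j)`. -/
abbrev tensorObj (M N : Mat_ T) : Mat_ T :=
  ⟨M.ι × N.ι, fun p => M.X p.1 ⊗ N.X p.2⟩

variable (T) in
/-- The tensor unit: the family with the tensor unit of `T` as its only member. -/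
abbrev tensorUnit : Mat_ T := single (𝟙_ T)

/-- The tensor product of matrices is the Kronecker product. -/
def kronecker {M M' N N' : Mat_ T} (f : M ⟶ M') (g : N ⟶ N') :
    tensorObj M N ⟶ tensorObj M' N' :=
  fun p q => f p.1 q.1 ⊗ₘ g p.2 q.2

lemma kronecker_apply {M M' N N' : Mat_ T} (f : M ⟶ M') (g : N ⟶ N')
    (p : (tensorObj M N).ι) (q : (tensorObj M' N').ι) :
    kronecker f g p q = f p.1 q.1 ⊗ₘ g p.2 q.2 := rfl

def associator (M N K : Mat_ T) :
    tensorObj (tensorObj M N) K ≅ tensorObj M (tensorObj N K) :=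
  permIso (Equiv.prodAssoc M.ι N.ι K.ι) fun p => α_ (M.X p.1.1) (N.X p.1.2) (K.X p.2)

def leftUnitor (M : Mat_ T) : tensorObj (tensorUnit T) M ≅ M :=
  permIso (Equiv.punitProd M.ι) fun p => λ_ (M.X p.2)

def rightUnitor (M : Mat_ T) : tensorObj M (tensorUnit T) ≅ M :=
  permIso (Equiv.prodPUnit M.ι) fun p => ρ_ (M.X p.1)

lemma associator_hom (M N K : Mat_ T) : (associator M N K).hom =
    perm (M := tensorObj (tensorObj M N) K) (N := tensorObj M (tensorObj N K))
      (fun p => (p.1.1, p.1.2, p.2)) fun p => (α_ (M.X p.1.1) (N.X p.1.2) (K.X p.2)).hom := rfl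

lemma leftUnitor_hom (M : Mat_ T) : (leftUnitor M).hom =
    perm (M := tensorObj (tensorUnit T) M) (fun p => p.2) fun p => (λ_ (M.X p.2)).hom := rfl

lemma rightUnitor_hom (M : Mat_ T) : (rightUnitor M).hom =
    perm (M := tensorObj M (tensorUnit T)) (fun p => p.1) fun p => (ρ_ (M.X p.1)).hom := rfl

variable [MonoidalPreadditive T]

lemma kronecker_perm {M M' N N' : Mat_ T} (e : M.ι → M'.ι) (φ : ∀ i, M.X i ⟶ M'.X (e i))
    (e' : N.ι → N'.ι) (φ' : ∀ i, N.X i ⟶ N'.X (e' i)) :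
    kronecker (perm e φ) (perm e' φ') =
      perm (M := tensorObj M N) (N := tensorObj M' N') (fun p => (e p.1, e' p.2))
        (fun p => φ p.1 ⊗ₘ φ' p.2) := by
  refine perm_ext _ _ _ (fun p => ?_) (fun p q h => ?_)
  · rw [kronecker_apply, perm_apply_self, perm_apply_self]
  · rw [kronecker_apply]
    by_cases h₁ : e p.1 = q.1
    · have h₂ : e' p.2 ≠ q.2 := fun h₂ => h (Prod.ext h₁ h₂)
      rw [perm_apply_of_ne _ _ _ _ h₂, MonoidalPreadditive.tensor_zero]
    · rw [perm_apply_of_ne _ _ _ _ h₁, MonoidalPreadditive.zero_tensor]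

lemma kronecker_id (M N : Mat_ T) : kronecker (𝟙 M) (𝟙 N) = 𝟙 (tensorObj M N) := by
  rw [id_eq_perm, id_eq_perm, kronecker_perm, id_eq_perm]
  simp only [id_tensorHom_id]

lemma kronecker_comp {M M' M'' N N' N'' : Mat_ T} (f : M ⟶ M') (f' : M' ⟶ M'')
    (g : N ⟶ N') (g' : N' ⟶ N'') :
    kronecker f g ≫ kronecker f' g' = kronecker (f ≫ f') (g ≫ g') := by
  refine Mat_.hom_ext _ _ fun p q => ?_
  rw [Mat_.comp_apply, kronecker_apply, Mat_.comp_apply, Mat_.comp_apply, sum_tensor]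
  simp only [tensor_sum]
  refine (Fintype.sum_prod_type _).trans ?_
  simp only [kronecker_apply, tensorHom_comp_tensorHom]

/-- The tensor structure of the additive envelope. -/
instance : MonoidalCategory (Mat_ T) where
  tensorObj := tensorObj
  tensorUnit := tensorUnit T
  tensorHom f g := kronecker f g
  whiskerLeft M _ _ g := kronecker (𝟙 M) g
  whiskerRight f N := kronecker f (𝟙 N)
  associator := associator
  leftUnitor := leftUnitor
  rightUnitor := rightUnitor
  tensorHom_def f g := by simp [kronecker_comp]
  id_tensorHom_id M N := kronecker_id M N
  tensorHom_comp_tensorHom f f' g g' := kronecker_comp f g f' g'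
  whiskerLeft_id M N := kronecker_id M N
  id_whiskerRight M N := kronecker_id M N
  associator_naturality f g h := by
    refine Mat_.hom_ext _ _ fun p ⟨i', j', l'⟩ => ?_
    rw [associator_hom, associator_hom, perm_comp_apply]
    refine (comp_perm_apply (N := tensorObj (tensorObj _ _) _) _ _ (Equiv.prodAssoc _ _ _).injective _ p ((i', j'), l')).trans ?_
    exact associator_naturality _ _ _
  leftUnitor_naturality {M N} f := by
    refine Mat_.hom_ext _ _ fun ⟨⟨⟩, i⟩ j => ?_
    rw [leftUnitor_hom, leftUnitor_hom, perm_comp_apply]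
    refine (comp_perm_apply (N := tensorObj (tensorUnit T) _) _ _ (Equiv.punitProd N.ι).injective _ _ (PUnit.unit, j)).trans ?_
    rw [kronecker_apply]
    dsimp only
    rw [Mat_.id_apply_self]
    exact (congrArg (· ≫ _) (id_tensorHom _ _)).trans (MonoidalCategory.leftUnitor_naturality _)
  rightUnitor_naturality {M N} f := by
    refine Mat_.hom_ext _ _ fun ⟨i, ⟨⟩⟩ j => ?_
    rw [rightUnitor_hom, rightUnitor_hom, perm_comp_apply]
    refine (comp_perm_apply (N := tensorObj _ (tensorUnit T)) _ _ (Equiv.prodPUnit N.ι).injective _ _ (j, PUnit.unit)).trans ?_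
    rw [kronecker_apply]
    dsimp only
    rw [Mat_.id_apply_self]
    exact (congrArg (· ≫ _) (tensorHom_id _ _)).trans (MonoidalCategory.rightUnitor_naturality _)
  pentagon M N K L := by
    simp only [associator_hom]
    rw [id_eq_perm, id_eq_perm, kronecker_perm, kronecker_perm, perm_comp_perm, perm_comp_perm,
      perm_comp_perm]
    congr 1
    funext p
    dsimp only
    rw [tensorHom_id, id_tensorHom]
    exact MonoidalCategory.pentagon _ _ _ _
  triangle M N := by
    rw [associator_hom, leftUnitor_hom, rightUnitor_hom, id_eq_perm, id_eq_perm, kronecker_perm,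
      kronecker_perm, perm_comp_perm]
    congr 1
    funext p
    dsimp only
    rw [tensorHom_id, id_tensorHom]
    exact MonoidalCategory.triangle _ _

instance : MonoidalPreadditive (Mat_ T) where
  whiskerLeft_zero := Mat_.hom_ext _ _ fun _ _ => MonoidalPreadditive.tensor_zero _
  zero_whiskerRight := Mat_.hom_ext _ _ fun _ _ => MonoidalPreadditive.zero_tensor _
  whiskerLeft_add _ _ := Mat_.hom_ext _ _ fun _ _ => MonoidalPreadditive.tensor_add _ _ _
  add_whiskerRight _ _ := Mat_.hom_ext _ _ fun _ _ => MonoidalPreadditive.add_tensor _ _ _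

instance {k : Type*} [Field k] [Linear k T] [MonoidalLinear k T] :
    MonoidalLinear k (Mat_ T) where
  whiskerLeft_smul M _ _ r f := Mat_.hom_ext _ _ fun p q => by
    refine (kronecker_apply (𝟙 M) (r • f) p q).trans (Eq.trans ?_
      (congrArg (r • ·) (kronecker_apply (𝟙 M) f p q)).symm)
    simp [MonoidalCategory.tensorHom_def]
  smul_whiskerRight r _ _ f M := Mat_.hom_ext _ _ fun p q => by
    refine (kronecker_apply (r • f) (𝟙 M) p q).trans (Eq.trans ?_
      (congrArg (r • ·) (kronecker_apply f (𝟙 M) p q)).symm)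
    simp [MonoidalCategory.tensorHom_def]

/-- The isomorphism `(X) ⊗ (Y) ≅ (X ⊗ Y)` of families with one member. -/
def singleμIso (X Y : T) : tensorObj (single X) (single Y) ≅ single (X ⊗ Y) :=
  permIso (M := tensorObj (single X) (single Y)) (N := single (X ⊗ Y)) (Equiv.punitProd PUnit)
    fun _ => Iso.refl (X ⊗ Y)

lemma singleμIso_hom (X Y : T) : (singleμIso X Y).hom =
    perm (M := tensorObj (single X) (single Y)) (N := single (X ⊗ Y)) (fun p => p.2)
      (fun _ => 𝟙 (X ⊗ Y)) := rfl

/-- The embedding `T ⥤ Mat_ T` as families with one member is monoidal. -/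
instance : (Mat_.embedding T).Monoidal := Functor.CoreMonoidal.toMonoidal
  { εIso := Iso.refl (tensorUnit T)
    μIso := singleμIso
    μIso_hom_natural_left {X Y} f Z := by
      rw [embedding_map, embedding_map]
      change kronecker (M := single X) (M' := single Y) _ (𝟙 (single Z)) ≫
        (singleμIso Y Z).hom = (singleμIso X Z).hom ≫ _
      rw [singleμIso_hom, singleμIso_hom, id_eq_perm, kronecker_perm, perm_comp_perm,
        perm_comp_perm]
      congr 1
      funext p
      simp
    μIso_hom_natural_right {X Y} Z f := by
      rw [embedding_map, embedding_map]
      change kronecker (N := single X) (N' := single Y) (𝟙 (single Z)) _ ≫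
        (singleμIso Z Y).hom = (singleμIso Z X).hom ≫ _
      rw [singleμIso_hom, singleμIso_hom, id_eq_perm, kronecker_perm, perm_comp_perm,
        perm_comp_perm]
      congr 1
      funext p
      simp
    associativity X Y Z := by
      rw [embedding_map]
      change kronecker (singleμIso X Y).hom (𝟙 (single Z)) ≫ (singleμIso (X ⊗ Y) Z).hom ≫ _ =
        (associator (single X) (single Y) (single Z)).hom ≫ kronecker (𝟙 (single X))
          (singleμIso Y Z).hom ≫ (singleμIso X (Y ⊗ Z)).hom
      simp only [singleμIso_hom, id_eq_perm, associator_hom]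
      rw [kronecker_perm, kronecker_perm, perm_comp_perm, perm_comp_perm, perm_comp_perm,
        perm_comp_perm]
      congr 1
      funext p
      simp
    left_unitality X := by
      rw [embedding_map]
      change (leftUnitor (single X)).hom = kronecker (𝟙 (single (𝟙_ T))) (𝟙 (single X)) ≫
        (singleμIso (𝟙_ T) X).hom ≫ _
      rw [singleμIso_hom, id_eq_perm, id_eq_perm, leftUnitor_hom, kronecker_perm,
        perm_comp_perm, perm_comp_perm]
      congr 1
      funext p
      simp
    right_unitality X := by
      rw [embedding_map]
      change (rightUnitor (single X)).hom = kronecker (𝟙 (single X)) (𝟙 (single (𝟙_ T))) ≫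
        (singleμIso X (𝟙_ T)).hom ≫ _
      rw [singleμIso_hom, id_eq_perm, id_eq_perm, rightUnitor_hom, kronecker_perm,
        perm_comp_perm, perm_comp_perm]
      congr 1
      funext p
      simp }

instance {k : Type*} [Field k] [Linear k T] : (Mat_.embedding T).Linear k where

end Mat

end AdditiveEnvelope

section LinearProduct

/-- The tensor product over `k` of two `k`-linear categories: its objects are pairs `X ⊠ Y`, and
`Hom (X ⊠ Y) (X' ⊠ Y') = Hom X X' ⊗ Hom Y Y'`. -/
structure LinearProduct (k : Type*) (C D : Type*) where
  fst : C
  snd : D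

namespace LinearProduct

variable {k : Type*} [Field k]
  {C : Type*} [Category C] [Preadditive C] [Linear k C]
  {D : Type*} [Category D] [Preadditive D] [Linear k D]

/-- The composition `(f ⊗ g) ≫ (f' ⊗ g') = (f ≫ f') ⊗ (g ≫ g')`. -/
def compHom {X₁ X₂ X₃ : C} {Y₁ Y₂ Y₃ : D} :
    ((X₁ ⟶ X₂) ⊗[k] (Y₁ ⟶ Y₂)) →ₗ[k] ((X₂ ⟶ X₃) ⊗[k] (Y₂ ⟶ Y₃)) →ₗ[k]
      ((X₁ ⟶ X₃) ⊗[k] (Y₁ ⟶ Y₃)) :=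
  TensorProduct.map₂ (Linear.comp X₁ X₂ X₃) (Linear.comp Y₁ Y₂ Y₃)

@[simp] lemma compHom_tmul {X₁ X₂ X₃ : C} {Y₁ Y₂ Y₃ : D} (f : X₁ ⟶ X₂) (g : Y₁ ⟶ Y₂)
    (f' : X₂ ⟶ X₃) (g' : Y₂ ⟶ Y₃) :
    compHom (k := k) (f ⊗ₜ g) (f' ⊗ₜ g') = (f ≫ f') ⊗ₜ (g ≫ g') := by
  simp [compHom]

instance : Category (LinearProduct k C D) where
  Hom X Y := (X.fst ⟶ Y.fst) ⊗[k] (X.snd ⟶ Y.snd)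
  id X := 𝟙 X.fst ⊗ₜ 𝟙 X.snd
  comp f g := compHom f g
  id_comp f := by
    induction f using TensorProduct.induction_on with
    | zero => simp
    | tmul f g => simp
    | add f f' h h' => rw [map_add, h, h']
  comp_id f := by
    induction f using TensorProduct.induction_on with
    | zero => simp
    | tmul f g => simp
    | add f f' h h' => rw [map_add, LinearMap.add_apply, h, h']
  assoc f g h := by
    induction f using TensorProduct.induction_on with
    | zero => simp
    | add f f' h h' => simp only [map_add, LinearMap.add_apply, h, h']
    | tmul f₁ f₂ =>
      induction g using TensorProduct.induction_on with
      | zero => simp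
      | add f f' h h' => simp only [map_add, LinearMap.add_apply, h, h']
      | tmul g₁ g₂ =>
        induction h using TensorProduct.induction_on with
        | zero => simp
        | add f f' h h' => simp only [map_add, h, h']
        | tmul h₁ h₂ => simp

instance : Preadditive (LinearProduct k C D) where
  homGroup X Y := inferInstanceAs (AddCommGroup ((X.fst ⟶ Y.fst) ⊗[k] (X.snd ⟶ Y.snd)))
  add_comp X Y Z f f' g := LinearMap.map_add₂ (compHom (k := k) (X₁ := X.fst) (X₂ := Y.fst)
    (X₃ := Z.fst) (Y₁ := X.snd) (Y₂ := Y.snd) (Y₃ := Z.snd)) f f' g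
  comp_add X Y Z f g g' := LinearMap.map_add (compHom (k := k) (X₁ := X.fst) (X₂ := Y.fst)
    (X₃ := Z.fst) (Y₁ := X.snd) (Y₂ := Y.snd) (Y₃ := Z.snd) f) g g'

instance : Linear k (LinearProduct k C D) where
  homModule X Y := inferInstanceAs (Module k ((X.fst ⟶ Y.fst) ⊗[k] (X.snd ⟶ Y.snd)))
  smul_comp X Y Z r f g := LinearMap.map_smul₂ (compHom (k := k) (X₁ := X.fst) (X₂ := Y.fst)
    (X₃ := Z.fst) (Y₁ := X.snd) (Y₂ := Y.snd) (Y₃ := Z.snd)) r f g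
  comp_smul X Y Z f r g := LinearMap.map_smul (compHom (k := k) (X₁ := X.fst) (X₂ := Y.fst)
    (X₃ := Z.fst) (Y₁ := X.snd) (Y₂ := Y.snd) (Y₃ := Z.snd) f) r g

/-- The morphism `f ⊠ g`. -/
def homMk {X Y : LinearProduct k C D} (f : X.fst ⟶ Y.fst) (g : X.snd ⟶ Y.snd) : X ⟶ Y :=
  (f ⊗ₜ[k] g : (X.fst ⟶ Y.fst) ⊗[k] (X.snd ⟶ Y.snd))

@[elab_as_elim]
lemma hom_induction {X Y : LinearProduct k C D} {p : (X ⟶ Y) → Prop} (f : X ⟶ Y)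
    (zero : p 0) (mk : ∀ f g, p (homMk f g)) (add : ∀ f f', p f → p f' → p (f + f')) : p f :=
  TensorProduct.induction_on (motive := p) f zero mk add

lemma homMk_comp {X Y Z : LinearProduct k C D} (f : X.fst ⟶ Y.fst) (g : X.snd ⟶ Y.snd)
    (f' : Y.fst ⟶ Z.fst) (g' : Y.snd ⟶ Z.snd) :
    (homMk f g : X ⟶ Y) ≫ (homMk f' g' : Y ⟶ Z) = homMk (f ≫ f') (g ≫ g') :=
  compHom_tmul f g f' g'

lemma id_eq_homMk (X : LinearProduct k C D) : 𝟙 X = homMk (𝟙 X.fst) (𝟙 X.snd) := rfl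

lemma homMk_add {X Y : LinearProduct k C D} (f : X.fst ⟶ Y.fst) (g g' : X.snd ⟶ Y.snd) :
    (homMk f (g + g') : X ⟶ Y) = homMk f g + homMk f g' := TensorProduct.tmul_add _ _ _

lemma add_homMk {X Y : LinearProduct k C D} (f f' : X.fst ⟶ Y.fst) (g : X.snd ⟶ Y.snd) :
    (homMk (f + f') g : X ⟶ Y) = homMk f g + homMk f' g := TensorProduct.add_tmul _ _ _

lemma smul_homMk {X Y : LinearProduct k C D} (r : k) (f : X.fst ⟶ Y.fst) (g : X.snd ⟶ Y.snd) :
    (homMk (r • f) g : X ⟶ Y) = r • homMk f g := rfl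

lemma homMk_smul {X Y : LinearProduct k C D} (r : k) (f : X.fst ⟶ Y.fst) (g : X.snd ⟶ Y.snd) :
    (homMk f (r • g) : X ⟶ Y) = r • homMk f g := TensorProduct.tmul_smul _ _ _

/-- The isomorphism `e ⊠ e'`. -/
@[simps] def isoMk {X Y : LinearProduct k C D} (e : X.fst ≅ Y.fst) (e' : X.snd ≅ Y.snd) :
    X ≅ Y where
  hom := homMk e.hom e'.hom
  inv := homMk e.inv e'.inv
  hom_inv_id := by rw [homMk_comp, e.hom_inv_id, e'.hom_inv_id, id_eq_homMk]
  inv_hom_id := by rw [homMk_comp, e.inv_hom_id, e'.inv_hom_id, id_eq_homMk]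

/-- The morphism `f ⊠ g`, in terms of the components of the objects. -/
abbrev pair {X X' : C} {Y Y' : D} (f : X ⟶ X') (g : Y ⟶ Y') :
    (⟨X, Y⟩ : LinearProduct k C D) ⟶ ⟨X', Y'⟩ :=
  homMk (X := ⟨X, Y⟩) (Y := ⟨X', Y'⟩) f g

variable (k) in
lemma pair_comp {X X' X'' : C} {Y Y' Y'' : D} (f : X ⟶ X') (g : Y ⟶ Y') (f' : X' ⟶ X'')
    (g' : Y' ⟶ Y'') : pair (k := k) f g ≫ pair f' g' = pair (f ≫ f') (g ≫ g') :=
  homMk_comp _ _ _ _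

variable [MonoidalCategory C] [MonoidalPreadditive C] [MonoidalLinear k C]
  [MonoidalCategory D] [MonoidalPreadditive D] [MonoidalLinear k D]

/-- The tensor product of morphisms as a bilinear map. -/
def tensorBilin (X X' Y Y' : C) : (X ⟶ X') →ₗ[k] (Y ⟶ Y') →ₗ[k] (X ⊗ Y ⟶ X' ⊗ Y') :=
  LinearMap.mk₂ k (fun f g => f ⊗ₘ g) (MonoidalPreadditive.add_tensor)
    (by simp [MonoidalCategory.tensorHom_def]) (MonoidalPreadditive.tensor_add)
    (by simp [MonoidalCategory.tensorHom_def])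

/-- The tensor product of objects `(X ⊠ Y) ⊗ (X' ⊠ Y') = (X ⊗ X') ⊠ (Y ⊗ Y')`. -/
abbrev tensorObj (X Y : LinearProduct k C D) : LinearProduct k C D :=
  ⟨X.fst ⊗ Y.fst, X.snd ⊗ Y.snd⟩

/-- The tensor product of morphisms `(f ⊠ g) ⊗ (f' ⊠ g') = (f ⊗ f') ⊠ (g ⊗ g')`. -/
def tensorHom (X X' Y Y' : LinearProduct k C D) :
    (X ⟶ X') →ₗ[k] (Y ⟶ Y') →ₗ[k] (tensorObj X Y ⟶ tensorObj X' Y') :=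
  (TensorProduct.map₂ (tensorBilin X.fst X'.fst Y.fst Y'.fst)
    (tensorBilin X.snd X'.snd Y.snd Y'.snd) :
    ((X.fst ⟶ X'.fst) ⊗[k] (X.snd ⟶ X'.snd)) →ₗ[k] ((Y.fst ⟶ Y'.fst) ⊗[k] (Y.snd ⟶ Y'.snd))
      →ₗ[k] (X.fst ⊗ Y.fst ⟶ X'.fst ⊗ Y'.fst) ⊗[k] (X.snd ⊗ Y.snd ⟶ X'.snd ⊗ Y'.snd))

lemma tensorHom_homMk {X X' Y Y' : LinearProduct k C D} (f : X.fst ⟶ X'.fst)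
    (g : X.snd ⟶ X'.snd) (f' : Y.fst ⟶ Y'.fst) (g' : Y.snd ⟶ Y'.snd) :
    tensorHom X X' Y Y' (homMk f g) (homMk f' g') = homMk (f ⊗ₘ f') (g ⊗ₘ g') :=
  (LinearMap.congr_fun (TensorProduct.map₂_apply_tmul _ _ _ _) _).trans
    (TensorProduct.map_tmul _ _ _ _)

/-- The tensor structure `(X ⊠ Y) ⊗ (X' ⊠ Y') = (X ⊗ X') ⊠ (Y ⊗ Y')`, with unit `I ⊠ I`. -/
instance : MonoidalCategory (LinearProduct k C D) where
  tensorObj := tensorObj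
  tensorUnit := ⟨𝟙_ C, 𝟙_ D⟩
  tensorHom f g := tensorHom _ _ _ _ f g
  whiskerLeft X _ _ g := tensorHom _ _ _ _ (𝟙 X) g
  whiskerRight f Y := tensorHom _ _ _ _ f (𝟙 Y)
  associator X Y Z := isoMk (α_ X.fst Y.fst Z.fst) (α_ X.snd Y.snd Z.snd)
  leftUnitor X := isoMk (λ_ X.fst) (λ_ X.snd)
  rightUnitor X := isoMk (ρ_ X.fst) (ρ_ X.snd)
  tensorHom_def f g := by
    induction f using hom_induction with
    | zero => simp
    | add f f' h h' => simp only [map_add, LinearMap.add_apply, Preadditive.add_comp, h, h']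
    | mk f f' =>
      induction g using hom_induction with
      | zero => simp
      | add g g' h h' => simp only [map_add, Preadditive.comp_add, h, h']
      | mk g g' =>
        simp only [id_eq_homMk, tensorHom_homMk, homMk_comp, tensorHom_comp_tensorHom,
          Category.id_comp, Category.comp_id]
  id_tensorHom_id X Y := by
    simp only [id_eq_homMk, tensorHom_homMk, id_tensorHom_id]
  tensorHom_comp_tensorHom f f' g g' := by
    induction f using hom_induction with
    | zero => simp
    | add _ _ h h' => simp only [map_add, LinearMap.add_apply, Preadditive.add_comp, h, h']
    | mk f₁ f₂ =>
      induction f' using hom_induction with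
      | zero => simp
      | add _ _ h h' => simp only [map_add, Preadditive.add_comp, h, h']
      | mk f₁' f₂' =>
        induction g using hom_induction with
        | zero => simp
        | add _ _ h h' => simp only [map_add, LinearMap.add_apply, Preadditive.comp_add, h, h']
        | mk g₁ g₂ =>
          induction g' using hom_induction with
          | zero => simp
          | add _ _ h h' => simp only [map_add, Preadditive.comp_add, h, h']
          | mk g₁' g₂' =>
            simp only [tensorHom_homMk, homMk_comp, tensorHom_comp_tensorHom]
  whiskerLeft_id X Y := by
    simp only [id_eq_homMk, tensorHom_homMk, id_tensorHom_id]
  id_whiskerRight X Y := by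
    simp only [id_eq_homMk, tensorHom_homMk, id_tensorHom_id]
  associator_naturality f g h := by
    induction f using hom_induction with
    | zero => simp
    | add _ _ h h' => simp only [map_add, LinearMap.add_apply, Preadditive.add_comp,
        Preadditive.comp_add, h, h']
    | mk f₁ f₂ =>
      induction g using hom_induction with
      | zero => simp
      | add _ _ h h' => simp only [map_add, LinearMap.add_apply, Preadditive.add_comp,
          Preadditive.comp_add, h, h']
      | mk g₁ g₂ =>
        induction h using hom_induction with
        | zero => simp
        | add _ _ h h' => simp only [map_add, Preadditive.add_comp, Preadditive.comp_add, h, h']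
        | mk h₁ h₂ =>
          simp only [tensorHom_homMk, isoMk_hom, homMk_comp]
          rw [MonoidalCategory.associator_naturality, MonoidalCategory.associator_naturality]
  leftUnitor_naturality f := by
    induction f using hom_induction with
    | zero => simp
    | add _ _ h h' => simp only [map_add, Preadditive.add_comp, Preadditive.comp_add, h, h']
    | mk f₁ f₂ =>
      simp only [id_eq_homMk, tensorHom_homMk, isoMk_hom, homMk_comp, id_tensorHom,
        MonoidalCategory.leftUnitor_naturality]
  rightUnitor_naturality f := by
    induction f using hom_induction with
    | zero => simp
    | add _ _ h h' => simp only [map_add, LinearMap.add_apply, Preadditive.add_comp,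
        Preadditive.comp_add, h, h']
    | mk f₁ f₂ =>
      simp only [id_eq_homMk, tensorHom_homMk, isoMk_hom, homMk_comp, tensorHom_id,
        MonoidalCategory.rightUnitor_naturality]
  pentagon W X Y Z := by
    simp only [id_eq_homMk, tensorHom_homMk, isoMk_hom, homMk_comp, tensorHom_id, id_tensorHom,
      MonoidalCategory.pentagon]
  triangle X Y := by
    simp only [id_eq_homMk, tensorHom_homMk, isoMk_hom, homMk_comp, tensorHom_id, id_tensorHom,
      MonoidalCategory.triangle]

lemma homMk_tensorHom {X X' Y Y' : LinearProduct k C D} (f : X.fst ⟶ X'.fst)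
    (g : X.snd ⟶ X'.snd) (f' : Y.fst ⟶ Y'.fst) (g' : Y.snd ⟶ Y'.snd) :
    (homMk f g : X ⟶ X') ⊗ₘ (homMk f' g' : Y ⟶ Y') =
      (homMk (X := tensorObj X Y) (Y := tensorObj X' Y') (f ⊗ₘ f') (g ⊗ₘ g')) :=
  tensorHom_homMk f g f' g'

instance : MonoidalPreadditive (LinearProduct k C D) where
  whiskerLeft_zero {X Y Z} := map_zero (tensorHom X X Y Z (𝟙 X))
  zero_whiskerRight {X Y Z} :=
    (congrArg (· (𝟙 X)) (map_zero (tensorHom Y Z X X))).trans (LinearMap.zero_apply _)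
  whiskerLeft_add {X Y Z} f g := map_add (tensorHom X X Y Z (𝟙 X)) f g
  add_whiskerRight {X Y Z} f g :=
    (congrArg (· (𝟙 X)) (map_add (tensorHom Y Z X X) f g)).trans (LinearMap.add_apply _ _ _)

instance : MonoidalLinear k (LinearProduct k C D) where
  whiskerLeft_smul X {Y Z} r f := map_smul (tensorHom X X Y Z (𝟙 X)) r f
  smul_whiskerRight r {Y Z} f X :=
    (congrArg (· (𝟙 X)) (map_smul (tensorHom Y Z X X) r f)).trans (LinearMap.smul_apply _ _ _)

variable (k) in
lemma pair_tensor {X₁ X₁' X₂ X₂' : C} {Y₁ Y₁' Y₂ Y₂' : D} (f₁ : X₁ ⟶ X₁') (g₁ : Y₁ ⟶ Y₁')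
    (f₂ : X₂ ⟶ X₂') (g₂ : Y₂ ⟶ Y₂') :
    tensorHom _ _ _ _ (pair (k := k) f₁ g₁) (pair f₂ g₂) = pair (f₁ ⊗ₘ f₂) (g₁ ⊗ₘ g₂) :=
  tensorHom_homMk _ _ _ _

variable (k C D) in
/-- The functor `X ↦ X ⊠ I`. -/
@[simps] def inl : C ⥤ LinearProduct k C D where
  obj X := ⟨X, 𝟙_ D⟩
  map f := pair f (𝟙 (𝟙_ D))
  map_id _ := rfl
  map_comp f g := by rw [pair_comp, Category.id_comp]

variable (k C D) in
/-- The functor `Y ↦ I ⊠ Y`. -/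
@[simps] def inr : D ⥤ LinearProduct k C D where
  obj Y := ⟨𝟙_ C, Y⟩
  map g := pair (𝟙 (𝟙_ C)) g
  map_id _ := rfl
  map_comp f g := by rw [pair_comp, Category.id_comp]

/-- The isomorphisms of the monoidal structure of `inl`. -/
def inlμIso (X Y : C) :
    (⟨X ⊗ Y, 𝟙_ D ⊗ 𝟙_ D⟩ : LinearProduct k C D) ≅ ⟨X ⊗ Y, 𝟙_ D⟩ :=
  isoMk (X := ⟨X ⊗ Y, 𝟙_ D ⊗ 𝟙_ D⟩) (Y := ⟨X ⊗ Y, 𝟙_ D⟩) (Iso.refl (X ⊗ Y)) (λ_ (𝟙_ D))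

/-- The functor `inl` is monoidal. -/
instance : (inl k C D).Monoidal := Functor.CoreMonoidal.toMonoidal
  { εIso := Iso.refl _
    μIso := inlμIso
    μIso_hom_natural_left {X Y} f Z := by
      change tensorHom _ _ _ _ (pair (k := k) (f) (𝟙 (𝟙_ D))) (pair (k := k) (𝟙 Z) (𝟙 (𝟙_ D))) ≫ pair (k := k) (𝟙 (Y ⊗ Z)) ((λ_ (𝟙_ D)).hom) =
        pair (k := k) (𝟙 (X ⊗ Z)) ((λ_ (𝟙_ D)).hom) ≫ pair (k := k) (f ▷ Z) (𝟙 (𝟙_ D))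
      rw [pair_tensor, pair_comp, pair_comp]
      congr 1 <;> simp
    μIso_hom_natural_right {X Y} Z f := by
      change tensorHom _ _ _ _ (pair (k := k) (𝟙 Z) (𝟙 (𝟙_ D))) (pair (k := k) (f) (𝟙 (𝟙_ D))) ≫ pair (k := k) (𝟙 (Z ⊗ Y)) ((λ_ (𝟙_ D)).hom) =
        pair (k := k) (𝟙 (Z ⊗ X)) ((λ_ (𝟙_ D)).hom) ≫ pair (k := k) (Z ◁ f) (𝟙 (𝟙_ D))
      rw [pair_tensor, pair_comp, pair_comp]
      congr 1 <;> simp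
    associativity X Y Z := by
      change tensorHom _ _ _ _ (pair (k := k) (𝟙 (X ⊗ Y)) ((λ_ (𝟙_ D)).hom)) (pair (k := k) (𝟙 Z) (𝟙 (𝟙_ D))) ≫ pair (k := k) (𝟙 ((X ⊗ Y) ⊗ Z)) ((λ_ (𝟙_ D)).hom) ≫
          pair (k := k) ((α_ X Y Z).hom) (𝟙 (𝟙_ D)) =
        pair (k := k) ((α_ X Y Z).hom) ((α_ (𝟙_ D) (𝟙_ D) (𝟙_ D)).hom) ≫
          tensorHom _ _ _ _ (pair (k := k) (𝟙 X) (𝟙 (𝟙_ D))) (pair (k := k) (𝟙 (Y ⊗ Z)) ((λ_ (𝟙_ D)).hom)) ≫ pair (k := k) (𝟙 (X ⊗ (Y ⊗ Z))) ((λ_ (𝟙_ D)).hom)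
      rw [pair_tensor, pair_tensor, pair_comp, pair_comp, pair_comp, pair_comp]
      congr 1
      all_goals first | (simp; done) | monoidal
    left_unitality X := by
      change pair (k := k) ((λ_ X).hom) ((λ_ (𝟙_ D)).hom) =
        tensorHom _ _ _ _ (pair (k := k) (𝟙 (𝟙_ C)) (𝟙 (𝟙_ D))) (pair (k := k) (𝟙 X) (𝟙 (𝟙_ D))) ≫
          pair (k := k) (𝟙 (𝟙_ C ⊗ X)) ((λ_ (𝟙_ D)).hom) ≫ pair (k := k) ((λ_ X).hom) (𝟙 (𝟙_ D))
      rw [pair_tensor, pair_comp, pair_comp]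
      congr 1 <;> simp
    right_unitality X := by
      change pair (k := k) ((ρ_ X).hom) ((ρ_ (𝟙_ D)).hom) =
        tensorHom _ _ _ _ (pair (k := k) (𝟙 X) (𝟙 (𝟙_ D))) (pair (k := k) (𝟙 (𝟙_ C)) (𝟙 (𝟙_ D))) ≫
          pair (k := k) (𝟙 (X ⊗ 𝟙_ C)) ((λ_ (𝟙_ D)).hom) ≫ pair (k := k) ((ρ_ X).hom) (𝟙 (𝟙_ D))
      rw [pair_tensor, pair_comp, pair_comp]
      congr 1 <;> simp [unitors_equal] }

/-- The isomorphisms of the monoidal structure of `inr`. -/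
def inrμIso (X Y : D) :
    (⟨𝟙_ C ⊗ 𝟙_ C, X ⊗ Y⟩ : LinearProduct k C D) ≅ ⟨𝟙_ C, X ⊗ Y⟩ :=
  isoMk (X := ⟨𝟙_ C ⊗ 𝟙_ C, X ⊗ Y⟩) (Y := ⟨𝟙_ C, X ⊗ Y⟩) (λ_ (𝟙_ C)) (Iso.refl (X ⊗ Y))

/-- The functor `inr` is monoidal. -/
instance : (inr k C D).Monoidal := Functor.CoreMonoidal.toMonoidal
  { εIso := Iso.refl _
    μIso := inrμIso
    μIso_hom_natural_left {X Y} f Z := by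
      change tensorHom _ _ _ _ (pair (k := k) (𝟙 (𝟙_ C)) (f)) (pair (k := k) (𝟙 (𝟙_ C)) (𝟙 Z)) ≫ pair (k := k) ((λ_ (𝟙_ C)).hom) (𝟙 (Y ⊗ Z)) =
        pair (k := k) ((λ_ (𝟙_ C)).hom) (𝟙 (X ⊗ Z)) ≫ pair (k := k) (𝟙 (𝟙_ C)) (f ▷ Z)
      rw [pair_tensor, pair_comp, pair_comp]
      congr 1 <;> simp
    μIso_hom_natural_right {X Y} Z f := by
      change tensorHom _ _ _ _ (pair (k := k) (𝟙 (𝟙_ C)) (𝟙 Z)) (pair (k := k) (𝟙 (𝟙_ C)) (f)) ≫ pair (k := k) ((λ_ (𝟙_ C)).hom) (𝟙 (Z ⊗ Y)) =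
        pair (k := k) ((λ_ (𝟙_ C)).hom) (𝟙 (Z ⊗ X)) ≫ pair (k := k) (𝟙 (𝟙_ C)) (Z ◁ f)
      rw [pair_tensor, pair_comp, pair_comp]
      congr 1 <;> simp
    associativity X Y Z := by
      change tensorHom _ _ _ _ (pair (k := k) ((λ_ (𝟙_ C)).hom) (𝟙 (X ⊗ Y))) (pair (k := k) (𝟙 (𝟙_ C)) (𝟙 Z)) ≫ pair (k := k) ((λ_ (𝟙_ C)).hom) (𝟙 ((X ⊗ Y) ⊗ Z)) ≫
          pair (k := k) (𝟙 (𝟙_ C)) ((α_ X Y Z).hom) =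
        pair (k := k) ((α_ (𝟙_ C) (𝟙_ C) (𝟙_ C)).hom) ((α_ X Y Z).hom) ≫
          tensorHom _ _ _ _ (pair (k := k) (𝟙 (𝟙_ C)) (𝟙 X)) (pair (k := k) ((λ_ (𝟙_ C)).hom) (𝟙 (Y ⊗ Z))) ≫ pair (k := k) ((λ_ (𝟙_ C)).hom) (𝟙 (X ⊗ (Y ⊗ Z)))
      rw [pair_tensor, pair_tensor, pair_comp, pair_comp, pair_comp, pair_comp]
      congr 1
      all_goals first | (simp; done) | monoidal
    left_unitality X := by
      change pair (k := k) ((λ_ (𝟙_ C)).hom) ((λ_ X).hom) =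
        tensorHom _ _ _ _ (pair (k := k) (𝟙 (𝟙_ C)) (𝟙 (𝟙_ D))) (pair (k := k) (𝟙 (𝟙_ C)) (𝟙 X)) ≫
          pair (k := k) ((λ_ (𝟙_ C)).hom) (𝟙 (𝟙_ D ⊗ X)) ≫ pair (k := k) (𝟙 (𝟙_ C)) ((λ_ X).hom)
      rw [pair_tensor, pair_comp, pair_comp]
      congr 1 <;> simp
    right_unitality X := by
      change pair (k := k) ((ρ_ (𝟙_ C)).hom) ((ρ_ X).hom) =
        tensorHom _ _ _ _ (pair (k := k) (𝟙 (𝟙_ C)) (𝟙 X)) (pair (k := k) (𝟙 (𝟙_ C)) (𝟙 (𝟙_ D))) ≫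
          pair (k := k) ((λ_ (𝟙_ C)).hom) (𝟙 (X ⊗ 𝟙_ D)) ≫ pair (k := k) (𝟙 (𝟙_ C)) ((ρ_ X).hom)
      rw [pair_tensor, pair_comp, pair_comp]
      congr 1 <;> simp [unitors_equal] }

instance : (inl k C D).Additive where
  map_add {X Y} f g := add_homMk (X := ⟨X, 𝟙_ D⟩) (Y := ⟨Y, 𝟙_ D⟩) f g (𝟙 (𝟙_ D))

instance : (inl k C D).Linear k where
  map_smul {X Y} f r := smul_homMk (X := ⟨X, 𝟙_ D⟩) (Y := ⟨Y, 𝟙_ D⟩) r f (𝟙 (𝟙_ D))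

instance : (inr k C D).Additive where
  map_add {X Y} f g := homMk_add (X := ⟨𝟙_ C, X⟩) (Y := ⟨𝟙_ C, Y⟩) (𝟙 (𝟙_ C)) f g

instance : (inr k C D).Linear k where
  map_smul {X Y} f r := homMk_smul (X := ⟨𝟙_ C, X⟩) (Y := ⟨𝟙_ C, Y⟩) r (𝟙 (𝟙_ C)) f

end LinearProduct

end LinearProduct

section GradedVectorSpaces

/-- The `k`-linear category with objects the elements of a group `G`, with `Hom g h = k` if
`g = h` and `Hom g h = 0` otherwise. -/
structure LinearDiscrete (k : Type*) (G : Type*) where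
  as : G

namespace LinearDiscrete

variable {k : Type*} [Field k] {G : Type*}

/-- Morphisms are scalars `c`, which have to be zero if source and target are different. -/
@[ext]
structure Hom (g h : LinearDiscrete k G) where
  coeff : k
  coeff_eq_zero : g.as ≠ h.as → coeff = 0

instance : Category (LinearDiscrete k G) where
  Hom := Hom
  id _ := ⟨1, fun h => (h rfl).elim⟩
  comp {g₁ g₂ g₃} a b := ⟨a.coeff * b.coeff, fun h => by
    by_cases h₁ : g₁.as = g₂.as
    · rw [b.coeff_eq_zero (h₁ ▸ h), mul_zero]
    · rw [a.coeff_eq_zero h₁, zero_mul]⟩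
  id_comp a := Hom.ext (one_mul _)
  comp_id a := Hom.ext (mul_one _)
  assoc a b c := Hom.ext (mul_assoc _ _ _)

@[ext] lemma hom_ext {g h : LinearDiscrete k G} {a b : g ⟶ h} (e : a.coeff = b.coeff) : a = b :=
  Hom.ext e

@[simp] lemma id_coeff (g : LinearDiscrete k G) : Hom.coeff (𝟙 g) = 1 := rfl
@[simp] lemma comp_coeff {g₁ g₂ g₃ : LinearDiscrete k G} (a : g₁ ⟶ g₂) (b : g₂ ⟶ g₃) :
    (a ≫ b).coeff = a.coeff * b.coeff := rfl

instance : Preadditive (LinearDiscrete k G) where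
  homGroup g h :=
    letI : Zero (g ⟶ h) := ⟨⟨0, fun _ => rfl⟩⟩
    letI : Add (g ⟶ h) := ⟨fun a b => ⟨a.coeff + b.coeff, fun e => by
      rw [a.coeff_eq_zero e, b.coeff_eq_zero e, add_zero]⟩⟩
    letI : Neg (g ⟶ h) := ⟨fun a => ⟨-a.coeff, fun e => by rw [a.coeff_eq_zero e, neg_zero]⟩⟩
    letI : Sub (g ⟶ h) := ⟨fun a b => ⟨a.coeff - b.coeff, fun e => by
      rw [a.coeff_eq_zero e, b.coeff_eq_zero e, sub_zero]⟩⟩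
    letI : SMul ℕ (g ⟶ h) := ⟨fun n a => ⟨n • a.coeff, fun e => by
      rw [a.coeff_eq_zero e, smul_zero]⟩⟩
    letI : SMul ℤ (g ⟶ h) := ⟨fun n a => ⟨n • a.coeff, fun e => by
      rw [a.coeff_eq_zero e, smul_zero]⟩⟩
    Function.Injective.addCommGroup (fun a : g ⟶ h => a.coeff) (fun _ _ e => Hom.ext e)
      rfl (fun _ _ => rfl) (fun _ => rfl) (fun _ _ => rfl) (fun _ _ => rfl) (fun _ _ => rfl)
  add_comp _ _ _ a a' b := Hom.ext (add_mul _ _ _)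
  comp_add _ _ _ a b b' := Hom.ext (mul_add _ _ _)

@[simp] lemma add_coeff {g h : LinearDiscrete k G} (a b : g ⟶ h) :
    (a + b).coeff = a.coeff + b.coeff := rfl
@[simp] lemma zero_coeff {g h : LinearDiscrete k G} : Hom.coeff (0 : g ⟶ h) = 0 := rfl

instance : Linear k (LinearDiscrete k G) where
  homModule g h :=
    letI : SMul k (g ⟶ h) := ⟨fun r a => ⟨r * a.coeff, fun e => by
      rw [a.coeff_eq_zero e, mul_zero]⟩⟩
    Function.Injective.module k
      (⟨⟨fun a : g ⟶ h => a.coeff, rfl⟩, fun _ _ => rfl⟩ : (g ⟶ h) →+ k)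
      (fun _ _ e => Hom.ext e) (fun _ _ => rfl)
  smul_comp _ _ _ r a b := Hom.ext (mul_assoc _ _ _)
  comp_smul _ _ _ a r b := Hom.ext (mul_left_comm _ _ _)

@[simp] lemma smul_coeff {g h : LinearDiscrete k G} (r : k) (a : g ⟶ h) :
    (r • a).coeff = r * a.coeff := rfl

/-- The isomorphism of equal objects. -/
@[simps] def isoOfEq {g h : LinearDiscrete k G} (e : g.as = h.as) : g ≅ h where
  hom := ⟨1, fun e' => (e' e).elim⟩
  inv := ⟨1, fun e' => (e' e.symm).elim⟩
  hom_inv_id := Hom.ext (one_mul 1)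
  inv_hom_id := Hom.ext (one_mul 1)

variable [Group G]

/-- The tensor product is the product of `G` on objects and that of `k` on morphisms, and all
the structure isomorphisms (in particular, the associator) are trivial. -/
instance : MonoidalCategory (LinearDiscrete k G) where
  tensorObj g h := ⟨g.as * h.as⟩
  tensorUnit := ⟨1⟩
  tensorHom {g g' h h'} a b := ⟨a.coeff * b.coeff, fun e => by
    by_cases h₁ : g.as = g'.as
    · rw [b.coeff_eq_zero (fun h₂ => e (by rw [h₁, h₂])), mul_zero]
    · rw [a.coeff_eq_zero h₁, zero_mul]⟩
  whiskerLeft g _ _ b := ⟨b.coeff, fun e => b.coeff_eq_zero fun h => e (by rw [h])⟩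
  whiskerRight a h := ⟨a.coeff, fun e => a.coeff_eq_zero fun h => e (by rw [h])⟩
  associator g h l := isoOfEq (mul_assoc g.as h.as l.as)
  leftUnitor g := isoOfEq (one_mul g.as)
  rightUnitor g := isoOfEq (mul_one g.as)
  tensorHom_def a b := rfl
  id_tensorHom_id g h := Hom.ext (mul_one (1 : k))
  tensorHom_comp_tensorHom a a' b b' := Hom.ext (mul_mul_mul_comm _ _ _ _)
  whiskerLeft_id g h := rfl
  id_whiskerRight g h := rfl
  associator_naturality a b c := by ext; simp [mul_assoc]
  leftUnitor_naturality a := by ext; simp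
  rightUnitor_naturality a := by ext; simp
  pentagon _ _ _ _ := by ext; simp
  triangle _ _ := by ext; simp

instance : MonoidalPreadditive (LinearDiscrete k G) where
  whiskerLeft_zero := rfl
  zero_whiskerRight := rfl
  whiskerLeft_add _ _ := rfl
  add_whiskerRight _ _ := rfl

instance : MonoidalLinear k (LinearDiscrete k G) where
  whiskerLeft_smul _ _ _ _ _ := rfl
  smul_whiskerRight _ _ _ _ _ := rfl

variable (k G) in
/-- The inclusion of the discrete monoidal category of `G`. -/
@[simps] def ofDiscrete : Discrete G ⥤ LinearDiscrete k G where
  obj g := ⟨g.as⟩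
  map f := (isoOfEq (Discrete.eq_of_hom f)).hom
  map_comp _ _ := Hom.ext (one_mul (1 : k)).symm

instance : (ofDiscrete k G).Monoidal := Functor.CoreMonoidal.toMonoidal
  { εIso := Iso.refl _
    μIso g h := Iso.refl _
    μIso_hom_natural_left f Z := by
      refine Hom.ext ?_
      change (1 : k) * 1 = 1 * 1
      rfl
    μIso_hom_natural_right Z f := by
      refine Hom.ext ?_
      change (1 : k) * 1 = 1 * 1
      rfl
    associativity X Y Z := by
      refine Hom.ext ?_
      change (1 : k) * (1 * 1) = 1 * (1 * 1)
      rfl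
    left_unitality X := by
      refine Hom.ext ?_
      change (1 : k) = 1 * (1 * 1)
      simp
    right_unitality X := by
      refine Hom.ext ?_
      change (1 : k) = 1 * (1 * 1)
      simp }

end LinearDiscrete

end GradedVectorSpaces

section Conjugation

section Aux

variable {D : Type*} [Category D] [MonoidalCategory D]

/-- The morphism `(P ⊗ X ⊗ Q) ⊗ (P ⊗ Y ⊗ Q) ⟶ P ⊗ (X ⊗ Y) ⊗ Q` which contracts the factors
`Q ⊗ P` in the middle by means of `e : Q ⊗ P ⟶ I`. -/
def conjμ {P Q : D} (e : Q ⊗ P ⟶ 𝟙_ D) (X Y : D) :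
    (P ⊗ (X ⊗ Q)) ⊗ (P ⊗ (Y ⊗ Q)) ⟶ P ⊗ ((X ⊗ Y) ⊗ Q) :=
  𝟙 _ ⊗≫ (P ⊗ X) ◁ e ▷ (Y ⊗ Q) ⊗≫ 𝟙 _

/-- The morphism `P ⊗ (P' ⊗ X ⊗ Q') ⊗ Q ⟶ P'' ⊗ X ⊗ Q''` obtained from
`m : P ⊗ P' ⟶ P''` and `n : Q' ⊗ Q ⟶ Q''`. -/
def conjMul {P P' P'' Q Q' Q'' : D} (m : P ⊗ P' ⟶ P'') (n : Q' ⊗ Q ⟶ Q'') (X : D) :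
    P ⊗ ((P' ⊗ (X ⊗ Q')) ⊗ Q) ⟶ P'' ⊗ (X ⊗ Q'') :=
  𝟙 _ ⊗≫ m ▷ (X ⊗ (Q' ⊗ Q)) ⊗≫ P'' ◁ X ◁ n

lemma conjμ_natural_left {P Q : D} (e : Q ⊗ P ⟶ 𝟙_ D) {X X' : D} (f : X ⟶ X') (Y : D) :
    (P ◁ (f ▷ Q)) ▷ (P ⊗ (Y ⊗ Q)) ≫ conjμ e X' Y = conjμ e X Y ≫ P ◁ ((f ▷ Y) ▷ Q) := by
  dsimp only [conjμ]
  calc _ = 𝟙 _ ⊗≫ P ◁ ((f ▷ (Q ⊗ P) ≫ X' ◁ e)) ▷ (Y ⊗ Q) ⊗≫ 𝟙 _ := by monoidal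
    _ = _ := by rw [← whisker_exchange]; monoidal

lemma conjμ_natural_right {P Q : D} (e : Q ⊗ P ⟶ 𝟙_ D) {Y Y' : D} (X : D) (f : Y ⟶ Y') :
    (P ⊗ (X ⊗ Q)) ◁ (P ◁ (f ▷ Q)) ≫ conjμ e X Y' = conjμ e X Y ≫ P ◁ ((X ◁ f) ▷ Q) := by
  dsimp only [conjμ]
  calc _ = 𝟙 _ ⊗≫ (P ⊗ X) ◁ (((Q ⊗ P) ◁ f ≫ e ▷ Y')) ▷ Q ⊗≫ 𝟙 _ := by monoidal
    _ = _ := by rw [whisker_exchange]; monoidal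

lemma conjμ_assoc {P Q : D} (e : Q ⊗ P ⟶ 𝟙_ D) (X Y Z : D) :
    conjμ e X Y ▷ (P ⊗ (Z ⊗ Q)) ≫ conjμ e (X ⊗ Y) Z ≫ P ◁ ((α_ X Y Z).hom ▷ Q) =
      (α_ _ _ _).hom ≫ (P ⊗ (X ⊗ Q)) ◁ conjμ e Y Z ≫ conjμ e X (Y ⊗ Z) := by
  dsimp only [conjμ]
  calc _ = 𝟙 _ ⊗≫ (P ⊗ X) ◁ (e ▷ (Y ⊗ (Q ⊗ P)) ≫ 𝟙_ D ◁ (Y ◁ e)) ▷ (Z ⊗ Q) ⊗≫ 𝟙 _ := by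
        monoidal
    _ = _ := by rw [← whisker_exchange]; monoidal

lemma conjμ_leftUnit {P Q : D} (e : Q ⊗ P ⟶ 𝟙_ D) (c : 𝟙_ D ⟶ P ⊗ Q)
    (h : c ▷ P ≫ (α_ P Q P).hom ≫ P ◁ e = (λ_ P).hom ≫ (ρ_ P).inv) (X : D) :
    (λ_ (P ⊗ (X ⊗ Q))).hom = (c ≫ P ◁ (λ_ Q).inv) ▷ (P ⊗ (X ⊗ Q)) ≫ conjμ e (𝟙_ D) X ≫
      P ◁ ((λ_ X).hom ▷ Q) := by
  dsimp only [conjμ]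
  symm
  calc _ = 𝟙 _ ⊗≫ (c ▷ P ≫ (α_ P Q P).hom ≫ P ◁ e) ▷ (X ⊗ Q) ⊗≫ 𝟙 _ := by monoidal
    _ = _ := by rw [h]; monoidal

lemma conjμ_rightUnit {P Q : D} (e : Q ⊗ P ⟶ 𝟙_ D) (c : 𝟙_ D ⟶ P ⊗ Q)
    (h : Q ◁ c ≫ (α_ Q P Q).inv ≫ e ▷ Q = (ρ_ Q).hom ≫ (λ_ Q).inv) (X : D) :
    (ρ_ (P ⊗ (X ⊗ Q))).hom = (P ⊗ (X ⊗ Q)) ◁ (c ≫ P ◁ (λ_ Q).inv) ≫ conjμ e X (𝟙_ D) ≫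
      P ◁ ((ρ_ X).hom ▷ Q) := by
  dsimp only [conjμ]
  symm
  calc _ = 𝟙 _ ⊗≫ (P ⊗ X) ◁ (Q ◁ c ≫ (α_ Q P Q).inv ≫ e ▷ Q) ⊗≫ 𝟙 _ := by monoidal
    _ = _ := by rw [h]; monoidal

lemma conjMul_natural {P P' P'' Q Q' Q'' : D} (m : P ⊗ P' ⟶ P'') (n : Q' ⊗ Q ⟶ Q'') {X Y : D}
    (f : X ⟶ Y) : P ◁ ((P' ◁ (f ▷ Q')) ▷ Q) ≫ conjMul m n Y =
      conjMul m n X ≫ P'' ◁ (f ▷ Q'') := by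
  dsimp only [conjMul]
  calc _ = 𝟙 _ ⊗≫ ((P ⊗ P') ◁ (f ▷ (Q' ⊗ Q)) ≫ m ▷ (Y ⊗ (Q' ⊗ Q))) ⊗≫ P'' ◁ Y ◁ n := by
        monoidal
    _ = 𝟙 _ ⊗≫ m ▷ (X ⊗ (Q' ⊗ Q)) ⊗≫ P'' ◁ (f ▷ (Q' ⊗ Q) ≫ Y ◁ n) := by
        rw [whisker_exchange]; monoidal
    _ = _ := by rw [← whisker_exchange]; monoidal

lemma conjMul_tensor {P P' P'' Q Q' Q'' : D} (m : P ⊗ P' ⟶ P'') (n : Q' ⊗ Q ⟶ Q'')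
    (e : Q ⊗ P ⟶ 𝟙_ D) (e' : Q' ⊗ P' ⟶ 𝟙_ D) (e'' : Q'' ⊗ P'' ⟶ 𝟙_ D)
    (h : (n ▷ (P ⊗ P') ≫ Q'' ◁ m) ≫ e'' = 𝟙 _ ⊗≫ Q' ◁ e ▷ P' ⊗≫ e') (X Y : D) :
    (conjμ e (P' ⊗ (X ⊗ Q')) (P' ⊗ (Y ⊗ Q')) ≫ P ◁ (conjμ e' X Y ▷ Q)) ≫ conjMul m n (X ⊗ Y) =
      (conjMul m n X ⊗ₘ conjMul m n Y) ≫ conjμ e'' X Y := by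
  obtain ⟨w, hw⟩ : ∃ w, w = 𝟙 ((Q' ⊗ Q) ⊗ (P ⊗ P')) ⊗≫ Q' ◁ e ▷ P' ⊗≫ e' := ⟨_, rfl⟩
  rw [← hw] at h
  rw [MonoidalCategory.tensorHom_def]
  dsimp only [conjMul, conjμ]
  symm
  calc _ = 𝟙 _ ⊗≫ m ▷ (X ⊗ (Q' ⊗ Q) ⊗ (P ⊗ P') ⊗ Y ⊗ (Q' ⊗ Q)) ⊗≫
        (P'' ⊗ X) ◁ (n ▷ (P ⊗ P') ≫ Q'' ◁ m) ▷ (Y ⊗ (Q' ⊗ Q)) ⊗≫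
          (P'' ⊗ X) ◁ ((Q'' ⊗ P'') ◁ (Y ◁ n) ≫ e'' ▷ (Y ⊗ Q'')) ⊗≫ 𝟙 _ := by monoidal
    _ = 𝟙 _ ⊗≫ m ▷ (X ⊗ (Q' ⊗ Q) ⊗ (P ⊗ P') ⊗ Y ⊗ (Q' ⊗ Q)) ⊗≫
        (P'' ⊗ X) ◁ ((n ▷ (P ⊗ P') ≫ Q'' ◁ m) ≫ e'') ▷ (Y ⊗ (Q' ⊗ Q)) ⊗≫
          (P'' ⊗ X ⊗ Y) ◁ n ⊗≫ 𝟙 _ := by rw [whisker_exchange]; monoidal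
    _ = 𝟙 _ ⊗≫ (m ▷ (X ⊗ ((Q' ⊗ Q) ⊗ (P ⊗ P')) ⊗ Y ⊗ (Q' ⊗ Q)) ≫
        P'' ◁ (X ◁ w ▷ (Y ⊗ (Q' ⊗ Q)))) ⊗≫ (P'' ⊗ X ⊗ Y) ◁ n ⊗≫ 𝟙 _ := by rw [h]; monoidal
    _ = _ := by rw [← whisker_exchange, hw]; monoidal

lemma conjMul_unit {P P' P'' Q Q' Q'' : D} (m : P ⊗ P' ⟶ P'') (n : Q' ⊗ Q ⟶ Q'')
    (c : 𝟙_ D ⟶ P ⊗ Q) (c' : 𝟙_ D ⟶ P' ⊗ Q') (c'' : 𝟙_ D ⟶ P'' ⊗ Q'')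
    (h : c ⊗≫ P ◁ c' ▷ Q ⊗≫ m ▷ (Q' ⊗ Q) ≫ P'' ◁ n = c'') :
    ((c ≫ P ◁ (λ_ Q).inv) ≫ P ◁ ((c' ≫ P' ◁ (λ_ Q').inv) ▷ Q)) ≫ conjMul m n (𝟙_ D) =
      c'' ≫ P'' ◁ (λ_ Q'').inv := by
  dsimp only [conjMul]
  rw [← h]
  monoidal

lemma conjMul_comp {P P' P'' P₀ Q Q' Q'' Q₀ : D} (m : P ⊗ P' ⟶ P'') (n : Q' ⊗ Q ⟶ Q'')
    (a : P'' ⟶ P₀) (b : Q'' ⟶ Q₀) (X : D) :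
    conjMul m n X ≫ (a ⊗ₘ (X ◁ b)) = conjMul (m ≫ a) (n ≫ b) X := by
  rw [MonoidalCategory.tensorHom_def]
  dsimp only [conjMul]
  calc _ = 𝟙 _ ⊗≫ m ▷ (X ⊗ (Q' ⊗ Q)) ⊗≫ (P'' ◁ (X ◁ n) ≫ a ▷ (X ⊗ Q'')) ≫
      P₀ ◁ (X ◁ b) := by monoidal
    _ = _ := by rw [whisker_exchange]; monoidal

lemma conjMul_conjMul {P₁ P₂ P₃ P₁₂ P₂₃ P Q₁ Q₂ Q₃ Q₁₂ Q₂₃ Q : D}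
    (m₁₂ : P₁ ⊗ P₂ ⟶ P₁₂) (m₂₃ : P₂ ⊗ P₃ ⟶ P₂₃) (m : P₁₂ ⊗ P₃ ⟶ P) (m' : P₁ ⊗ P₂₃ ⟶ P)
    (n₁₂ : Q₂ ⊗ Q₁ ⟶ Q₁₂) (n₂₃ : Q₃ ⊗ Q₂ ⟶ Q₂₃) (n : Q₃ ⊗ Q₁₂ ⟶ Q) (n' : Q₂₃ ⊗ Q₁ ⟶ Q)
    (hm : m₁₂ ▷ P₃ ≫ m = (α_ P₁ P₂ P₃).hom ≫ P₁ ◁ m₂₃ ≫ m')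
    (hn : Q₃ ◁ n₁₂ ≫ n = (α_ Q₃ Q₂ Q₁).inv ≫ n₂₃ ▷ Q₁ ≫ n') (X : D) :
    conjMul m₁₂ n₁₂ (P₃ ⊗ (X ⊗ Q₃)) ≫ conjMul m n X =
      P₁ ◁ (conjMul m₂₃ n₂₃ X ▷ Q₁) ≫ conjMul m' n' X := by
  dsimp only [conjMul]
  calc _ = 𝟙 _ ⊗≫ m₁₂ ▷ (P₃ ⊗ X ⊗ Q₃ ⊗ Q₂ ⊗ Q₁) ⊗≫
        ((P₁₂ ⊗ P₃) ◁ (X ◁ (Q₃ ◁ n₁₂)) ≫ m ▷ (X ⊗ (Q₃ ⊗ Q₁₂))) ⊗≫ P ◁ (X ◁ n) := by monoidal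
    _ = 𝟙 _ ⊗≫ (m₁₂ ▷ P₃ ≫ m) ▷ (X ⊗ (Q₃ ⊗ Q₂ ⊗ Q₁)) ⊗≫ P ◁ (X ◁ (Q₃ ◁ n₁₂ ≫ n)) := by
        rw [whisker_exchange]; monoidal
    _ = 𝟙 _ ⊗≫ P₁ ◁ m₂₃ ▷ (X ⊗ Q₃ ⊗ Q₂ ⊗ Q₁) ⊗≫
        (m' ▷ (X ⊗ (Q₃ ⊗ Q₂) ⊗ Q₁) ≫ P ◁ (X ◁ (n₂₃ ▷ Q₁))) ⊗≫ P ◁ (X ◁ n') := by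
        rw [hm, hn]; monoidal
    _ = _ := by rw [← whisker_exchange]; monoidal

lemma conjMul_assoc {P₁ P₂ P₃ P₁₂ P₂₃ P₁₂₃ P Q₁ Q₂ Q₃ Q₁₂ Q₂₃ Q₁₂₃ Q : D}
    (m₁₂ : P₁ ⊗ P₂ ⟶ P₁₂) (m₂₃ : P₂ ⊗ P₃ ⟶ P₂₃) (m : P₁₂ ⊗ P₃ ⟶ P₁₂₃) (m' : P₁ ⊗ P₂₃ ⟶ P)
    (n₁₂ : Q₂ ⊗ Q₁ ⟶ Q₁₂) (n₂₃ : Q₃ ⊗ Q₂ ⟶ Q₂₃) (n : Q₃ ⊗ Q₁₂ ⟶ Q₁₂₃) (n' : Q₂₃ ⊗ Q₁ ⟶ Q)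
    (a : P₁₂₃ ⟶ P) (b : Q₁₂₃ ⟶ Q)
    (hm : m₁₂ ▷ P₃ ≫ m ≫ a = (α_ P₁ P₂ P₃).hom ≫ P₁ ◁ m₂₃ ≫ m')
    (hn : Q₃ ◁ n₁₂ ≫ n ≫ b = (α_ Q₃ Q₂ Q₁).inv ≫ n₂₃ ▷ Q₁ ≫ n') (X : D) :
    conjMul m₁₂ n₁₂ (P₃ ⊗ (X ⊗ Q₃)) ≫ conjMul m n X ≫ (a ⊗ₘ (X ◁ b)) =
      P₁ ◁ (conjMul m₂₃ n₂₃ X ▷ Q₁) ≫ conjMul m' n' X := by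
  rw [conjMul_comp]
  exact conjMul_conjMul _ _ _ _ _ _ _ _ hm hn X

/-- The morphism `X ⟶ P ⊗ X ⊗ Q` obtained from `p : I ⟶ P` and `q : I ⟶ Q`. -/
def conjUnit {P Q : D} (p : 𝟙_ D ⟶ P) (q : 𝟙_ D ⟶ Q) (X : D) : X ⟶ P ⊗ (X ⊗ Q) :=
  𝟙 _ ⊗≫ p ▷ X ⊗≫ P ◁ (X ◁ q)

lemma conjUnit_natural {P Q : D} (p : 𝟙_ D ⟶ P) (q : 𝟙_ D ⟶ Q) {X Y : D} (f : X ⟶ Y) :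
    f ≫ conjUnit p q Y = conjUnit p q X ≫ P ◁ (f ▷ Q) := by
  dsimp only [conjUnit]
  calc _ = 𝟙 _ ⊗≫ (𝟙_ D ◁ f ≫ p ▷ Y) ⊗≫ P ◁ (Y ◁ q) := by monoidal
    _ = 𝟙 _ ⊗≫ p ▷ X ⊗≫ P ◁ (f ▷ 𝟙_ D ≫ Y ◁ q) := by rw [whisker_exchange]; monoidal
    _ = _ := by rw [← whisker_exchange]; monoidal

lemma conjUnit_unit {P Q : D} (p : 𝟙_ D ⟶ P) (q : 𝟙_ D ⟶ Q) (c : 𝟙_ D ⟶ P ⊗ Q)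
    (h : p ⊗≫ P ◁ q = c) : conjUnit p q (𝟙_ D) = c ≫ P ◁ (λ_ Q).inv := by
  subst h
  dsimp only [conjUnit]
  monoidal

lemma conjUnit_tensor {P Q : D} (p : 𝟙_ D ⟶ P) (q : 𝟙_ D ⟶ Q) (e : Q ⊗ P ⟶ 𝟙_ D)
    (h : q ▷ 𝟙_ D ≫ Q ◁ p ≫ e = (λ_ (𝟙_ D)).hom) (X Y : D) :
    (conjUnit p q X ⊗ₘ conjUnit p q Y) ≫ conjμ e X Y = conjUnit p q (X ⊗ Y) := by
  rw [MonoidalCategory.tensorHom_def]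
  dsimp only [conjUnit, conjμ]
  calc _ = 𝟙 _ ⊗≫ p ▷ (X ⊗ Y) ⊗≫ (P ⊗ X) ◁ ((q ▷ 𝟙_ D) ≫ (Q ◁ p)) ▷ Y ⊗≫
        (P ⊗ X) ◁ ((Q ⊗ P) ◁ (Y ◁ q) ≫ e ▷ (Y ⊗ Q)) ⊗≫ 𝟙 _ := by monoidal
    _ = 𝟙 _ ⊗≫ p ▷ (X ⊗ Y) ⊗≫ (P ⊗ X) ◁ ((q ▷ 𝟙_ D) ≫ (Q ◁ p) ≫ e) ▷ Y ⊗≫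
        (P ⊗ X ⊗ Y) ◁ q ⊗≫ 𝟙 _ := by rw [whisker_exchange]; monoidal
    _ = _ := by rw [h]; monoidal

lemma conjUnit_conjMul {P P₁ P' Q Q₁ Q' : D} (p : 𝟙_ D ⟶ P₁) (q : 𝟙_ D ⟶ Q₁)
    (m : P₁ ⊗ P ⟶ P') (n : Q ⊗ Q₁ ⟶ Q') (a : P' ⟶ P) (b : Q' ⟶ Q)
    (hm : (λ_ P).hom = p ▷ P ≫ m ≫ a) (hn : (ρ_ Q).hom = Q ◁ q ≫ n ≫ b) (X : D) :
    𝟙 _ = conjUnit p q (P ⊗ (X ⊗ Q)) ≫ conjMul m n X ≫ (a ⊗ₘ (X ◁ b)) := by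
  rw [conjMul_comp]
  dsimp only [conjMul, conjUnit]
  symm
  calc _ = 𝟙 _ ⊗≫ p ▷ (P ⊗ X ⊗ Q) ⊗≫ ((P₁ ⊗ P) ◁ (X ◁ (Q ◁ q)) ≫
          (m ≫ a) ▷ (X ⊗ (Q ⊗ Q₁))) ⊗≫ P ◁ (X ◁ (n ≫ b)) := by monoidal
    _ = 𝟙 _ ⊗≫ (p ▷ P ≫ m ≫ a) ▷ (X ⊗ Q) ⊗≫ P ◁ (X ◁ (Q ◁ q ≫ n ≫ b)) := by
        rw [whisker_exchange]; monoidal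
    _ = _ := by rw [← hm, ← hn]; monoidal

lemma conjMul_conjUnit {P P₁ P' Q Q₁ Q' : D} (p : 𝟙_ D ⟶ P₁) (q : 𝟙_ D ⟶ Q₁)
    (m : P ⊗ P₁ ⟶ P') (n : Q₁ ⊗ Q ⟶ Q') (a : P' ⟶ P) (b : Q' ⟶ Q)
    (hm : (ρ_ P).hom = P ◁ p ≫ m ≫ a) (hn : (λ_ Q).hom = q ▷ Q ≫ n ≫ b) (X : D) :
    𝟙 _ = P ◁ (conjUnit p q X ▷ Q) ≫ conjMul m n X ≫ (a ⊗ₘ (X ◁ b)) := by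
  rw [conjMul_comp]
  dsimp only [conjMul, conjUnit]
  symm
  calc _ = 𝟙 _ ⊗≫ P ◁ p ▷ (X ⊗ Q) ⊗≫ ((P ⊗ P₁) ◁ (X ◁ (q ▷ Q)) ≫
          (m ≫ a) ▷ (X ⊗ (Q₁ ⊗ Q))) ⊗≫ P ◁ (X ◁ (n ≫ b)) := by monoidal
    _ = 𝟙 _ ⊗≫ (P ◁ p ≫ m ≫ a) ▷ (X ⊗ Q) ⊗≫ P ◁ (X ◁ (q ▷ Q ≫ n ≫ b)) := by
        rw [whisker_exchange]; monoidal
    _ = _ := by rw [← hm, ← hn]; monoidal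

instance {P Q : D} (e : Q ⊗ P ⟶ 𝟙_ D) [IsIso e] (X Y : D) : IsIso (conjμ e X Y) := by
  dsimp only [conjμ, monoidalComp]
  infer_instance

instance {P P' P'' Q Q' Q'' : D} (m : P ⊗ P' ⟶ P'') (n : Q' ⊗ Q ⟶ Q'') [IsIso m] [IsIso n]
    (X : D) : IsIso (conjMul m n X) := by
  dsimp only [conjMul, monoidalComp]
  infer_instance

instance {P Q : D} (p : 𝟙_ D ⟶ P) (q : 𝟙_ D ⟶ Q) [IsIso p] [IsIso q] (X : D) :
    IsIso (conjUnit p q X) := by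
  dsimp only [conjUnit, monoidalComp]
  infer_instance

/-- `conjμ` as an isomorphism. -/
abbrev conjμIso {P Q : D} (e : Q ⊗ P ⟶ 𝟙_ D) [IsIso e] (X Y : D) :
    (P ⊗ (X ⊗ Q)) ⊗ (P ⊗ (Y ⊗ Q)) ≅ P ⊗ ((X ⊗ Y) ⊗ Q) := asIso (conjμ e X Y)

/-- `conjMul` as an isomorphism. -/
abbrev conjMulIsoAux {P P' P'' Q Q' Q'' : D} (m : P ⊗ P' ⟶ P'') (n : Q' ⊗ Q ⟶ Q'') [IsIso m]
    [IsIso n] (X : D) : P ⊗ ((P' ⊗ (X ⊗ Q')) ⊗ Q) ≅ P'' ⊗ (X ⊗ Q'') := asIso (conjMul m n X)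

/-- `conjUnit` as an isomorphism. -/
abbrev conjUnitIsoAux {P Q : D} (p : 𝟙_ D ⟶ P) (q : 𝟙_ D ⟶ Q) [IsIso p] [IsIso q] (X : D) :
    X ≅ P ⊗ (X ⊗ Q) := asIso (conjUnit p q X)

end Aux

section Inverses

variable {G : Type*} [Group G] {D : Type*} [Category D] [MonoidalCategory D]

/-- The inverse of `g`, as an object of the discrete monoidal category of `G`. -/
abbrev ginv (g : Discrete G) : Discrete G := ⟨g.as⁻¹⟩

/-- The morphism `g⁻¹ ⟶ h⁻¹` for `g = h`. -/
abbrev invMap {g h : Discrete G} (f : g ⟶ h) : ginv g ⟶ ginv h :=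
  Discrete.eqToHom (congrArg Inv.inv (Discrete.eq_of_hom f))

variable (P : Discrete G ⥤ D) [P.Monoidal]

/-- The isomorphism `P a ⊗ P b ≅ P c` for `a * b = c`. -/
def mulIso {a b c : Discrete G} (h : a.as * b.as = c.as) : P.obj a ⊗ P.obj b ≅ P.obj c :=
  μIso P a b ≪≫ P.mapIso (Discrete.eqToIso h)

/-- The isomorphism `ev : P g⁻¹ ⊗ P g ≅ I`. -/
def evIso (g : Discrete G) : P.obj (ginv g) ⊗ P.obj g ≅ 𝟙_ D :=
  mulIso P (c := 𝟙_ (Discrete G)) (inv_mul_cancel g.as) ≪≫ (εIso P).symm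

/-- The isomorphism `coev : I ≅ P g ⊗ P g⁻¹`. -/
def coevIso (g : Discrete G) : 𝟙_ D ≅ P.obj g ⊗ P.obj (ginv g) :=
  εIso P ≪≫ (mulIso P (c := 𝟙_ (Discrete G)) (mul_inv_cancel g.as)).symm

/-- The isomorphism `P h⁻¹ ⊗ P g⁻¹ ≅ P (g h)⁻¹`. -/
def invMulIso (g h : Discrete G) : P.obj (ginv h) ⊗ P.obj (ginv g) ≅ P.obj (ginv (g ⊗ h)) :=
  mulIso P (mul_inv_rev g.as h.as).symm

/-- The isomorphism `I ≅ P 1⁻¹`. -/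
def invUnitIso : 𝟙_ D ≅ P.obj (ginv (𝟙_ (Discrete G))) :=
  εIso P ≪≫ P.mapIso (Discrete.eqToIso (inv_one (G := G)).symm)

lemma mulIso_rfl (a b : Discrete G) : (mulIso P (rfl : a.as * b.as = (a ⊗ b).as)).hom =
    μ P a b := by
  have : Discrete.eqToIso (rfl : a.as * b.as = (a ⊗ b).as) = Iso.refl (a ⊗ b) :=
    Iso.ext (Subsingleton.elim _ _)
  rw [mulIso, this, Iso.trans_hom, Functor.mapIso_refl]
  exact Category.comp_id _

lemma mulIso_assoc {a b c x y z : Discrete G} (hab : a.as * b.as = x.as)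
    (hxc : x.as * c.as = y.as) (hbc : b.as * c.as = z.as) (haz : a.as * z.as = y.as) :
    (mulIso P hab).hom ▷ P.obj c ≫ (mulIso P hxc).hom =
      (α_ _ _ _).hom ≫ P.obj a ◁ (mulIso P hbc).hom ≫ (mulIso P haz).hom := by
  obtain ⟨a⟩ := a
  obtain ⟨b⟩ := b
  obtain ⟨c⟩ := c
  obtain ⟨x⟩ := x
  obtain ⟨y⟩ := y
  obtain ⟨z⟩ := z
  dsimp only at hab hxc hbc haz
  subst hab hbc hxc
  have e₁ := mulIso_rfl P ⟨a⟩ ⟨b⟩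
  have e₂ := mulIso_rfl P (⟨a⟩ ⊗ ⟨b⟩) ⟨c⟩
  have e₃ := mulIso_rfl P ⟨b⟩ ⟨c⟩
  change (mulIso P _).hom ▷ P.obj ⟨c⟩ ≫ (mulIso P (a := ⟨a⟩ ⊗ ⟨b⟩) (c := (⟨a⟩ ⊗ ⟨b⟩) ⊗ ⟨c⟩) _).hom =
    _ ≫ P.obj ⟨a⟩ ◁ (mulIso P (c := ⟨b⟩ ⊗ ⟨c⟩) _).hom ≫
      (mulIso P (b := ⟨b⟩ ⊗ ⟨c⟩) (c := (⟨a⟩ ⊗ ⟨b⟩) ⊗ ⟨c⟩) _).hom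
  have := Functor.LaxMonoidal.associativity P ⟨a⟩ ⟨b⟩ ⟨c⟩
  rw [← cancel_mono (P.map (α_ (⟨a⟩ : Discrete G) ⟨b⟩ ⟨c⟩).hom)]
  rw [e₁, e₂, e₃]
  simp only [Category.assoc]
  rw [this]
  congr 2
  simp only [mulIso, Iso.trans_hom, Functor.mapIso_hom, Category.assoc, μIso_hom, ← P.map_comp]
  rw [Subsingleton.elim (_ ≫ _) (𝟙 _), P.map_id, Category.comp_id]

lemma mulIso_map_right {a b b' c c' : Discrete G} (hb : a.as * b.as = c.as)
    (hb' : a.as * b'.as = c'.as) (f : b ⟶ b') (f' : c ⟶ c') :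
    P.obj a ◁ P.map f ≫ (mulIso P hb').hom = (mulIso P hb).hom ≫ P.map f' := by
  simp only [mulIso, Iso.trans_hom, Functor.mapIso_hom, μIso_hom, Category.assoc, ← P.map_comp,
    μ_natural_right_assoc]
  exact congrArg _ (congrArg P.map (Subsingleton.elim _ _))

lemma mulIso_map_left {a a' b c c' : Discrete G} (hb : a.as * b.as = c.as)
    (hb' : a'.as * b.as = c'.as) (f : a ⟶ a') (f' : c ⟶ c') :
    P.map f ▷ P.obj b ≫ (mulIso P hb').hom = (mulIso P hb).hom ≫ P.map f' := by
  simp only [mulIso, Iso.trans_hom, Functor.mapIso_hom, μIso_hom, Category.assoc, ← P.map_comp,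
    μ_natural_left_assoc]
  exact congrArg _ (congrArg P.map (Subsingleton.elim _ _))

lemma mulIso_one_left (a : Discrete G) : ε P ▷ P.obj a ≫
    (mulIso P (a := 𝟙_ (Discrete G)) (one_mul a.as)).hom = (λ_ (P.obj a)).hom := by
  rw [Functor.LaxMonoidal.left_unitality, mulIso]
  rfl

lemma mulIso_one_right (a : Discrete G) : P.obj a ◁ ε P ≫
    (mulIso P (b := 𝟙_ (Discrete G)) (mul_one a.as)).hom = (ρ_ (P.obj a)).hom := by
  rw [Functor.LaxMonoidal.right_unitality, mulIso]
  rfl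

lemma coev_mulIso (g : Discrete G) :
    (coevIso P g).hom ≫ (mulIso P (c := 𝟙_ (Discrete G)) (mul_inv_cancel g.as)).hom = ε P := by
  simp [coevIso]

lemma ev_ε (g : Discrete G) :
    (evIso P g).hom ≫ ε P = (mulIso P (c := 𝟙_ (Discrete G)) (inv_mul_cancel g.as)).hom := by
  simp [evIso]

lemma ev_coev_left (g : Discrete G) : (coevIso P g).hom ▷ P.obj g ≫ (α_ _ _ _).hom ≫
    P.obj g ◁ (evIso P g).hom = (λ_ _).hom ≫ (ρ_ _).inv := by
  rw [← cancel_mono (ρ_ (P.obj g)).hom]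
  rw [← mulIso_one_right]
  simp only [Category.assoc]
  rw [← whiskerLeft_comp_assoc, ev_ε, ← mulIso_assoc P (mul_inv_cancel g.as) (one_mul g.as),
    ← comp_whiskerRight_assoc, coev_mulIso, mulIso_one_left, mulIso_one_right]
  simp

lemma ev_coev_right (g : Discrete G) : P.obj (ginv g) ◁ (coevIso P g).hom ≫ (α_ _ _ _).inv ≫
    (evIso P g).hom ▷ P.obj (ginv g) = (ρ_ _).hom ≫ (λ_ _).inv := by
  rw [← cancel_mono (λ_ (P.obj (ginv g))).hom]
  rw [← mulIso_one_left]
  simp only [Category.assoc]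
  rw [← comp_whiskerRight_assoc, ev_ε, mulIso_assoc P (inv_mul_cancel g.as) (one_mul (ginv g).as)
    (mul_inv_cancel g.as) (mul_one (ginv g).as), Iso.inv_hom_id_assoc,
    ← whiskerLeft_comp_assoc, coev_mulIso, mulIso_one_left, mulIso_one_right]
  simp

lemma invMul_ev (g h : Discrete G) :
    ((invMulIso P g h).hom ▷ (P.obj g ⊗ P.obj h) ≫ P.obj (ginv (g ⊗ h)) ◁ μ P g h) ≫
      (evIso P (g ⊗ h)).hom =
        𝟙 _ ⊗≫ P.obj (ginv h) ◁ (evIso P g).hom ▷ P.obj h ⊗≫ (evIso P h).hom := by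
  have h₁ : (ginv h).as * (ginv g).as = (ginv (g ⊗ h)).as := (mul_inv_rev g.as h.as).symm
  have e₁ := mulIso_assoc P (inv_mul_cancel g.as : (ginv g).as * g.as = (𝟙_ (Discrete G)).as)
    (one_mul h.as) (rfl : g.as * h.as = (g ⊗ h).as)
    (inv_mul_cancel_left g.as h.as : (ginv g).as * (g ⊗ h).as = h.as)
  have e₂ := mulIso_assoc P h₁ (inv_mul_cancel (g ⊗ h).as : _ = (𝟙_ (Discrete G)).as)
    (inv_mul_cancel_left g.as h.as : (ginv g).as * (g ⊗ h).as = h.as) (inv_mul_cancel h.as)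
  rw [← ev_ε P g, comp_whiskerRight, Category.assoc, mulIso_one_left] at e₁
  have e₃ : P.obj (ginv g) ◁ μ P g h ≫ (mulIso P (inv_mul_cancel_left g.as h.as :
      (ginv g).as * (g ⊗ h).as = h.as)).hom =
      (α_ _ _ _).inv ≫ (evIso P g).hom ▷ P.obj h ≫ (λ_ _).hom := by
    rw [e₁, Iso.inv_hom_id_assoc, mulIso_rfl]
  rw [← ev_ε] at e₂
  have e₄ : (invMulIso P g h).hom ▷ P.obj (g ⊗ h) ≫ (evIso P (g ⊗ h)).hom =
      (α_ _ _ _).hom ≫ P.obj (ginv h) ◁ (mulIso P (inv_mul_cancel_left g.as h.as :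
        (ginv g).as * (g ⊗ h).as = h.as)).hom ≫ (evIso P h).hom := by
    rw [← cancel_mono (ε P)]
    simp only [Category.assoc, ev_ε P h]
    exact e₂
  rw [← whisker_exchange, Category.assoc, e₄]
  calc _ = 𝟙 _ ⊗≫ P.obj (ginv h) ◁ (P.obj (ginv g) ◁ μ P g h ≫ (mulIso P (inv_mul_cancel_left
        g.as h.as : (ginv g).as * (g ⊗ h).as = h.as)).hom) ≫ (evIso P h).hom := by monoidal
    _ = _ := by rw [e₃]; monoidal

lemma coev_mul (g h : Discrete G) :
    (coevIso P g).hom ⊗≫ P.obj g ◁ (coevIso P h).hom ▷ P.obj (ginv g) ⊗≫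
      μ P g h ▷ (P.obj (ginv h) ⊗ P.obj (ginv g)) ≫ P.obj (g ⊗ h) ◁ (invMulIso P g h).hom =
        (coevIso P (g ⊗ h)).hom := by
  have e₁ := mulIso_assoc P (rfl : g.as * h.as = (g ⊗ h).as)
    (mul_inv_cancel_right g.as h.as : (g ⊗ h).as * (ginv h).as = g.as)
    (mul_inv_cancel h.as : h.as * (ginv h).as = (𝟙_ (Discrete G)).as) (mul_one g.as)
  have e₂ := mulIso_assoc P (a := g ⊗ h) (b := ginv h) (c := ginv g)
    (mul_inv_cancel_right g.as h.as : (g ⊗ h).as * (ginv h).as = g.as)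
    (mul_inv_cancel g.as : g.as * (ginv g).as = (𝟙_ (Discrete G)).as)
    ((mul_inv_rev g.as h.as).symm : (ginv h).as * (ginv g).as = (ginv (g ⊗ h)).as)
    (mul_inv_cancel (g ⊗ h).as)
  rw [mulIso_rfl] at e₁
  have e₃ : P.obj g ◁ (coevIso P h).hom ≫ (α_ _ _ _).inv ≫ μ P g h ▷ P.obj (ginv h) ≫
      (mulIso P (mul_inv_cancel_right g.as h.as : (g ⊗ h).as * (ginv h).as = g.as)).hom =
        (ρ_ _).hom := by
    rw [e₁, Iso.inv_hom_id_assoc, ← whiskerLeft_comp_assoc, coev_mulIso, mulIso_one_right]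
  rw [← cancel_mono (mulIso P (c := 𝟙_ (Discrete G)) (mul_inv_cancel (g ⊗ h).as)).hom,
    coev_mulIso]
  calc _ = (coevIso P g).hom ⊗≫ P.obj g ◁ (coevIso P h).hom ▷ P.obj (ginv g) ⊗≫
      μ P g h ▷ (P.obj (ginv h) ⊗ P.obj (ginv g)) ⊗≫ ((α_ _ _ _).hom ≫
        P.obj (g ⊗ h) ◁ (mulIso P ((mul_inv_rev g.as h.as).symm :
          (ginv h).as * (ginv g).as = (ginv (g ⊗ h)).as)).hom ≫ 
          (mulIso P (c := 𝟙_ (Discrete G)) (mul_inv_cancel (g ⊗ h).as)).hom) := by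
        rw [invMulIso]; monoidal
    _ = (coevIso P g).hom ⊗≫ (P.obj g ◁ (coevIso P h).hom ≫ (α_ _ _ _).inv ≫
        μ P g h ▷ P.obj (ginv h) ≫ (mulIso P (mul_inv_cancel_right g.as h.as :
          (g ⊗ h).as * (ginv h).as = g.as)).hom) ▷ P.obj (ginv g) ≫
          (mulIso P (mul_inv_cancel g.as :
            g.as * (ginv g).as = (𝟙_ (Discrete G)).as)).hom := by
        rw [← e₂]; monoidal
    _ = (coevIso P g).hom ≫ (mulIso P (mul_inv_cancel g.as :
            g.as * (ginv g).as = (𝟙_ (Discrete G)).as)).hom := by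
        rw [e₃]; monoidal
    _ = _ := coev_mulIso P g

lemma coev_one : ε P ⊗≫ P.obj (𝟙_ _) ◁ (invUnitIso P).hom =
    (coevIso P (𝟙_ (Discrete G))).hom := by
  have e : P.obj (𝟙_ _) ◁ (invUnitIso P).hom ≫ (mulIso P (c := 𝟙_ (Discrete G))
      (mul_inv_cancel (𝟙_ (Discrete G)).as)).hom = (ρ_ _).hom := by
    rw [← mulIso_one_right P (𝟙_ (Discrete G)), invUnitIso, Iso.trans_hom, whiskerLeft_comp,
      Category.assoc, Functor.mapIso_hom, mulIso_map_right P (mul_one _) _ _ (𝟙 _), P.map_id,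
      Category.comp_id, εIso_hom]
  rw [← cancel_mono (mulIso P (c := 𝟙_ (Discrete G))
    (mul_inv_cancel (𝟙_ (Discrete G)).as)).hom, coev_mulIso]
  calc _ = ε P ≫ (ρ_ _).inv ≫ P.obj (𝟙_ _) ◁ (invUnitIso P).hom ≫
      (mulIso P (c := 𝟙_ (Discrete G)) (mul_inv_cancel (𝟙_ (Discrete G)).as)).hom := by monoidal
    _ = _ := by rw [e]; simp

lemma invUnit_ev : (invUnitIso P).hom ▷ 𝟙_ D ≫ P.obj (ginv (𝟙_ _)) ◁ ε P ≫
    (evIso P (𝟙_ (Discrete G))).hom = (λ_ (𝟙_ D)).hom := by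
  rw [← cancel_mono (ε P), Category.assoc, Category.assoc, ev_ε, ← whisker_exchange_assoc,
    invUnitIso, Iso.trans_hom, comp_whiskerRight, Category.assoc, Functor.mapIso_hom,
    mulIso_map_left P (one_mul _) _ _ (𝟙 _), P.map_id, Category.comp_id, εIso_hom,
    mulIso_one_left, leftUnitor_naturality]

lemma ε_mul (g : Discrete G) :
    (λ_ (P.obj g)).hom = ε P ▷ P.obj g ≫ μ P (𝟙_ _) g ≫ P.map (λ_ g).hom :=
  Functor.LaxMonoidal.left_unitality P g

lemma mul_ε (g : Discrete G) :
    (ρ_ (P.obj g)).hom = P.obj g ◁ ε P ≫ μ P g (𝟙_ _) ≫ P.map (ρ_ g).hom :=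
  Functor.LaxMonoidal.right_unitality P g

lemma mul_invUnit (g : Discrete G) :
    (ρ_ (P.obj (ginv g))).hom = P.obj (ginv g) ◁ (invUnitIso P).hom ≫
      (invMulIso P (𝟙_ _) g).hom ≫ P.map (invMap (λ_ g).hom) := by
  rw [← mulIso_one_right, invUnitIso, invMulIso, Iso.trans_hom, whiskerLeft_comp,
      Category.assoc, Functor.mapIso_hom, ← Category.assoc (P.obj (ginv g) ◁ P.map _),
      mulIso_map_right P (mul_one _) _ _ (invMap (λ_ g).inv), Category.assoc, ← P.map_comp,
      Subsingleton.elim (_ ≫ _) (𝟙 _), P.map_id,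
      Category.comp_id, εIso_hom]

lemma invUnit_mul (g : Discrete G) :
    (λ_ (P.obj (ginv g))).hom = (invUnitIso P).hom ▷ P.obj (ginv g) ≫
      (invMulIso P g (𝟙_ _)).hom ≫ P.map (invMap (ρ_ g).hom) := by
  rw [← mulIso_one_left, invUnitIso, invMulIso, Iso.trans_hom, comp_whiskerRight,
      Category.assoc, Functor.mapIso_hom, ← Category.assoc (P.map _ ▷ P.obj (ginv g)),
      mulIso_map_left P (one_mul _) _ _ (invMap (ρ_ g).inv), Category.assoc, ← P.map_comp,
      Subsingleton.elim (_ ≫ _) (𝟙 _), P.map_id,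
      Category.comp_id, εIso_hom]

lemma invMul_assoc (g h l : Discrete G) :
    P.obj (ginv l) ◁ (invMulIso P g h).hom ≫ (invMulIso P (g ⊗ h) l).hom ≫
      P.map (invMap (α_ g h l).hom) = (α_ _ _ _).inv ≫
        (invMulIso P h l).hom ▷ P.obj (ginv g) ≫ (invMulIso P g (h ⊗ l)).hom := by
  have e : (ginv l).as * (ginv (g ⊗ h)).as = (ginv (g ⊗ h ⊗ l)).as := by simp [mul_assoc]
  have e₁ := mulIso_assoc P (a := ginv l) (b := ginv h) (c := ginv g) (z := ginv (g ⊗ h))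
    (mul_inv_rev h.as l.as).symm (mul_inv_rev g.as (h ⊗ l).as).symm
    (mul_inv_rev g.as h.as).symm e
  have e₂ := mulIso_map_right P (a := ginv l) (mul_inv_rev (g ⊗ h).as l.as).symm e (𝟙 _)
    (invMap (α_ g h l).hom)
  rw [P.map_id, MonoidalCategory.whiskerLeft_id, Category.id_comp] at e₂
  rw [invMulIso, invMulIso, invMulIso, invMulIso, ← e₂]
  exact ((Iso.inv_comp_eq _).2 e₁).symm

lemma map_tensor_ev {g h : Discrete G} (f : g ⟶ h) :
    (P.map (invMap f) ▷ P.obj g ≫ P.obj (ginv h) ◁ P.map f) ≫ (evIso P h).hom =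
      (evIso P g).hom := by
  obtain rfl : g = h := Discrete.ext (Discrete.eq_of_hom f)
  rw [Subsingleton.elim (invMap f) (𝟙 _), Subsingleton.elim f (𝟙 _)]
  simp

end Inverses

section InnerAction

universe v u

variable {k : Type*} [Field k] {G : Type*} [Group G]
  {D : Type u} [Category.{v} D] [Preadditive D] [Linear k D] [MonoidalCategory D]
  [MonoidalPreadditive D] [MonoidalLinear k D]

variable (P : Discrete G ⥤ D)

/-- The functor `X ↦ P g ⊗ X ⊗ P g⁻¹`. -/
@[simps] def conjFunctor (g : Discrete G) : D ⥤ D where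
  obj X := P.obj g ⊗ (X ⊗ P.obj (ginv g))
  map f := P.obj g ◁ (f ▷ P.obj (ginv g))

lemma conjFunctor_additive (g : Discrete G) : (conjFunctor P g).Additive where
  map_add {_ _ a b} := by
    change P.obj g ◁ ((a + b) ▷ P.obj (ginv g)) =
      P.obj g ◁ (a ▷ P.obj (ginv g)) + P.obj g ◁ (b ▷ P.obj (ginv g))
    simp

lemma conjFunctor_linear (g : Discrete G) : (conjFunctor P g).Linear k where
  map_smul a r := by
    change P.obj g ◁ ((r • a) ▷ P.obj (ginv g)) = r • P.obj g ◁ (a ▷ P.obj (ginv g))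
    simp

variable [P.Monoidal]

/-- The tensor structure of conjugation: the tensor product of `P g ⊗ X ⊗ P g⁻¹` and
`P g ⊗ Y ⊗ P g⁻¹` is identified with `P g ⊗ (X ⊗ Y) ⊗ P g⁻¹` by means of `ev`, and the unit with
`P g ⊗ I ⊗ P g⁻¹` by means of `coev`. -/
instance (g : Discrete G) : (conjFunctor P g).Monoidal := Functor.CoreMonoidal.toMonoidal
  { εIso := coevIso P g ≪≫ whiskerLeftIso _ (λ_ _).symm
    μIso X Y := conjμIso (evIso P g).hom X Y
    μIso_hom_natural_left f Y := conjμ_natural_left _ f Y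
    μIso_hom_natural_right X f := conjμ_natural_right _ X f
    associativity X Y Z := conjμ_assoc _ X Y Z
    left_unitality X := conjμ_leftUnit _ _ (ev_coev_left P g) X
    right_unitality X := conjμ_rightUnit _ _ (ev_coev_right P g) X }

variable (k) in
/-- The inner tensor autoequivalence `X ↦ P g ⊗ X ⊗ P g⁻¹`. -/
@[simps toFunctor] def conj (g : Discrete G) : TensorFunctor k D D where
  toFunctor := conjFunctor P g
  additive := conjFunctor_additive P g
  linear := conjFunctor_linear P g

lemma conj_ε (g : Discrete G) : ε (conj k P g).toFunctor =
    (coevIso P g).hom ≫ P.obj g ◁ (λ_ (P.obj (ginv g))).inv := rfl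

lemma conj_μ (g : Discrete G) (X Y : D) : μ (conj k P g).toFunctor X Y =
    conjμ (evIso P g).hom X Y := rfl

variable (k) in
/-- The isomorphism `P g ⊗ (P h ⊗ X ⊗ P h⁻¹) ⊗ P g⁻¹ ≅ P (g h) ⊗ X ⊗ P (g h)⁻¹`. -/
def conjMulIso (g h : Discrete G) : conj k P g ⊗ conj k P h ≅ conj k P (g ⊗ h) :=
  TensorFunctor.isoMk
    (NatIso.ofComponents (F := conjFunctor P h ⋙ conjFunctor P g) (G := conjFunctor P (g ⊗ h))
      (fun X => conjMulIsoAux (μ P g h) (invMulIso P g h).hom X)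
      (fun f => conjMul_natural _ _ f))
    { unit := conjMul_unit _ _ _ _ _ (coev_mul P g h)
      tensor X Y := conjMul_tensor _ _ _ _ _ (invMul_ev P g h) X Y }

variable (k) in
/-- The isomorphism `X ≅ P 1 ⊗ X ⊗ P 1⁻¹`. -/
def conjUnitIso : 𝟙_ (TensorFunctor k D D) ≅ conj k P (𝟙_ (Discrete G)) :=
  TensorFunctor.isoMk
    (NatIso.ofComponents (F := 𝟭 D) (G := conjFunctor P (𝟙_ (Discrete G)))
      (fun X => conjUnitIsoAux (ε P) (invUnitIso P).hom X)
      (fun f => conjUnit_natural _ _ f))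
    { unit := (Category.id_comp _).trans (conjUnit_unit _ _ _ (coev_one P))
      tensor X Y := (Category.id_comp _).trans (conjUnit_tensor _ _ _ (invUnit_ev P) X Y).symm }

variable (k) in
/-- Conjugation as a functor from the discrete category of `G`. -/
def conjugation : Discrete G ⥤ TensorFunctor k D D where
  obj := conj k P
  map {g h} f := eqToHom (congrArg (conj k P) (Discrete.ext (Discrete.eq_of_hom f)))

lemma conjugation_map_app {g h : Discrete G} (f : g ⟶ h) (X : D) :
    ((conjugation k P).map f).hom.app X = P.map f ⊗ₘ (X ◁ P.map (invMap f)) := by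
  obtain rfl : g = h := Discrete.ext (Discrete.eq_of_hom f)
  rw [Subsingleton.elim (invMap f) (𝟙 _), Subsingleton.elim f (𝟙 _), P.map_id, P.map_id,
    (conjugation k P).map_id]
  simp
  rfl

instance : (conjugation k P).Monoidal := Functor.CoreMonoidal.toMonoidal
  { εIso := conjUnitIso k P
    μIso := conjMulIso k P
    μIso_hom_natural_left {g g'} f h := by
      obtain rfl : g = g' := Discrete.ext (Discrete.eq_of_hom f)
      rw [Subsingleton.elim f (𝟙 _)]
      simp
    μIso_hom_natural_right {g g'} h f := by
      obtain rfl : g = g' := Discrete.ext (Discrete.eq_of_hom f)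
      rw [Subsingleton.elim f (𝟙 _)]
      simp
    associativity g h l := TensorFunctor.hom_ext fun X => by
      refine Eq.trans ?_ ((conjMul_assoc (μ P g h) (μ P h l) _ _ _ _ _ _ _ _
        (Functor.LaxMonoidal.associativity P g h l) (invMul_assoc P g h l) X).trans ?_)
      · change conjMul _ _ _ ≫ conjMul _ _ _ ≫ ((conjugation k P).map _).hom.app X = _
        rw [conjugation_map_app]
        rfl
      · exact (Category.id_comp _).symm
    left_unitality g := TensorFunctor.hom_ext fun X => by
      refine (conjUnit_conjMul _ _ _ _ _ _ (ε_mul P g) (mul_invUnit P g) X).trans ?_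
      rw [← conjugation_map_app (k := k)]
      rfl
    right_unitality g := TensorFunctor.hom_ext fun X => by
      refine (conjMul_conjUnit _ _ _ _ _ _ (mul_ε P g) (invUnit_mul P g) X).trans ?_
      rw [← conjugation_map_app (k := k)]
      rfl }

variable (k) in
/-- The inner action of `G` on `D` by conjugation with the invertible objects `P g`. -/
def innerAction : GroupAction k G D where
  toFunctor := conjugation k P

end InnerAction

end Conjugation

section Pairs

/-- The tensor category `V(G)` of finite-dimensional `G`-graded vector spaces: the additive
envelope of the linear category whose objects are the one-dimensional spaces in degree `g`. -/
abbrev GradedVect (k : Type*) [Field k] (G : Type*) [Group G] := Mat_ (LinearDiscrete k G)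

/-- The one-dimensional spaces `δ g` in degree `g`, as a functor from the discrete monoidal
category of `G`. -/
abbrev delta (k : Type*) [Field k] (G : Type*) [Group G] : Discrete G ⥤ GradedVect k G :=
  LinearDiscrete.ofDiscrete k G ⋙ Mat_.embedding (LinearDiscrete k G)

section DeligneProduct

variable (k : Type*) [Field k]
  (C : Type*) [Category C] [Preadditive C] [Linear k C]
  (D : Type*) [Category D] [Preadditive D] [Linear k D]

/-- The product `C ⊠ D` of semisimple `k`-linear categories over an algebraically closed field
`k`: the objects are the finite direct sums of objects `X ⊠ Y`, and
`Hom (X ⊠ Y) (X' ⊠ Y') = Hom X X' ⊗ Hom Y Y'`. -/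
abbrev DeligneProduct := Mat_ (LinearProduct k C D)

variable [MonoidalCategory C] [MonoidalPreadditive C] [MonoidalLinear k C]
  [MonoidalCategory D] [MonoidalPreadditive D] [MonoidalLinear k D]

namespace DeligneProduct

/-- The tensor functor `X ↦ X ⊠ I`. -/
@[simps toFunctor] def inl : TensorFunctor k C (DeligneProduct k C D) where
  toFunctor := LinearProduct.inl k C D ⋙ Mat_.embedding (LinearProduct k C D)

/-- The tensor functor `Y ↦ I ⊠ Y`. -/
@[simps toFunctor] def inr : TensorFunctor k D (DeligneProduct k C D) where
  toFunctor := LinearProduct.inr k C D ⋙ Mat_.embedding (LinearProduct k C D)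

variable {C D}

/-- The canonical isomorphism `(X ⊠ I) ⊗ (I ⊠ Y) ≅ X ⊠ Y ≅ (I ⊠ Y) ⊗ (X ⊠ I)`. -/
def exchange (X : C) (Y : D) : (inl k C D).obj X ⊗ (inr k C D).obj Y ≅
    (inr k C D).obj Y ⊗ (inl k C D).obj X :=
  μIso (Mat_.embedding (LinearProduct k C D)) _ _ ≪≫
    (Mat_.embedding (LinearProduct k C D)).mapIso
      (LinearProduct.isoMk ((ρ_ X) ≪≫ (λ_ X).symm) ((λ_ Y) ≪≫ (ρ_ Y).symm)) ≪≫
    (μIso (Mat_.embedding (LinearProduct k C D)) _ _).symm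

end DeligneProduct

end DeligneProduct

variable {k : Type*} [Field k] {C : Type*} [Category C] [Preadditive C] [Linear k C]
  [MonoidalCategory C] {G : Type*} [Group G]
  {D : Type*} [Category D] [Preadditive D] [Linear k D] [MonoidalCategory D]
  [MonoidalPreadditive D] [MonoidalLinear k D]

/-- The action of `G` on `D` by conjugation with the images of the invertible objects `δ g` under
a tensor functor `V(G) ⥤ D`. -/
abbrev conjugationAction (F : TensorFunctor k (GradedVect k G) D) : GroupAction k G D :=
  innerAction k (delta k G ⋙ F.toFunctor)

variable (k C G D) in
/-- A tensor functor `F : V(G) ⥤ D` together with a tensor functor `H : C ⥤ D^G` to the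
equivariant objects for the action by conjugation with the `F (δ g)`. -/
structure EquivariantPair where
  fst : TensorFunctor k (GradedVect k G) D
  snd : TensorFunctor k C (EquivariantObj (conjugationAction fst))

namespace EquivariantPair

/-- The tensor functor `C ⥤ D^G ⥤ D`. -/
abbrev underlying (p : EquivariantPair k C G D) : TensorFunctor k C D :=
  p.snd.comp (EquivariantObj.forget (conjugationAction p.fst))

/-- The invertible object `F (δ g)`. -/
abbrev pt (p : EquivariantPair k C G D) (g : Discrete G) : D :=
  (delta k G ⋙ p.fst.toFunctor).obj g

/-- The equivariant structure `H X ≅ F (δ g) ⊗ H X ⊗ F (δ g⁻¹)`. -/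
def str (p : EquivariantPair k C G D) (X : C) (g : Discrete G) :
    p.underlying.obj X ≅ p.pt g ⊗ (p.underlying.obj X ⊗ p.pt (ginv g)) :=
  (p.snd.obj X).iso g

/-- The morphism `H X ⊗ F (δ g) ⟶ F (δ g) ⊗ H X ⊗ F (δ g⁻¹) ⊗ F (δ g) ⟶ F (δ g) ⊗ H X`
corresponding to the equivariant structure. -/
def halfBraiding (p : EquivariantPair k C G D) (X : C) (g : Discrete G) :
    p.underlying.obj X ⊗ p.pt g ⟶ p.pt g ⊗ p.underlying.obj X :=
  (p.str X g).hom ▷ p.pt g ⊗≫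
    (p.pt g ⊗ p.underlying.obj X) ◁ (evIso (delta k G ⋙ p.fst.toFunctor) g).hom ≫ (ρ_ _).hom

/-- A morphism of pairs: tensor transformations `α : F ⟶ F'` and `β : H ⟶ H'` (after forgetting
the equivariant structures) which are compatible with the equivariant structures. -/
@[ext]
structure Hom (p q : EquivariantPair k C G D) where
  fst : p.fst ⟶ q.fst
  snd : p.underlying ⟶ q.underlying
  comm (X : C) (g : Discrete G) :
    (p.str X g).hom ≫ (fst.hom.app ((delta k G).obj g) ⊗ₘ
      (snd.hom.app X ⊗ₘ fst.hom.app ((delta k G).obj (ginv g)))) =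
        snd.hom.app X ≫ (q.str X g).hom

instance : Category (EquivariantPair k C G D) where
  Hom := Hom
  id p := ⟨𝟙 _, 𝟙 _, fun X g => by
    change (p.str X g).hom ≫ (𝟙 (p.pt g) ⊗ₘ (𝟙 (p.underlying.obj X) ⊗ₘ 𝟙 (p.pt (ginv g)))) =
      𝟙 (p.underlying.obj X) ≫ (p.str X g).hom
    simp⟩
  comp a b := ⟨a.fst ≫ b.fst, a.snd ≫ b.snd, fun X g => by
    simp only [TensorFunctor.comp_hom, NatTrans.comp_app, ← tensorHom_comp_tensorHom]
    rw [← Category.assoc, a.comm, Category.assoc, b.comm, Category.assoc]⟩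

variable (k C G D) in
/-- The functor `(F, H) ↦ F`. -/
@[simps] def fstFunctor : EquivariantPair k C G D ⥤ TensorFunctor k (GradedVect k G) D where
  obj p := p.fst
  map a := a.fst

variable (k C G D) in
/-- The functor which maps `(F, H)` to the tensor functor `C ⥤ D^G ⥤ D`. -/
@[simps] def underlyingFunctor : EquivariantPair k C G D ⥤ TensorFunctor k C D where
  obj p := p.underlying
  map a := a.snd

end EquivariantPair

/-- A fusion category: a semisimple tensor category with finite-dimensional spaces of morphisms,
finitely many isomorphism classes of simple objects, and simple unit object. -/
structure IsFusion (k : Type*) [Field k] (C : Type*) [Category C] [Abelian C] [Linear k C]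
    [MonoidalCategory C] : Prop where
  finite_hom (X Y : C) : Module.Finite k (X ⟶ Y)
  semisimple (X : C) : ∃ (n : ℕ) (S : Fin n → C) (_ : HasBiproduct S),
    (∀ i, Simple (S i)) ∧ Nonempty (X ≅ ⨁ S)
  finite_simple : ∃ (n : ℕ) (S : Fin n → C), ∀ X : C, Simple X → ∃ i, Nonempty (X ≅ S i)
  simple_unit : Simple (𝟙_ C)

end Pairs

end TensorCategory

end

open TensorCategory

open CategoryTheory MonoidalCategory Limits
open scoped TensorProduct
noncomputable section
namespace TensorCategory
open Functor.LaxMonoidal Functor.OplaxMonoidal Functor.Monoidal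

/-! A tensor functor `Φ` on `C ⊠ V(G)` is governed by its restrictions `H` to `C` and `F` to `V(G)`,
because `X ⊠ M` is the product of `X ⊠ I` and `I ⊠ M`. The only further information in `Φ` is the
isomorphism `H X ⊗ F M ≅ F M ⊗ H X` that comes from the canonical exchange of `X ⊠ I` and `I ⊠ M`.
It is natural and multiplicative in both variables: a `Commutation`. Conversely, for such a
commutation `X ⊠ M ↦ H X ⊗ F M` is a tensor functor. Its tensorator exchanges the two middle factors
of `(H X ⊗ F M) ⊗ (H X' ⊗ F M')`, and its axioms follow from `midExchange_natural`,
`midExchange_assoc` and the multiplicativity of the commutation. Compatibility with units need not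
be assumed, since it follows from multiplicativity and invertibility (`unit_of_hexagon_left`). The
outcome is `CommutingPair.equivalence`.

On `V(G)` a commutation is determined by its values at the objects `δ g`: every graded space is a
direct sum of these, and the morphisms between them are scalars (`Commutation.extendDelta`). As `F
(δ g⁻¹)` is dual to `F (δ g)`, bending a strand turns a braiding `H X ⊗ F (δ g) ⟶ F (δ g) ⊗ H X`
into a morphism `H X ⟶ F (δ g) ⊗ H X ⊗ F (δ g⁻¹)` and back. The operations `braidOfStr` and
`strOfBraid` are mutually inverse by the two zigzag identities. Under this dictionary
multiplicativity in `g` is the condition on `x_{gh}`, naturality in `X` says that the morphisms `H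
f` are equivariant, and multiplicativity in `X` says that the tensor structure of `H` is
equivariant. A commutation is thus the same as a lift of `H` to `D^G`.

Finally, `C ⊠ V(G)` is the additive envelope of the category of objects `X ⊠ M`. As `D` has finite
direct sums, tensor functors and their transformations extend uniquely from a category to its
additive envelope (`Mat.restriction` is an equivalence). The equivalence of the theorem is the
composite of these three, and the formula for the half-braiding holds because the exchange
isomorphism is carried along at each stage (`halfBraiding_comp_μ`). -/

section AdditiveEnvelopeExtension

/-! ### Additive envelopes: direct sum decompositions and extension of transformations. -/

namespace Mat

variable {T : Type*} [Category T] [Preadditive T]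

/-- The inclusion of a member of a family. -/
def incl (M : Mat_ T) (i : M.ι) : (Mat_.embedding T).obj (M.X i) ⟶ M :=
  fun _ j => (𝟙 M : Mat_.Hom M M) i j

/-- The projection to a member of a family. -/
def proj (M : Mat_ T) (i : M.ι) : M ⟶ (Mat_.embedding T).obj (M.X i) :=
  fun j _ => (𝟙 M : Mat_.Hom M M) j i

lemma incl_comp_apply {M N : Mat_ T} (f : M ⟶ N) (i : M.ι) (u) (j : N.ι) :
    (incl M i ≫ f) u j = f i j := by
  conv_rhs => rw [← Category.id_comp f]
  rfl

lemma comp_proj_apply {M N : Mat_ T} (f : M ⟶ N) (i : M.ι) (j : N.ι) (u) :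
    (f ≫ proj N j) i u = f i j := by
  conv_rhs => rw [← Category.comp_id f]
  rfl

/-- Turns single entries into composites in the envelope, so that naturality known only on `T` can
be applied to a matrix entry by entry. -/
lemma incl_comp_proj {M N : Mat_ T} (f : M ⟶ N) (i : M.ι) (j : N.ι) :
    incl M i ≫ f ≫ proj N j = (Mat_.embedding T).map (f i j) :=
  Mat_.hom_ext _ _ fun u v => by
    rw [incl_comp_apply, comp_proj_apply]
    rfl

lemma sum_apply {M N : Mat_ T} {ι : Type*} (s : Finset ι) (f : ι → (M ⟶ N)) (i : M.ι) (j : N.ι) :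
    (∑ l ∈ s, f l : M ⟶ N) i j = ∑ l ∈ s, f l i j :=
  map_sum (⟨⟨fun f => f i j, rfl⟩, fun _ _ => rfl⟩ : (M ⟶ N) →+ (M.X i ⟶ N.X j)) f s

/-- A family is the direct sum of its members. This resolution of the identity is behind all the
extension and uniqueness statements for additive functors that follow. -/
lemma proj_comp_incl_sum (M : Mat_ T) : ∑ i, proj M i ≫ incl M i = 𝟙 M := by
  refine Mat_.hom_ext _ _ fun i j => ?_
  have h (l : M.ι) : (proj M l ≫ incl M l) i j =
      (𝟙 M : Mat_.Hom M M) i l ≫ (𝟙 M : Mat_.Hom M M) l j := by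
    rw [Mat_.comp_apply]
    exact Finset.sum_singleton _ PUnit.unit
  rw [sum_apply, Finset.sum_congr rfl (fun l _ => h l)]
  exact congrFun (congrFun (Category.id_comp (𝟙 M)) i) j

section

variable {E : Type*} [Category E] [Preadditive E]

lemma map_proj_comp_incl_sum (F : Mat_ T ⥤ E) [F.Additive] (M : Mat_ T) :
    ∑ i, F.map (proj M i) ≫ F.map (incl M i) = 𝟙 (F.obj M) := by
  simp only [← F.map_comp, ← F.map_sum, proj_comp_incl_sum, F.map_id]

/-- An additive functor preserves the resolution of the identity, so the images of the inclusions
are jointly epimorphic. -/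
lemma hom_ext_incl (F : Mat_ T ⥤ E) [F.Additive] {M : Mat_ T} {Z : E} {f g : F.obj M ⟶ Z}
    (h : ∀ i, F.map (incl M i) ≫ f = F.map (incl M i) ≫ g) : f = g := by
  rw [← Category.id_comp f, ← Category.id_comp g, ← map_proj_comp_incl_sum F]
  simp only [Preadditive.sum_comp, Category.assoc, h]

/-- Two natural transformations of additive functors on the additive envelope of `T` agree if they
agree on `T`. -/
lemma natTrans_ext {F F' : Mat_ T ⥤ E} [F.Additive] {a b : F ⟶ F'}
    (h : ∀ X : T, a.app ((Mat_.embedding T).obj X) = b.app ((Mat_.embedding T).obj X)) :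
    a = b := by
  ext M
  refine hom_ext_incl F fun i => ?_
  rw [a.naturality, b.naturality, h]

variable {F F' F'' : Mat_ T ⥤ E} [F.Additive] [F'.Additive] [F''.Additive]

/-- The extension of a natural transformation from `T` to its additive envelope. -/
@[simps] def extend (a : Mat_.embedding T ⋙ F ⟶ Mat_.embedding T ⋙ F') : F ⟶ F' where
  app M := ∑ i, F.map (proj M i) ≫ a.app (M.X i) ≫ F'.map (incl M i)
  naturality {M N} f := by
    refine hom_ext_incl F fun i => ?_
    have h₁ (l : M.ι) : F.map (incl M i) ≫ F.map (proj M l) ≫ a.app (M.X l) ≫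
        F'.map (incl M l) ≫ F'.map f = a.app (M.X i) ≫ F'.map (incl M i) ≫
          F'.map (proj M l) ≫ F'.map (incl M l) ≫ F'.map f := by
      -- The entry `(i, l)` of the identity matrix is an identity or zero; naturality along it
      -- handles both cases at once.
      have := a.naturality ((𝟙 M : Mat_.Hom M M) i l)
      simp only [Functor.comp_map, ← incl_comp_proj] at this
      rw [Category.id_comp, F.map_comp, F'.map_comp, Category.assoc] at this
      rw [reassoc_of% this]
    have h₂ (j : N.ι) : F.map (incl M i) ≫ F.map f ≫ F.map (proj N j) ≫ a.app (N.X j) ≫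
        F'.map (incl N j) = a.app (M.X i) ≫ F'.map (incl M i) ≫ F'.map f ≫
          F'.map (proj N j) ≫ F'.map (incl N j) := by
      have := a.naturality (f i j)
      simp only [Functor.comp_map, ← incl_comp_proj, F.map_comp, F'.map_comp,
        Category.assoc] at this
      rw [reassoc_of% this]
    simp only [Preadditive.sum_comp, Preadditive.comp_sum, Category.assoc, h₁, h₂]
    simp only [← Preadditive.comp_sum]
    congr 2
    rw [map_proj_comp_incl_sum F' N, Category.comp_id]
    simp only [← Category.assoc (F'.map (proj M _)), ← Preadditive.sum_comp]
    rw [map_proj_comp_incl_sum F' M, Category.id_comp]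

/-- Pins down the extension on each summand. For a family with one member the inclusion is the
identity, which is how the extension is seen to restrict to `a`. -/
lemma incl_extend (a : Mat_.embedding T ⋙ F ⟶ Mat_.embedding T ⋙ F') (M : Mat_ T) (i : M.ι) :
    F.map (incl M i) ≫ (extend a).app M = a.app (M.X i) ≫ F'.map (incl M i) := by
  have h (l : M.ι) : F.map (incl M i) ≫ F.map (proj M l) ≫ a.app (M.X l) ≫
      F'.map (incl M l) = a.app (M.X i) ≫ F'.map (incl M i) ≫
          F'.map (proj M l) ≫ F'.map (incl M l) := by
    have := a.naturality ((𝟙 M : Mat_.Hom M M) i l)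
    simp only [Functor.comp_map, ← incl_comp_proj] at this
    rw [Category.id_comp, F.map_comp, F'.map_comp, Category.assoc] at this
    rw [reassoc_of% this]
  rw [extend_app, Preadditive.comp_sum]
  simp only [h, ← Preadditive.comp_sum]
  rw [map_proj_comp_incl_sum F' M, Category.comp_id]

lemma extend_app_embedding (a : Mat_.embedding T ⋙ F ⟶ Mat_.embedding T ⋙ F') (X : T) :
    (extend a).app ((Mat_.embedding T).obj X) = a.app X := by
  have h : F.map (𝟙 _) ≫ (extend a).app ((Mat_.embedding T).obj X) = a.app X ≫ F'.map (𝟙 _) :=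
    incl_extend a ((Mat_.embedding T).obj X) PUnit.unit
  rw [F.map_id, F'.map_id, Category.id_comp] at h
  exact h.trans (Category.comp_id _)

/-- The extension of a natural isomorphism from `T` to its additive envelope. -/
@[simps hom] def extendIso (a : Mat_.embedding T ⋙ F ≅ Mat_.embedding T ⋙ F') : F ≅ F' where
  hom := extend a.hom
  inv := extend a.inv
  hom_inv_id := natTrans_ext fun X => by
    simp only [NatTrans.comp_app, extend_app_embedding, Iso.hom_inv_id_app, NatTrans.id_app]
    rfl
  inv_hom_id := natTrans_ext fun X => by
    simp only [NatTrans.comp_app, extend_app_embedding, Iso.inv_hom_id_app, NatTrans.id_app]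
    rfl

end

section Tensor

variable {D : Type*} [Category D] [Preadditive D] [MonoidalCategory D] [MonoidalPreadditive D]

/-- The tensor product of `D` is biadditive, so two resolutions of the identity multiply to one of
the tensor product. -/
lemma hom_ext_incl_tensor (F F' : Mat_ T ⥤ D) [F.Additive] [F'.Additive] {M N : Mat_ T} {Z : D}
    {f g : F.obj M ⊗ F'.obj N ⟶ Z}
    (h : ∀ i j, (F.map (incl M i) ⊗ₘ F'.map (incl N j)) ≫ f =
      (F.map (incl M i) ⊗ₘ F'.map (incl N j)) ≫ g) : f = g := by
  rw [← Category.id_comp f, ← Category.id_comp g, ← id_tensorHom_id,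
    ← map_proj_comp_incl_sum F M, ← map_proj_comp_incl_sum F' N]
  simp only [sum_tensor, tensor_sum, Preadditive.sum_comp, ← tensorHom_comp_tensorHom,
    Category.assoc, h]

variable [MonoidalCategory T] [MonoidalPreadditive T]

/-- A natural transformation of additive functors on the additive envelope is monoidal if its
restriction is. -/
lemma isMonoidal_of_embedding {F F' : Mat_ T ⥤ D} [F.Additive] [F.Monoidal] [F'.Monoidal]
    (a : F ⟶ F') (h : NatTrans.IsMonoidal (Functor.whiskerLeft (Mat_.embedding T) a)) :
    NatTrans.IsMonoidal a where
  unit := by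
    -- The unit of the restricted functor is that of `F` followed by the image of the unit of the
    -- embedding; the latter is invertible and cancels.
    have := h.unit
    rw [comp_ε, comp_ε, Functor.whiskerLeft_app, Category.assoc, a.naturality, ← Category.assoc,
      cancel_mono] at this
    exact this
  tensor M N := by
    refine hom_ext_incl_tensor F F fun i j => ?_
    have := h.tensor (M.X i) (N.X j)
    rw [comp_μ, comp_μ, Functor.whiskerLeft_app, Functor.whiskerLeft_app, Functor.whiskerLeft_app,
      Category.assoc, a.naturality, ← Category.assoc, ← Category.assoc, cancel_mono] at this
    rw [μ_natural_assoc, a.naturality, reassoc_of% this, tensorHom_comp_tensorHom_assoc,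
      a.naturality, a.naturality, ← tensorHom_comp_tensorHom_assoc, μ_natural]

end Tensor

/-! ### Tensor functors applied entrywise to matrices. -/

section Functoriality

variable {D : Type*} [Category D] [Preadditive D]

/-- The family obtained by applying a functor to each member. -/
abbrev mapObj (F : T ⥤ D) (M : Mat_ T) : Mat_ D := ⟨M.ι, fun i => F.obj (M.X i)⟩

/-- The matrix obtained by applying a functor to each entry. -/
def mapHom (F : T ⥤ D) {M N : Mat_ T} (f : M ⟶ N) : mapObj F M ⟶ mapObj F N :=
  fun i j => F.map (f i j)

variable (F : T ⥤ D) [F.Additive]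

/-- Additivity enters through the zero entries off the graph of `e`. The structure morphisms of the
envelope are of this form, so their images are known. -/
lemma mapHom_perm {M N : Mat_ T} (e : M.ι → N.ι) (φ : ∀ i, M.X i ⟶ N.X (e i)) :
    mapHom F (perm e φ) =
      perm (M := mapObj F M) (N := mapObj F N) e (fun i => F.map (φ i)) := by
  refine perm_ext (M := mapObj F M) (N := mapObj F N) _ _ _ (fun i => ?_)
    (fun i j h => ?_)
  · exact congrArg F.map (perm_apply_self e φ i)
  · exact (congrArg F.map (perm_apply_of_ne e φ i j h)).trans (F.map_zero _ _)

lemma mapHom_id (M : Mat_ T) : mapHom F (𝟙 M) = 𝟙 (mapObj F M) := by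
  rw [id_eq_perm, mapHom_perm, id_eq_perm]
  simp only [F.map_id]

/-- The functor on additive envelopes which applies an additive functor entrywise. -/
@[simps] def mapFunctor (F : T ⥤ D) [F.Additive] : Mat_ T ⥤ Mat_ D where
  obj M := mapObj F M
  map f := mapHom F f
  map_id M := mapHom_id F M
  map_comp f g := Mat_.hom_ext _ _ fun i j =>
    (congrArg F.map (Mat_.comp_apply f g i j)).trans ((F.map_sum _ _).trans
      (Finset.sum_congr rfl fun l _ => F.map_comp (f i l) (g l j)))

instance : (mapFunctor F).Additive where
  map_add {_ _ _ _} := Mat_.hom_ext _ _ fun _ _ => F.map_add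

instance {k : Type*} [Field k] [Linear k T] [Linear k D] [F.Linear k] :
    (mapFunctor F).Linear k where
  map_smul _ _ := Mat_.hom_ext _ _ fun _ _ => F.map_smul _ _

variable [MonoidalCategory T] [MonoidalPreadditive T] [MonoidalCategory D]
  [MonoidalPreadditive D] [F.Monoidal]

/-- The tensor structure of `mapFunctor F`. -/
def mapFunctorμIso (M N : Mat_ T) : tensorObj (mapObj F M) (mapObj F N) ≅
    mapObj F (tensorObj M N) :=
  permIso (M := tensorObj (mapObj F M) (mapObj F N))
    (N := mapObj F (tensorObj M N)) (Equiv.refl _) fun p => μIso F (M.X p.1) (N.X p.2)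

lemma mapFunctorμIso_hom (M N : Mat_ T) : (mapFunctorμIso F M N).hom =
    perm (M := tensorObj (mapObj F M) (mapObj F N))
      (N := mapObj F (tensorObj M N)) (fun p => p) fun p => μ F (M.X p.1) (N.X p.2) :=
  rfl

lemma mapFunctorμIso_natural {M M' N N' : Mat_ T} (f : M ⟶ M') (g : N ⟶ N') :
    kronecker (mapHom F f) (mapHom F g) ≫ (mapFunctorμIso F M' N').hom =
      (mapFunctorμIso F M N).hom ≫ mapHom F (kronecker f g) := by
  refine Mat_.hom_ext _ _ fun p q => ?_
  rw [mapFunctorμIso_hom, mapFunctorμIso_hom, perm_comp_apply]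
  refine (comp_perm_apply (N := tensorObj (mapObj F M') (mapObj F N'))
    (K := mapObj F (tensorObj M' N')) _ _ (fun _ _ h => h) _ p q).trans ?_
  exact μ_natural F _ _

/-- The unit of the tensor structure of `mapFunctor F`. -/
def mapFunctorεIso : tensorUnit D ≅ mapObj F (tensorUnit T) :=
  permIso (M := tensorUnit D) (N := mapObj F (tensorUnit T)) (Equiv.refl _)
    fun _ => εIso F

lemma mapFunctorεIso_hom : (mapFunctorεIso F).hom =
    perm (M := tensorUnit D) (N := mapObj F (tensorUnit T)) (fun p => p)
      fun _ => ε F := rfl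

/-- In each coherence axiom both sides are generalised permutation matrices over the same map of
index sets, so what remains is the same axiom for `F`, entry by entry. -/
instance : (mapFunctor F).Monoidal := Functor.CoreMonoidal.toMonoidal
  { εIso := mapFunctorεIso F
    μIso := mapFunctorμIso F
    μIso_hom_natural_left {M N} f K := by
      have := mapFunctorμIso_natural F f (𝟙 K)
      rwa [mapHom_id] at this
    μIso_hom_natural_right K f := by
      have := mapFunctorμIso_natural F (𝟙 K) f
      rwa [mapHom_id] at this
    associativity M N K := by
      change kronecker (mapFunctorμIso F M N).hom (𝟙 _) ≫ (mapFunctorμIso F _ K).hom ≫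
        mapHom F (associator M N K).hom = (associator _ _ _).hom ≫
          kronecker (𝟙 _) (mapFunctorμIso F N K).hom ≫ (mapFunctorμIso F M _).hom
      simp only [mapFunctorμIso_hom, id_eq_perm, associator_hom, mapHom_perm]
      rw [kronecker_perm, kronecker_perm, perm_comp_perm, perm_comp_perm, perm_comp_perm,
        perm_comp_perm]
      congr 1
      funext p
      dsimp only
      rw [tensorHom_id, id_tensorHom]
      exact Functor.LaxMonoidal.associativity F _ _ _
    left_unitality M := by
      change (leftUnitor _).hom = kronecker (mapFunctorεIso F).hom (𝟙 _) ≫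
        (mapFunctorμIso F _ M).hom ≫ mapHom F (leftUnitor M).hom
      simp only [mapFunctorμIso_hom, mapFunctorεIso_hom, id_eq_perm, leftUnitor_hom,
        mapHom_perm]
      rw [kronecker_perm, perm_comp_perm, perm_comp_perm]
      congr 1
      funext p
      dsimp only
      rw [tensorHom_id]
      exact Functor.LaxMonoidal.left_unitality F _
    right_unitality M := by
      change (rightUnitor _).hom = kronecker (𝟙 _) (mapFunctorεIso F).hom ≫
        (mapFunctorμIso F M _).hom ≫ mapHom F (rightUnitor M).hom
      simp only [mapFunctorμIso_hom, mapFunctorεIso_hom, id_eq_perm, rightUnitor_hom,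
        mapHom_perm]
      rw [kronecker_perm, perm_comp_perm, perm_comp_perm]
      congr 1
      funext p
      dsimp only
      rw [id_tensorHom]
      exact Functor.LaxMonoidal.right_unitality F _ }

/-- The functor `mapFunctor F` extends `F`. -/
def embeddingMapFunctorIso : Mat_.embedding T ⋙ mapFunctor F ≅ F ⋙ Mat_.embedding D :=
  NatIso.ofComponents (fun X => Iso.refl ((Mat_.embedding D).obj (F.obj X)))
    (fun _ => (Category.comp_id _).trans (Category.id_comp _).symm)

instance : NatTrans.IsMonoidal (embeddingMapFunctorIso F).hom where
  unit := by
    rw [comp_ε, comp_ε]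
    refine (Category.comp_id _).trans ?_
    change (mapFunctorεIso F).hom ≫ mapHom F (𝟙 _) = 𝟙 _ ≫ (Mat_.embedding D).map (ε F)
    rw [mapHom_id, mapFunctorεIso_hom, embedding_map, Category.comp_id]
    exact (Category.id_comp (X := single (𝟙_ D)) (Y := single (F.obj (𝟙_ T))) _).symm
  tensor X Y := by
    rw [comp_μ, comp_μ]
    refine (Category.comp_id _).trans ?_
    change (mapFunctorμIso F (single X) (single Y)).hom ≫ mapHom F (singleμIso X Y).hom =
      kronecker (𝟙 (single (F.obj X))) (𝟙 (single (F.obj Y))) ≫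
        (singleμIso (F.obj X) (F.obj Y)).hom ≫ (Mat_.embedding D).map (μ F X Y)
    rw [embedding_map]
    change _ = _ ≫ _ ≫ perm (M := single (F.obj X ⊗ F.obj Y)) (N := single (F.obj (X ⊗ Y)))
      (fun i => i) fun _ => μ F X Y
    rw [mapFunctorμIso_hom, singleμIso_hom, singleμIso_hom, mapHom_perm,
      id_eq_perm, id_eq_perm, kronecker_perm, perm_comp_perm, perm_comp_perm, perm_comp_perm]
    congr 1
    funext p
    simp

end Functoriality

/-! ### Restriction of tensor functors from the additive envelope is an equivalence. -/

section Restriction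

variable {D : Type*} [Category D] [Preadditive D]

/-- A category with finite biproducts is equivalent to its additive envelope. -/
instance [HasFiniteBiproducts D] : (Mat_.embedding D).EssSurj where
  mem_essImage M := ⟨⨁ M.X, ⟨{
    hom := fun _ j => biproduct.π M.X j
    inv := fun j _ => biproduct.ι M.X j
    hom_inv_id := Mat_.hom_ext _ _ fun u v => ((Mat_.comp_apply
      (M := single (⨁ M.X)) (K := single (⨁ M.X)) _ _ _ _).trans (biproduct.total (f := M.X))).trans
        (Mat_.id_apply_self (single (⨁ M.X)) u).symm
    inv_hom_id := Mat_.hom_ext _ _ fun i j => by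
      classical
      refine (Mat_.comp_apply (N := single (⨁ M.X)) _ _ _ _).trans
        ((Finset.sum_singleton _ PUnit.unit).trans ?_)
      rw [biproduct.ι_π, Mat_.id_apply] }⟩⟩

/-- The embedding is fully faithful in any case; finite biproducts supply essential surjectivity. -/
instance [HasFiniteBiproducts D] : (Mat_.embedding D).IsEquivalence where

variable {k : Type*} [Field k] [Linear k T] [Linear k D] [MonoidalCategory T]
  [MonoidalPreadditive T] [MonoidalCategory D] [MonoidalPreadditive D]

variable (k T) in
/-- The embedding of `T` into its additive envelope, as a tensor functor. -/
@[simps toFunctor] def embeddingTensorFunctor : TensorFunctor k T (Mat_ T) where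
  toFunctor := Mat_.embedding T

variable (k T D) in
/-- Restriction of tensor functors from the additive envelope of `T` to `T`. -/
abbrev restriction : TensorFunctor k (Mat_ T) D ⥤ TensorFunctor k T D :=
  TensorFunctor.precomp (embeddingTensorFunctor T k) D

instance : (restriction T D k).Faithful where
  map_injective {F F' _ _} h := TensorFunctor.Hom.ext (natTrans_ext fun X =>
    congrArg (fun c : (restriction T D k).obj F ⟶ (restriction T D k).obj F' => c.hom.app X) h)

/-- A tensor transformation on `T` lifts by `extend`, and the lift is monoidal because monoidality
can be tested on `T`. -/
instance : (restriction T D k).Full where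
  map_surjective {F F'} a :=
    let b := extend (F := F.toFunctor) (F' := F'.toFunctor) a.hom
    have e : Functor.whiskerLeft (Mat_.embedding T) b = a.hom :=
      NatTrans.ext (funext fun X => extend_app_embedding a.hom X)
    have h : NatTrans.IsMonoidal (Functor.whiskerLeft (Mat_.embedding T) b) := by
      rw [e]
      exact a.isMonoidal
    ⟨⟨b, isMonoidal_of_embedding _ h⟩, TensorFunctor.Hom.ext e⟩

variable (D) in
/-- The equivalence of a category with finite biproducts with its additive envelope. -/
def embeddingEquivalence [HasFiniteBiproducts D] : D ≌ Mat_ D := (Mat_.embedding D).asEquivalence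

variable [HasFiniteBiproducts D]

instance : (embeddingEquivalence D).functor.Monoidal :=
  (inferInstance : (Mat_.embedding D).Monoidal)
instance : (embeddingEquivalence D).functor.Additive :=
  (inferInstance : (Mat_.embedding D).Additive)
instance : (embeddingEquivalence D).functor.Linear k :=
  (inferInstance : (Mat_.embedding D).Linear k)
instance : (embeddingEquivalence D).inverse.Monoidal := (embeddingEquivalence D).inverseMonoidal
instance : (embeddingEquivalence D).IsMonoidal :=
  { leftAdjoint_ε := rfl
    leftAdjoint_μ := fun _ _ => rfl }
instance : NatTrans.IsMonoidal (embeddingEquivalence D).unitIso.hom :=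
  (inferInstance : NatTrans.IsMonoidal (embeddingEquivalence D).unit)

/-- The extension of a tensor functor from `T` to its additive envelope. -/
@[simps toFunctor] def extension (F : TensorFunctor k T D) : TensorFunctor k (Mat_ T) D where
  toFunctor := mapFunctor F.toFunctor ⋙ (embeddingEquivalence D).inverse

/-- The functor `extension F` extends `F`. -/
def embeddingExtensionIso (F : TensorFunctor k T D) :
    Mat_.embedding T ⋙ (extension F).toFunctor ≅ F.toFunctor :=
  (Functor.associator _ _ _).symm ≪≫
    Functor.isoWhiskerRight (embeddingMapFunctorIso F.toFunctor)
      (embeddingEquivalence D).inverse ≪≫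
    Functor.associator F.toFunctor (embeddingEquivalence D).functor
      (embeddingEquivalence D).inverse ≪≫
    Functor.isoWhiskerLeft F.toFunctor (embeddingEquivalence D).unitIso.symm ≪≫
    Functor.rightUnitor F.toFunctor

instance (F : TensorFunctor k T D) : NatTrans.IsMonoidal (embeddingExtensionIso F).hom :=
  have h₁ : NatTrans.IsMonoidal (Functor.associator (Mat_.embedding T) (mapFunctor F.toFunctor)
    (embeddingEquivalence D).inverse).inv := inferInstance
  have h₂ : NatTrans.IsMonoidal (Functor.whiskerRight (embeddingMapFunctorIso F.toFunctor).hom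
    (embeddingEquivalence D).inverse) := inferInstance
  have h₃ : NatTrans.IsMonoidal (Functor.associator F.toFunctor (embeddingEquivalence D).functor
    (embeddingEquivalence D).inverse).hom := inferInstance
  have h₄ : NatTrans.IsMonoidal (Functor.whiskerLeft F.toFunctor
    (embeddingEquivalence D).unitIso.inv) := inferInstance
  have h₅ : NatTrans.IsMonoidal (Functor.rightUnitor F.toFunctor).hom := inferInstance
  @NatTrans.IsMonoidal.comp _ _ _ _ _ _ _ _ _ _ _ _ _ _ h₁
    (@NatTrans.IsMonoidal.comp _ _ _ _ _ _ _ _ _ _ _ _ _ _ h₂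
      (@NatTrans.IsMonoidal.comp _ _ _ _ _ _ _ _ _ _ _ _ _ _ h₃
        (@NatTrans.IsMonoidal.comp _ _ _ _ _ _ _ _ _ _ _ _ _ _ h₄ h₅)))

/-- A preimage is found by applying `F` entrywise and then forming the direct sum in `D`, that is,
by inverting the embedding of `D` into its own envelope. -/
instance : (restriction T D k).EssSurj where
  mem_essImage F := ⟨extension F, ⟨TensorFunctor.isoMk (embeddingExtensionIso F)
    (inferInstanceAs (NatTrans.IsMonoidal (embeddingExtensionIso F).hom))⟩⟩

instance : (restriction T D k).IsEquivalence where

end Restriction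

end Mat

end AdditiveEnvelopeExtension

/-! ### Exchange of middle factors and commutations of monoidal functors. -/

section Commutation

section MiddleExchange

variable {D : Type*} [Category D] [MonoidalCategory D]

/-- The exchange of the two middle factors by means of `b : Y ⊗ X' ⟶ X' ⊗ Y`. -/
def midExchange (X : D) {Y X' : D} (b : Y ⊗ X' ⟶ X' ⊗ Y) (Y' : D) :
    (X ⊗ Y) ⊗ (X' ⊗ Y') ⟶ (X ⊗ X') ⊗ (Y ⊗ Y') :=
  (α_ _ _ _).hom ≫ (X ◁ ((α_ _ _ _).inv ≫ b ▷ Y' ≫ (α_ _ _ _).hom)) ≫ (α_ _ _ _).inv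

instance (X : D) {Y X' : D} (b : Y ⊗ X' ⟶ X' ⊗ Y) [IsIso b] (Y' : D) :
    IsIso (midExchange X b Y') := by
  dsimp only [midExchange]
  infer_instance

/-- Only the two middle factors interact, hence one square for `b` and `b'` suffices. Applied to
tensorators and units, the lemma trades a braiding at a product or at a unit for simpler ones. -/
lemma midExchange_natural {X Y X' Y' Z W Z' W' : D} (f : X ⟶ Z) (g : Y ⟶ W) (f' : X' ⟶ Z')
    (g' : Y' ⟶ W') (b : Y ⊗ X' ⟶ X' ⊗ Y) (b' : W ⊗ Z' ⟶ Z' ⊗ W)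
    (h : (g ⊗ₘ f') ≫ b' = b ≫ (f' ⊗ₘ g)) :
    ((f ⊗ₘ g) ⊗ₘ (f' ⊗ₘ g')) ≫ midExchange Z b' W' =
      midExchange X b Y' ≫ ((f ⊗ₘ f') ⊗ₘ (g ⊗ₘ g')) := by
  dsimp only [midExchange]
  have e₁ : (g ⊗ₘ f' ⊗ₘ g') ≫ (α_ W Z' W').inv ≫ b' ▷ W' ≫ (α_ Z' W W').hom =
      ((α_ _ _ _).inv ≫ b ▷ Y' ≫ (α_ _ _ _).hom) ≫ (f' ⊗ₘ g ⊗ₘ g') := by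
    rw [associator_inv_naturality_assoc, ← tensorHom_id b' W', tensorHom_comp_tensorHom_assoc, h,
      Category.comp_id, Category.assoc, Category.assoc, ← associator_naturality,
      ← tensorHom_id b Y', tensorHom_comp_tensorHom_assoc, Category.id_comp]
  generalize (α_ _ _ _).inv ≫ b ▷ Y' ≫ (α_ _ _ _).hom = t at *
  rw [associator_naturality_assoc, ← id_tensorHom Z, tensorHom_comp_tensorHom_assoc, e₁,
    Category.comp_id, Category.assoc, Category.assoc, ← associator_inv_naturality,
    ← id_tensorHom X, tensorHom_comp_tensorHom_assoc, Category.id_comp]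

/-- Both ways of sorting six factors use the same three crossings, with `b₃₁` last. They differ in
the order of `b₂₁` and `b₃₂`, which act on disjoint factors, so the interchange law is enough and no
Yang–Baxter relation is needed. -/
lemma midExchange_assoc {X₁ Y₁ X₂ Y₂ X₃ Y₃ : D} (b₂₁ : Y₁ ⊗ X₂ ⟶ X₂ ⊗ Y₁)
    (b₃₁ : Y₁ ⊗ X₃ ⟶ X₃ ⊗ Y₁) (b₃₂ : Y₂ ⊗ X₃ ⟶ X₃ ⊗ Y₂) :
    midExchange X₁ b₂₁ Y₂ ▷ (X₃ ⊗ Y₃) ≫ midExchange (X₁ ⊗ X₂) ((α_ _ _ _).hom ≫ Y₁ ◁ b₃₂ ≫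
      (α_ _ _ _).inv ≫ b₃₁ ▷ Y₂ ≫ (α_ _ _ _).hom) Y₃ ≫ ((α_ X₁ X₂ X₃).hom ⊗ₘ (α_ Y₁ Y₂ Y₃).hom) =
    (α_ (X₁ ⊗ Y₁) (X₂ ⊗ Y₂) (X₃ ⊗ Y₃)).hom ≫ (X₁ ⊗ Y₁) ◁ midExchange X₂ b₃₂ Y₃ ≫
      midExchange X₁ ((α_ _ _ _).inv ≫ b₂₁ ▷ X₃ ≫ (α_ _ _ _).hom ≫ X₂ ◁ b₃₁ ≫ (α_ _ _ _).inv)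
        (Y₂ ⊗ Y₃) := by
  dsimp only [midExchange]
  calc _ = 𝟙 _ ⊗≫ X₁ ◁ ((b₂₁ ▷ (Y₂ ⊗ X₃)) ≫ (X₂ ⊗ Y₁) ◁ b₃₂) ▷ Y₃ ⊗≫
        (X₁ ⊗ X₂) ◁ b₃₁ ▷ (Y₂ ⊗ Y₃) ⊗≫ 𝟙 _ := by monoidal
    _ = _ := by rw [← whisker_exchange]; monoidal

/-- The hexagon `hc` with a unit inserted expresses `c` through two copies of itself. As `c` is
invertible one copy cancels, so multiplicativity forces compatibility with units. -/
lemma unit_of_hexagon_left {U P : D} (e : 𝟙_ D ⟶ U) [IsIso e] (m : U ⊗ U ⟶ U) [IsIso m]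
    (h : U ◁ e ≫ m = (ρ_ U).hom) (c : U ⊗ P ⟶ P ⊗ U) [IsIso c]
    (hc : m ▷ P ≫ c = ((α_ _ _ _).hom ≫ U ◁ c ≫ (α_ _ _ _).inv ≫ c ▷ U ≫ (α_ _ _ _).hom) ≫
      P ◁ m) : e ▷ P ≫ c = (λ_ _).hom ≫ (ρ_ _).inv ≫ P ◁ e := by
  have h₁ : U ◁ (e ▷ P ≫ c) = U ◁ ((λ_ _).hom ≫ (ρ_ _).inv ≫ P ◁ e) := by
    rw [← cancel_epi (α_ _ _ _).hom, ← cancel_mono ((α_ _ _ _).inv ≫ c ▷ U ≫ (α_ _ _ _).hom ≫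
      P ◁ m)]
    calc _ = (U ◁ e) ▷ P ≫ m ▷ P ≫ c := by rw [hc]; monoidal
      _ = (ρ_ U).hom ▷ P ≫ c := by rw [← h, comp_whiskerRight, Category.assoc]
      _ = 𝟙 _ ⊗≫ (c ▷ 𝟙_ D) ⊗≫ P ◁ (U ◁ e ≫ m) := by rw [h]; monoidal
      _ = 𝟙 _ ⊗≫ ((c ▷ 𝟙_ D) ≫ (P ⊗ U) ◁ e) ⊗≫ P ◁ m := by monoidal
      _ = _ := by rw [← whisker_exchange]; monoidal
  -- The whiskering by `U` can be removed because `e` identifies `U` with the unit object.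
  rw [← whiskerLeft_iff, ← cancel_mono (e ▷ _), whisker_exchange, whisker_exchange, h₁]

lemma unit_of_hexagon_right {U X : D} (e : 𝟙_ D ⟶ U) [IsIso e] (m : U ⊗ U ⟶ U) [IsIso m]
    (h : e ▷ U ≫ m = (λ_ U).hom) (c : X ⊗ U ⟶ U ⊗ X) [IsIso c]
    (hc : X ◁ m ≫ c = ((α_ _ _ _).inv ≫ c ▷ U ≫ (α_ _ _ _).hom ≫ U ◁ c ≫ (α_ _ _ _).inv) ≫
      m ▷ X) : X ◁ e ≫ c = (ρ_ _).hom ≫ (λ_ _).inv ≫ e ▷ X := by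
  have h₁ : (X ◁ e ≫ c) ▷ U = ((ρ_ _).hom ≫ (λ_ _).inv ≫ e ▷ X) ▷ U := by
    rw [← cancel_epi (α_ _ _ _).inv, ← cancel_mono ((α_ _ _ _).hom ≫ U ◁ c ≫ (α_ _ _ _).inv ≫
      m ▷ X)]
    calc _ = X ◁ (e ▷ U) ≫ X ◁ m ≫ c := by rw [hc]; monoidal
      _ = X ◁ (λ_ U).hom ≫ c := by rw [← h, whiskerLeft_comp, Category.assoc]
      _ = 𝟙 _ ⊗≫ (𝟙_ D ◁ c) ⊗≫ (e ▷ U ≫ m) ▷ X := by rw [h]; monoidal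
      _ = 𝟙 _ ⊗≫ (𝟙_ D ◁ c ≫ e ▷ (U ⊗ X)) ⊗≫ m ▷ X := by monoidal
      _ = _ := by rw [whisker_exchange]; monoidal
  rw [← whiskerRight_iff, ← cancel_mono (_ ◁ e), ← whisker_exchange, ← whisker_exchange, h₁]

variable {E : Type*} [Category E] [MonoidalCategory E] (Φ : D ⥤ E) [Φ.Monoidal]

/-- The transport of a morphism `X ⊗ Y ⟶ Z ⊗ W` along a monoidal functor. -/
abbrev transport {X Y Z W : D} (f : X ⊗ Y ⟶ Z ⊗ W) :
    Φ.obj X ⊗ Φ.obj Y ⟶ Φ.obj Z ⊗ Φ.obj W := μ Φ X Y ≫ Φ.map f ≫ δ Φ Z W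

/-- Monoidal functors preserve exchanges up to tensorators. This is what identifies the tensorator
of the functor rebuilt from the restrictions of `Φ` with that of `Φ` itself. -/
lemma map_midExchange (X : D) {Y X' : D} (b : Y ⊗ X' ⟶ X' ⊗ Y) (Y' : D) :
    (μ Φ X Y ⊗ₘ μ Φ X' Y') ≫ μ Φ _ _ ≫ Φ.map (midExchange X b Y') =
      midExchange (Φ.obj X) (transport Φ b) (Φ.obj Y') ≫ (μ Φ X X' ⊗ₘ μ Φ Y Y') ≫ μ Φ _ _ := by
  dsimp only [midExchange]
  have w (Z W : D) (V V' : E) (f : (Φ.obj Z ⊗ Φ.obj W) ⊗ V ⟶ V') :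
      μ Φ Z W ▷ V ≫ δ Φ Z W ▷ V ≫ f = f := by
    rw [← comp_whiskerRight_assoc, Functor.Monoidal.μ_δ, id_whiskerRight, Category.id_comp]
  simp only [Functor.map_comp, Functor.Monoidal.map_whiskerLeft,
    Functor.Monoidal.map_whiskerRight, Functor.Monoidal.map_associator,
    Functor.Monoidal.map_associator_inv, MonoidalCategory.tensorHom_def, Category.assoc,
    ← whisker_exchange_assoc, whiskerLeft_comp, comp_whiskerRight, tensor_whiskerLeft,
    Iso.inv_hom_id_assoc]
  simp only [w, Functor.Monoidal.μ_δ_assoc, Iso.inv_hom_id_assoc]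
  simp only [← whiskerLeft_comp_assoc, Functor.Monoidal.μ_δ_assoc, Functor.Monoidal.μ_δ,
    MonoidalCategory.whiskerLeft_id, Category.id_comp]

end MiddleExchange

variable {A : Type*} [Category A] [MonoidalCategory A] {B : Type*} [Category B]
  [MonoidalCategory B] {D : Type*} [Category D] [MonoidalCategory D]

/-- A commutation of the images of two monoidal functors `H` and `F`: natural isomorphisms
`H X ⊗ F Y ≅ F Y ⊗ H X` which are compatible with tensor products in `X` and in `Y`. -/
structure Commutation (H : A ⥤ D) (F : B ⥤ D) [H.Monoidal] [F.Monoidal] where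
  iso (X : A) (Y : B) : H.obj X ⊗ F.obj Y ≅ F.obj Y ⊗ H.obj X
  natural_left {X X' : A} (f : X ⟶ X') (Y : B) :
    H.map f ▷ F.obj Y ≫ (iso X' Y).hom = (iso X Y).hom ≫ F.obj Y ◁ H.map f
  natural_right (X : A) {Y Y' : B} (f : Y ⟶ Y') :
    H.obj X ◁ F.map f ≫ (iso X Y').hom = (iso X Y).hom ≫ F.map f ▷ H.obj X
  tensor_left (X X' : A) (Y : B) : μ H X X' ▷ F.obj Y ≫ (iso (X ⊗ X') Y).hom =
    ((α_ _ _ _).hom ≫ H.obj X ◁ (iso X' Y).hom ≫ (α_ _ _ _).inv ≫ (iso X Y).hom ▷ H.obj X' ≫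
      (α_ _ _ _).hom) ≫ F.obj Y ◁ μ H X X'
  tensor_right (X : A) (Y Y' : B) : H.obj X ◁ μ F Y Y' ≫ (iso X (Y ⊗ Y')).hom =
    ((α_ _ _ _).inv ≫ (iso X Y).hom ▷ F.obj Y' ≫ (α_ _ _ _).hom ≫ F.obj Y ◁ (iso X Y').hom ≫
      (α_ _ _ _).inv) ≫ μ F Y Y' ▷ H.obj X

namespace Commutation

variable {H : A ⥤ D} {F : B ⥤ D} [H.Monoidal] [F.Monoidal] (c : Commutation H F)

/-- A commutation carries no unit axiom. The tensor axiom at two unit objects, moved along `I ⊗ I ≅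
I` by naturality, is the hexagon which implies it. -/
lemma unit_left (Y : B) : ε H ▷ F.obj Y ≫ (c.iso (𝟙_ A) Y).hom =
    (λ_ _).hom ≫ (ρ_ _).inv ≫ F.obj Y ◁ ε H := by
  refine unit_of_hexagon_left _ (μ H (𝟙_ A) (𝟙_ A) ≫ H.map (ρ_ (𝟙_ A)).hom)
    (Functor.LaxMonoidal.right_unitality H (𝟙_ A)).symm _ ?_
  have h := c.tensor_left (𝟙_ A) (𝟙_ A) Y
  rw [comp_whiskerRight, Category.assoc, c.natural_left, reassoc_of% h]
  simp

lemma unit_right (X : A) : H.obj X ◁ ε F ≫ (c.iso X (𝟙_ B)).hom =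
    (ρ_ _).hom ≫ (λ_ _).inv ≫ ε F ▷ H.obj X := by
  refine unit_of_hexagon_right _ (μ F (𝟙_ B) (𝟙_ B) ≫ F.map (λ_ (𝟙_ B)).hom)
    (Functor.LaxMonoidal.left_unitality F (𝟙_ B)).symm _ ?_
  have h := c.tensor_right X (𝟙_ B) (𝟙_ B)
  rw [whiskerLeft_comp, Category.assoc, c.natural_right, reassoc_of% h]
  simp

variable {E : Type*} [Category E] [MonoidalCategory E]

/-- The transport of a commutation along a monoidal functor. -/
@[simps iso] def map (Φ : D ⥤ E) [Φ.Monoidal] : Commutation (H ⋙ Φ) (F ⋙ Φ) where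
  iso X Y := μIso Φ _ _ ≪≫ Φ.mapIso (c.iso X Y) ≪≫ (μIso Φ _ _).symm
  natural_left f Y := by
    have := congrArg Φ.map (c.natural_left f Y)
    rw [Φ.map_comp, Φ.map_comp] at this
    simp [-Functor.map_comp]
    rw [reassoc_of% this]
  natural_right X _ _ f := by
    have := congrArg Φ.map (c.natural_right X f)
    rw [Φ.map_comp, Φ.map_comp] at this
    simp [-Functor.map_comp]
    rw [reassoc_of% this]
  tensor_left X X' Y := by
    have := congrArg Φ.map (c.tensor_left X X' Y)
    simp only [Functor.map_comp, Functor.Monoidal.map_whiskerLeft,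
      Functor.Monoidal.map_whiskerRight, Functor.Monoidal.map_associator,
      Functor.Monoidal.map_associator_inv, Category.assoc, Functor.Monoidal.μ_δ_assoc] at this
    rw [cancel_epi] at this
    simp only [comp_μ, Iso.trans_hom, μIso_hom, Functor.mapIso_hom, Iso.symm_hom, μIso_inv,
      comp_whiskerRight, whiskerLeft_comp, Category.assoc, Functor.comp_obj]
    rw [reassoc_of% this, ← comp_whiskerRight_assoc, Functor.Monoidal.μ_δ]
    simp
  tensor_right X Y Y' := by
    have := congrArg Φ.map (c.tensor_right X Y Y')
    simp only [Functor.map_comp, Functor.Monoidal.map_whiskerLeft,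
      Functor.Monoidal.map_whiskerRight, Functor.Monoidal.map_associator,
      Functor.Monoidal.map_associator_inv, Category.assoc, Functor.Monoidal.μ_δ_assoc] at this
    rw [cancel_epi] at this
    simp only [comp_μ, Iso.trans_hom, μIso_hom, Functor.mapIso_hom, Iso.symm_hom, μIso_inv,
      comp_whiskerRight, whiskerLeft_comp, Category.assoc, Functor.comp_obj]
    rw [reassoc_of% this, ← whiskerLeft_comp_assoc, Functor.Monoidal.μ_δ]
    simp

end Commutation

end Commutation

/-! ### Commuting pairs and the tensor functor which they generate. -/

section CommutingPairs

variable {k : Type*} [Field k]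
  {A : Type*} [Category A] [Preadditive A] [Linear k A] [MonoidalCategory A]
  {B : Type*} [Category B] [Preadditive B] [Linear k B] [MonoidalCategory B]
  {D : Type*} [Category D] [Preadditive D] [Linear k D] [MonoidalCategory D]

variable (k A B D) in
/-- Two tensor functors with values in `D` together with a commutation of their images. -/
structure CommutingPair where
  fst : TensorFunctor k B D
  snd : TensorFunctor k A D
  comm : Commutation snd.toFunctor fst.toFunctor

namespace CommutingPair

/-- A morphism of commuting pairs: tensor transformations compatible with the commutations. -/
@[ext]
structure Hom (p q : CommutingPair k A B D) where
  fst : p.fst ⟶ q.fst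
  snd : p.snd ⟶ q.snd
  comm (X : A) (Y : B) : (p.comm.iso X Y).hom ≫ (fst.hom.app Y ⊗ₘ snd.hom.app X) =
    (snd.hom.app X ⊗ₘ fst.hom.app Y) ≫ (q.comm.iso X Y).hom

instance : Category (CommutingPair k A B D) where
  Hom := Hom
  id p := ⟨𝟙 _, 𝟙 _, fun X Y => by simp⟩
  comp a b := ⟨a.fst ≫ b.fst, a.snd ≫ b.snd, fun X Y => by
    simp only [TensorFunctor.comp_hom, NatTrans.comp_app, ← tensorHom_comp_tensorHom]
    rw [← Category.assoc, a.comm, Category.assoc, b.comm, Category.assoc]⟩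

@[ext] lemma hom_ext {p q : CommutingPair k A B D} {a b : p ⟶ q} (h₁ : a.fst = b.fst)
    (h₂ : a.snd = b.snd) : a = b := Hom.ext h₁ h₂

/-- An isomorphism of commuting pairs. -/
@[simps] def isoMk {p q : CommutingPair k A B D} (e₁ : p.fst ≅ q.fst) (e₂ : p.snd ≅ q.snd)
    (h : ∀ X Y, (p.comm.iso X Y).hom ≫ (e₁.hom.hom.app Y ⊗ₘ e₂.hom.hom.app X) =
      (e₂.hom.hom.app X ⊗ₘ e₁.hom.hom.app Y) ≫ (q.comm.iso X Y).hom) : p ≅ q where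
  hom := ⟨e₁.hom, e₂.hom, h⟩
  inv := ⟨e₁.inv, e₂.inv, fun X Y => by
    have h₁ (Y : B) : e₁.inv.hom.app Y ≫ e₁.hom.hom.app Y = 𝟙 _ := by
      rw [← NatTrans.comp_app, ← TensorFunctor.comp_hom, e₁.inv_hom_id]
      rfl
    have h₂ (Y : A) : e₂.inv.hom.app Y ≫ e₂.hom.hom.app Y = 𝟙 _ := by
      rw [← NatTrans.comp_app, ← TensorFunctor.comp_hom, e₂.inv_hom_id]
      rfl
    have h₃ (Y : B) : e₁.hom.hom.app Y ≫ e₁.inv.hom.app Y = 𝟙 _ := by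
      rw [← NatTrans.comp_app, ← TensorFunctor.comp_hom, e₁.hom_inv_id]
      rfl
    have h₄ (Y : A) : e₂.hom.hom.app Y ≫ e₂.inv.hom.app Y = 𝟙 _ := by
      rw [← NatTrans.comp_app, ← TensorFunctor.comp_hom, e₂.hom_inv_id]
      rfl
    rw [← Category.id_comp ((q.comm.iso X Y).hom ≫ _), ← id_tensorHom_id, ← h₁, ← h₂,
      ← tensorHom_comp_tensorHom, Category.assoc, ← reassoc_of% (h X Y),
      tensorHom_comp_tensorHom, h₃, h₄, id_tensorHom_id, Category.comp_id]⟩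
  hom_inv_id := hom_ext e₁.hom_inv_id e₂.hom_inv_id
  inv_hom_id := hom_ext e₁.inv_hom_id e₂.inv_hom_id

section Amalgam

variable (p : CommutingPair k A B D)

/-- The amalgam has to move `F Y` past `H X'`, so it uses the inverse commutation. This and the next
four lemmas put the axioms for the inverse into the form of the square required by
`midExchange_natural`. -/
lemma comm_inv_natural {X X' : A} {Y Y' : B} (f : X ⟶ X') (g : Y ⟶ Y') :
    (p.fst.map g ⊗ₘ p.snd.map f) ≫ (p.comm.iso X' Y').inv =
      (p.comm.iso X Y).inv ≫ (p.snd.map f ⊗ₘ p.fst.map g) := by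
  rw [Iso.comp_inv_eq, Category.assoc, Iso.eq_inv_comp, MonoidalCategory.tensorHom_def,
    MonoidalCategory.tensorHom_def', Category.assoc, p.comm.natural_left,
    reassoc_of% (p.comm.natural_right X g)]

lemma comm_inv_tensor_left (X X' : A) (Y : B) :
    (𝟙 (p.fst.obj Y) ⊗ₘ μ p.snd.toFunctor X X') ≫ (p.comm.iso (X ⊗ X') Y).inv =
      ((α_ _ _ _).inv ≫ (p.comm.iso X Y).inv ▷ _ ≫ (α_ _ _ _).hom ≫
        _ ◁ (p.comm.iso X' Y).inv ≫ (α_ _ _ _).inv) ≫ (μ p.snd.toFunctor X X' ⊗ₘ 𝟙 _) := by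
  rw [Iso.comp_inv_eq, Category.assoc, tensorHom_id, p.comm.tensor_left]
  simp

lemma comm_inv_tensor_right (X : A) (Y Y' : B) :
    (μ p.fst.toFunctor Y Y' ⊗ₘ 𝟙 (p.snd.obj X)) ≫ (p.comm.iso X (Y ⊗ Y')).inv =
      ((α_ _ _ _).hom ≫ _ ◁ (p.comm.iso X Y').inv ≫ (α_ _ _ _).inv ≫
        (p.comm.iso X Y).inv ▷ _ ≫ (α_ _ _ _).hom) ≫ (𝟙 _ ⊗ₘ μ p.fst.toFunctor Y Y') := by
  rw [Iso.comp_inv_eq, Category.assoc, id_tensorHom, p.comm.tensor_right]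
  simp

lemma comm_inv_unit_left (Y : B) : (𝟙 (p.fst.obj Y) ⊗ₘ ε p.snd.toFunctor) ≫
    (p.comm.iso (𝟙_ A) Y).inv = ((ρ_ _).hom ≫ (λ_ _).inv) ≫ (ε p.snd.toFunctor ⊗ₘ 𝟙 _) := by
  rw [Iso.comp_inv_eq, Category.assoc, tensorHom_id, p.comm.unit_left]
  simp

lemma comm_inv_unit_right (X : A) : (ε p.fst.toFunctor ⊗ₘ 𝟙 (p.snd.obj X)) ≫
    (p.comm.iso X (𝟙_ B)).inv = ((λ_ _).hom ≫ (ρ_ _).inv) ≫ (𝟙 _ ⊗ₘ ε p.fst.toFunctor) := by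
  rw [Iso.comp_inv_eq, Category.assoc, id_tensorHom, p.comm.unit_right]
  simp

variable [MonoidalPreadditive A] [MonoidalLinear k A] [MonoidalPreadditive B] [MonoidalLinear k B]
  [MonoidalPreadditive D] [MonoidalLinear k D]

/-- The linear map `f ⊠ g ↦ H f ⊗ F g`. -/
def amalgamMap (Z Z' : LinearProduct k A B) : (Z ⟶ Z') →ₗ[k]
    (p.snd.obj Z.fst ⊗ p.fst.obj Z.snd ⟶ p.snd.obj Z'.fst ⊗ p.fst.obj Z'.snd) :=
  (TensorProduct.lift ((LinearProduct.tensorBilin (k := k) _ _ _ _).compl₁₂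
    (p.snd.toFunctor.mapLinearMap k) (p.fst.toFunctor.mapLinearMap k)) :
    ((Z.fst ⟶ Z'.fst) ⊗[k] (Z.snd ⟶ Z'.snd)) →ₗ[k] _)

lemma amalgamMap_homMk {Z Z' : LinearProduct k A B} (f : Z.fst ⟶ Z'.fst) (g : Z.snd ⟶ Z'.snd) :
    amalgamMap p Z Z' (LinearProduct.homMk f g) = p.snd.map f ⊗ₘ p.fst.map g :=
  TensorProduct.lift.tmul _ _

/-- The functor `X ⊠ Y ↦ H X ⊗ F Y`. -/
@[simps obj] def amalgamFunctor : LinearProduct k A B ⥤ D where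
  obj Z := p.snd.obj Z.fst ⊗ p.fst.obj Z.snd
  map {Z Z'} f := amalgamMap p Z Z' f
  map_id Z := by
    rw [LinearProduct.id_eq_homMk, amalgamMap_homMk]
    simp
  map_comp {Z Z' Z''} f g := by
    induction f using LinearProduct.hom_induction with
    | zero => simp
    | add _ _ h h' => simp only [Preadditive.add_comp, map_add, h, h']
    | mk f₁ f₂ =>
      induction g using LinearProduct.hom_induction with
      | zero => simp
      | add _ _ h h' => simp only [Preadditive.comp_add, map_add, h, h']
      | mk g₁ g₂ =>
        simp only [LinearProduct.homMk_comp, amalgamMap_homMk, Functor.map_comp,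
          tensorHom_comp_tensorHom]

lemma amalgamFunctor_map_homMk {Z Z' : LinearProduct k A B} (f : Z.fst ⟶ Z'.fst)
    (g : Z.snd ⟶ Z'.snd) : (amalgamFunctor p).map (LinearProduct.homMk f g) =
      p.snd.map f ⊗ₘ p.fst.map g := amalgamMap_homMk p f g

instance : (amalgamFunctor p).Additive where
  map_add {Z Z' _ _} := map_add (amalgamMap p Z Z') _ _

instance : (amalgamFunctor p).Linear k where
  map_smul {Z Z'} f r := map_smul (amalgamMap p Z Z') r f

/-- The tensor structure of `X ⊠ Y ↦ H X ⊗ F Y`. -/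
def amalgamμIso (Z Z' : LinearProduct k A B) :
    (amalgamFunctor p).obj Z ⊗ (amalgamFunctor p).obj Z' ≅ (amalgamFunctor p).obj (Z ⊗ Z') :=
  -- The middle factors arrive in the order `F Y ⊗ H X'`; after exchanging them the tensorators of
  -- `H` and `F` apply separately.
  letI e : (p.snd.obj Z.fst ⊗ p.fst.obj Z.snd) ⊗ (p.snd.obj Z'.fst ⊗ p.fst.obj Z'.snd) ≅
      p.snd.obj (Z.fst ⊗ Z'.fst) ⊗ p.fst.obj (Z.snd ⊗ Z'.snd) :=
    asIso (midExchange (p.snd.obj Z.fst) (p.comm.iso Z'.fst Z.snd).inv (p.fst.obj Z'.snd)) ≪≫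
      (μIso p.snd.toFunctor _ _ ⊗ᵢ μIso p.fst.toFunctor _ _)
  e

/-- Both sides are biadditive in `f` and `g`, which reduces the claim to pure tensors; there it is
naturality of the exchange and of the two tensorators. -/
lemma amalgamμIso_natural {Z Z' W W' : LinearProduct k A B} (f : Z ⟶ W) (g : Z' ⟶ W') :
    ((amalgamFunctor p).map f ⊗ₘ (amalgamFunctor p).map g) ≫ (amalgamμIso p W W').hom =
      (amalgamμIso p Z Z').hom ≫ (amalgamFunctor p).map (f ⊗ₘ g) := by
  induction f using LinearProduct.hom_induction with
  | zero => simp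
  | add _ _ h h' => simp only [Functor.map_add, MonoidalPreadditive.add_tensor,
      Preadditive.add_comp, Preadditive.comp_add, h, h']
  | mk f₁ f₂ =>
    induction g using LinearProduct.hom_induction with
    | zero => simp
    | add _ _ h h' => simp only [Functor.map_add, MonoidalPreadditive.tensor_add,
        Preadditive.add_comp, Preadditive.comp_add, h, h']
    | mk g₁ g₂ =>
      rw [LinearProduct.homMk_tensorHom, amalgamFunctor_map_homMk, amalgamFunctor_map_homMk]
      refine Eq.trans ?_ (congrArg (fun t => (amalgamμIso p Z Z').hom ≫ t)
        (amalgamFunctor_map_homMk p (Z := Z ⊗ Z') (Z' := W ⊗ W') (f₁ ⊗ₘ g₁) (f₂ ⊗ₘ g₂))).symm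
      change ((p.snd.map f₁ ⊗ₘ p.fst.map f₂) ⊗ₘ (p.snd.map g₁ ⊗ₘ p.fst.map g₂)) ≫
        midExchange (p.snd.obj W.fst) (p.comm.iso W'.fst W.snd).inv (p.fst.obj W'.snd) ≫
          (μ p.snd.toFunctor W.fst W'.fst ⊗ₘ μ p.fst.toFunctor W.snd W'.snd) =
        (midExchange (p.snd.obj Z.fst) (p.comm.iso Z'.fst Z.snd).inv (p.fst.obj Z'.snd) ≫
          (μ p.snd.toFunctor Z.fst Z'.fst ⊗ₘ μ p.fst.toFunctor Z.snd Z'.snd)) ≫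
            (p.snd.map (f₁ ⊗ₘ g₁) ⊗ₘ p.fst.map (f₂ ⊗ₘ g₂))
      rw [reassoc_of% (midExchange_natural _ _ _ _ _ _ (comm_inv_natural p g₁ f₂)),
        Category.assoc]
      simp only [tensorHom_comp_tensorHom, μ_natural]

/-- Naturality of the exchange moves the tensorators to the end and splits the crossings with
products into elementary ones. What is left is `midExchange_assoc` and the associativity of `H` and
`F`. -/
lemma amalgam_associativity (X₁ X₂ X₃ : A) (Y₁ Y₂ Y₃ : B) :
    (midExchange (p.snd.obj X₁) (p.comm.iso X₂ Y₁).inv (p.fst.obj Y₂) ≫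
      (μ p.snd.toFunctor X₁ X₂ ⊗ₘ μ p.fst.toFunctor Y₁ Y₂)) ▷ (p.snd.obj X₃ ⊗ p.fst.obj Y₃) ≫
    (midExchange (p.snd.obj (X₁ ⊗ X₂)) (p.comm.iso X₃ (Y₁ ⊗ Y₂)).inv (p.fst.obj Y₃) ≫
      (μ p.snd.toFunctor (X₁ ⊗ X₂) X₃ ⊗ₘ μ p.fst.toFunctor (Y₁ ⊗ Y₂) Y₃)) ≫
    (p.snd.map (α_ X₁ X₂ X₃).hom ⊗ₘ p.fst.map (α_ Y₁ Y₂ Y₃).hom) =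
    (α_ _ _ _).hom ≫ (p.snd.obj X₁ ⊗ p.fst.obj Y₁) ◁
      (midExchange (p.snd.obj X₂) (p.comm.iso X₃ Y₂).inv (p.fst.obj Y₃) ≫
        (μ p.snd.toFunctor X₂ X₃ ⊗ₘ μ p.fst.toFunctor Y₂ Y₃)) ≫
    midExchange (p.snd.obj X₁) (p.comm.iso (X₂ ⊗ X₃) Y₁).inv (p.fst.obj (Y₂ ⊗ Y₃)) ≫
      (μ p.snd.toFunctor X₁ (X₂ ⊗ X₃) ⊗ₘ μ p.fst.toFunctor Y₁ (Y₂ ⊗ Y₃)) := by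
  have h₁ := midExchange_natural (μ p.snd.toFunctor X₁ X₂) (μ p.fst.toFunctor Y₁ Y₂)
    (𝟙 (p.snd.obj X₃)) (𝟙 (p.fst.obj Y₃)) _ _ (comm_inv_tensor_right p X₃ Y₁ Y₂)
  have h₂ := midExchange_natural (𝟙 (p.snd.obj X₁)) (𝟙 (p.fst.obj Y₁))
    (μ p.snd.toFunctor X₂ X₃) (μ p.fst.toFunctor Y₂ Y₃) _ _ (comm_inv_tensor_left p X₂ X₃ Y₁)
  have h₃ := midExchange_assoc (X₁ := p.snd.obj X₁) (Y₃ := p.fst.obj Y₃)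
    (p.comm.iso X₂ Y₁).inv (p.comm.iso X₃ Y₁).inv (p.comm.iso X₃ Y₂).inv
  rw [id_tensorHom_id, tensorHom_id] at h₁
  rw [id_tensorHom_id, id_tensorHom] at h₂
  rw [comp_whiskerRight, Category.assoc, Category.assoc, reassoc_of% h₁, whiskerLeft_comp,
    Category.assoc, reassoc_of% h₂, ← reassoc_of% h₃]
  simp only [tensorHom_comp_tensorHom, tensorHom_id, id_tensorHom,
    Functor.LaxMonoidal.associativity]

/-- The factor `F I` crosses `H X` in the way the unit object does, so the exchange becomes a
coherence isomorphism and the unitality of `H` and `F` finishes. -/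
lemma amalgam_left_unitality (X : A) (Y : B) :
    ((λ_ (𝟙_ D)).inv ≫ (ε p.snd.toFunctor ⊗ₘ ε p.fst.toFunctor)) ▷
      (p.snd.obj X ⊗ p.fst.obj Y) ≫
    (midExchange (p.snd.obj (𝟙_ A)) (p.comm.iso X (𝟙_ B)).inv (p.fst.obj Y) ≫
      (μ p.snd.toFunctor (𝟙_ A) X ⊗ₘ μ p.fst.toFunctor (𝟙_ B) Y)) ≫
    (p.snd.map (λ_ X).hom ⊗ₘ p.fst.map (λ_ Y).hom) = (λ_ _).hom := by
  have h := midExchange_natural (ε p.snd.toFunctor) (ε p.fst.toFunctor)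
    (𝟙 (p.snd.obj X)) (𝟙 (p.fst.obj Y)) _ _ (comm_inv_unit_right p X)
  rw [id_tensorHom_id, tensorHom_id] at h
  rw [comp_whiskerRight, Category.assoc, Category.assoc, reassoc_of% h]
  simp only [tensorHom_comp_tensorHom, tensorHom_id, ← Functor.LaxMonoidal.left_unitality,
    midExchange]
  monoidal

lemma amalgam_right_unitality (X : A) (Y : B) :
    (p.snd.obj X ⊗ p.fst.obj Y) ◁
      ((λ_ (𝟙_ D)).inv ≫ (ε p.snd.toFunctor ⊗ₘ ε p.fst.toFunctor)) ≫
    (midExchange (p.snd.obj X) (p.comm.iso (𝟙_ A) Y).inv (p.fst.obj (𝟙_ B)) ≫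
      (μ p.snd.toFunctor X (𝟙_ A) ⊗ₘ μ p.fst.toFunctor Y (𝟙_ B))) ≫
    (p.snd.map (ρ_ X).hom ⊗ₘ p.fst.map (ρ_ Y).hom) = (ρ_ _).hom := by
  have h := midExchange_natural (𝟙 (p.snd.obj X)) (𝟙 (p.fst.obj Y)) (ε p.snd.toFunctor)
    (ε p.fst.toFunctor) _ _ (comm_inv_unit_left p Y)
  rw [id_tensorHom_id, id_tensorHom] at h
  rw [whiskerLeft_comp, Category.assoc, Category.assoc, reassoc_of% h]
  simp only [tensorHom_comp_tensorHom, id_tensorHom, ← Functor.LaxMonoidal.right_unitality,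
    midExchange]
  monoidal

instance : (amalgamFunctor p).Monoidal := Functor.CoreMonoidal.toMonoidal
  { εIso := (λ_ (𝟙_ D)).symm ≪≫ (εIso p.snd.toFunctor ⊗ᵢ εIso p.fst.toFunctor)
    μIso := amalgamμIso p
    μIso_hom_natural_left f Z := by
      simpa using amalgamμIso_natural p f (𝟙 Z)
    μIso_hom_natural_right Z f := by
      simpa using amalgamμIso_natural p (𝟙 Z) f
    associativity Z Z' Z'' := by
      refine Eq.trans ?_ (amalgam_associativity p Z.fst Z'.fst Z''.fst Z.snd Z'.snd Z''.snd)
      exact congrArg (fun t => (amalgamμIso p Z Z').hom ▷ _ ≫ (amalgamμIso p (Z ⊗ Z') Z'').hom ≫ t)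
        (amalgamFunctor_map_homMk p _ _)
    left_unitality Z := by
      refine (amalgam_left_unitality p Z.fst Z.snd).symm.trans ?_
      exact congrArg (fun t => ((λ_ (𝟙_ D)).inv ≫ (ε p.snd.toFunctor ⊗ₘ ε p.fst.toFunctor)) ▷ _ ≫
        (amalgamμIso p (𝟙_ _) Z).hom ≫ t) (amalgamFunctor_map_homMk p (Z := 𝟙_ _ ⊗ Z) (Z' := Z)
          (λ_ Z.fst).hom (λ_ Z.snd).hom).symm
    right_unitality Z := by
      refine (amalgam_right_unitality p Z.fst Z.snd).symm.trans ?_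
      exact congrArg (fun t => _ ◁ ((λ_ (𝟙_ D)).inv ≫ (ε p.snd.toFunctor ⊗ₘ ε p.fst.toFunctor)) ≫
        (amalgamμIso p Z (𝟙_ _)).hom ≫ t) (amalgamFunctor_map_homMk p (Z := Z ⊗ 𝟙_ _) (Z' := Z)
          (ρ_ Z.fst).hom (ρ_ Z.snd).hom).symm }

/-- The tensor functor `X ⊠ Y ↦ H X ⊗ F Y`. -/
@[simps toFunctor] def amalgam : TensorFunctor k (LinearProduct k A B) D where
  toFunctor := amalgamFunctor p

lemma amalgamMap_natural {p q : CommutingPair k A B D} (a : p ⟶ q) {Z Z' : LinearProduct k A B}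
    (f : Z ⟶ Z') :
    amalgamMap p Z Z' f ≫ (a.snd.hom.app Z'.fst ⊗ₘ a.fst.hom.app Z'.snd) =
      (a.snd.hom.app Z.fst ⊗ₘ a.fst.hom.app Z.snd) ≫ amalgamMap q Z Z' f := by
  induction f using LinearProduct.hom_induction with
  | zero => simp
  | add _ _ h h' => simp only [map_add, Preadditive.add_comp, Preadditive.comp_add, h, h']
  | mk f₁ f₂ =>
    rw [amalgamMap_homMk, amalgamMap_homMk, tensorHom_comp_tensorHom, tensorHom_comp_tensorHom,
      NatTrans.naturality, NatTrans.naturality]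

/-- This is the point of the compatibility condition on morphisms of commuting pairs: it provides
the square `h`, which makes the tensor product of the two transformations monoidal. -/
lemma amalgam_tensor {p q : CommutingPair k A B D} (a : p ⟶ q) (X X' : A) (Y Y' : B) :
    (midExchange (p.snd.obj X) (p.comm.iso X' Y).inv (p.fst.obj Y') ≫
      (μ p.snd.toFunctor X X' ⊗ₘ μ p.fst.toFunctor Y Y')) ≫
        (a.snd.hom.app (X ⊗ X') ⊗ₘ a.fst.hom.app (Y ⊗ Y')) =
    ((a.snd.hom.app X ⊗ₘ a.fst.hom.app Y) ⊗ₘ (a.snd.hom.app X' ⊗ₘ a.fst.hom.app Y')) ≫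
      midExchange (q.snd.obj X) (q.comm.iso X' Y).inv (q.fst.obj Y') ≫
        (μ q.snd.toFunctor X X' ⊗ₘ μ q.fst.toFunctor Y Y') := by
  have h : (a.fst.hom.app Y ⊗ₘ a.snd.hom.app X') ≫ (q.comm.iso X' Y).inv =
      (p.comm.iso X' Y).inv ≫ (a.snd.hom.app X' ⊗ₘ a.fst.hom.app Y) := by
    rw [Iso.comp_inv_eq, Category.assoc, Iso.eq_inv_comp, a.comm]
  rw [reassoc_of% (midExchange_natural _ _ _ _ _ _ h), Category.assoc]
  simp only [tensorHom_comp_tensorHom, NatTrans.IsMonoidal.tensor]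

variable (k A B D) in
/-- The tensor functor `X ⊠ Y ↦ H X ⊗ F Y`, functorially in the commuting pair. -/
@[simps obj] def amalgamation :
    CommutingPair k A B D ⥤ TensorFunctor k (LinearProduct k A B) D where
  obj p := amalgam p
  map {p q} a :=
    { hom :=
        { app Z := a.snd.hom.app Z.fst ⊗ₘ a.fst.hom.app Z.snd
          naturality _ _ f := amalgamMap_natural a f }
      isMonoidal :=
        { unit := by
            change ((λ_ (𝟙_ D)).inv ≫ (ε p.snd.toFunctor ⊗ₘ ε p.fst.toFunctor)) ≫
              (a.snd.hom.app (𝟙_ A) ⊗ₘ a.fst.hom.app (𝟙_ B)) =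
              (λ_ (𝟙_ D)).inv ≫ (ε q.snd.toFunctor ⊗ₘ ε q.fst.toFunctor)
            rw [Category.assoc, tensorHom_comp_tensorHom, NatTrans.IsMonoidal.unit,
              NatTrans.IsMonoidal.unit]
          tensor Z Z' := amalgam_tensor a Z.fst Z'.fst Z.snd Z'.snd } }
  map_id p := TensorFunctor.hom_ext fun Z => id_tensorHom_id _ _
  map_comp a b := TensorFunctor.hom_ext fun Z => (tensorHom_comp_tensorHom _ _ _ _).symm

end Amalgam

end CommutingPair

end CommutingPairs

/-! ### The canonical commutation inside the linear product. -/

section UniversalCommutation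

variable {k : Type*} [Field k]
  {A : Type*} [Category A] [Preadditive A] [Linear k A] [MonoidalCategory A]
  [MonoidalPreadditive A] [MonoidalLinear k A]
  {B : Type*} [Category B] [Preadditive B] [Linear k B] [MonoidalCategory B]
  [MonoidalPreadditive B] [MonoidalLinear k B]

namespace LinearProduct

/-- The isomorphism `(X ⊠ I) ⊗ (I ⊠ Y) ≅ X ⊠ Y`. -/
def join (X : A) (Y : B) : (inl k A B).obj X ⊗ (inr k A B).obj Y ≅ ⟨X, Y⟩ :=
  isoMk (ρ_ X) (λ_ Y)

/-- The isomorphism `(X ⊠ I) ⊗ (I ⊠ Y) ≅ (I ⊠ Y) ⊗ (X ⊠ I)`. -/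
def swap (X : A) (Y : B) : (inl k A B).obj X ⊗ (inr k A B).obj Y ≅
    (inr k A B).obj Y ⊗ (inl k A B).obj X :=
  isoMk (ρ_ X ≪≫ (λ_ X).symm) (λ_ Y ≪≫ (ρ_ Y).symm)

variable (k A B) in
/-- The canonical commutation of `X ⊠ I` and `I ⊠ Y`. -/
@[simps] def universalCommutation : Commutation (inl k A B) (inr k A B) where
  iso := swap
  natural_left {X X'} f Y := by
    change tensorHom _ _ _ _ (pair (k := k) f (𝟙 (𝟙_ B))) (pair (k := k) (𝟙 (𝟙_ A)) (𝟙 Y)) ≫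
      pair (k := k) ((ρ_ X').hom ≫ (λ_ X').inv) ((λ_ Y).hom ≫ (ρ_ Y).inv) =
      pair (k := k) ((ρ_ X).hom ≫ (λ_ X).inv) ((λ_ Y).hom ≫ (ρ_ Y).inv) ≫
      tensorHom _ _ _ _ (pair (k := k) (𝟙 (𝟙_ A)) (𝟙 Y)) (pair (k := k) f (𝟙 (𝟙_ B)))
    rw [pair_tensor, pair_tensor, pair_comp, pair_comp]
    congr 1 <;> simp
  natural_right X {Y Y'} f := by
    change tensorHom _ _ _ _ (pair (k := k) (𝟙 X) (𝟙 (𝟙_ B))) (pair (k := k) (𝟙 (𝟙_ A)) f) ≫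
      pair (k := k) ((ρ_ X).hom ≫ (λ_ X).inv) ((λ_ Y').hom ≫ (ρ_ Y').inv) =
      pair (k := k) ((ρ_ X).hom ≫ (λ_ X).inv) ((λ_ Y).hom ≫ (ρ_ Y).inv) ≫
      tensorHom _ _ _ _ (pair (k := k) (𝟙 (𝟙_ A)) f) (pair (k := k) (𝟙 X) (𝟙 (𝟙_ B)))
    rw [pair_tensor, pair_tensor, pair_comp, pair_comp]
    congr 1 <;> simp
  tensor_left X X' Y := by
    change tensorHom _ _ _ _ (pair (k := k) (𝟙 (X ⊗ X')) (λ_ (𝟙_ B)).hom)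
        (pair (k := k) (𝟙 (𝟙_ A)) (𝟙 Y)) ≫
      pair (k := k) ((ρ_ (X ⊗ X')).hom ≫ (λ_ (X ⊗ X')).inv) ((λ_ Y).hom ≫ (ρ_ Y).inv) =
      (pair (k := k) (α_ X X' (𝟙_ A)).hom (α_ (𝟙_ B) (𝟙_ B) Y).hom ≫
        tensorHom _ _ _ _ (pair (k := k) (𝟙 X) (𝟙 (𝟙_ B)))
          (pair (k := k) ((ρ_ X').hom ≫ (λ_ X').inv) ((λ_ Y).hom ≫ (ρ_ Y).inv)) ≫
        pair (k := k) (α_ X (𝟙_ A) X').inv (α_ (𝟙_ B) Y (𝟙_ B)).inv ≫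
        tensorHom _ _ _ _ (pair (k := k) ((ρ_ X).hom ≫ (λ_ X).inv) ((λ_ Y).hom ≫ (ρ_ Y).inv))
          (pair (k := k) (𝟙 X') (𝟙 (𝟙_ B))) ≫
        pair (k := k) (α_ (𝟙_ A) X X').hom (α_ Y (𝟙_ B) (𝟙_ B)).hom) ≫
      tensorHom _ _ _ _ (pair (k := k) (𝟙 (𝟙_ A)) (𝟙 Y))
        (pair (k := k) (𝟙 (X ⊗ X')) (λ_ (𝟙_ B)).hom)
    simp only [pair_tensor, pair_comp]
    congr 1
    all_goals simp
  tensor_right X Y Y' := by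
    change tensorHom _ _ _ _ (pair (k := k) (𝟙 X) (𝟙 (𝟙_ B)))
        (pair (k := k) (λ_ (𝟙_ A)).hom (𝟙 (Y ⊗ Y'))) ≫
      pair (k := k) ((ρ_ X).hom ≫ (λ_ X).inv) ((λ_ (Y ⊗ Y')).hom ≫ (ρ_ (Y ⊗ Y')).inv) =
      (pair (k := k) (α_ X (𝟙_ A) (𝟙_ A)).inv (α_ (𝟙_ B) Y Y').inv ≫
        tensorHom _ _ _ _ (pair (k := k) ((ρ_ X).hom ≫ (λ_ X).inv) ((λ_ Y).hom ≫ (ρ_ Y).inv))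
          (pair (k := k) (𝟙 (𝟙_ A)) (𝟙 Y')) ≫
        pair (k := k) (α_ (𝟙_ A) X (𝟙_ A)).hom (α_ Y (𝟙_ B) Y').hom ≫
        tensorHom _ _ _ _ (pair (k := k) (𝟙 (𝟙_ A)) (𝟙 Y))
          (pair (k := k) ((ρ_ X).hom ≫ (λ_ X).inv) ((λ_ Y').hom ≫ (ρ_ Y').inv)) ≫
        pair (k := k) (α_ (𝟙_ A) (𝟙_ A) X).inv (α_ Y Y' (𝟙_ B)).inv) ≫
      tensorHom _ _ _ _ (pair (k := k) (λ_ (𝟙_ A)).hom (𝟙 (Y ⊗ Y')))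
        (pair (k := k) (𝟙 X) (𝟙 (𝟙_ B)))
    simp only [pair_tensor, pair_comp]
    congr 1
    all_goals first | (simp; done) | monoidal

/-- With the next two lemmas, this shows that amalgamating the two canonical inclusions gives back
the identity of the linear product as a tensor functor. Applying `Φ` then gives the corresponding
statement for `Φ`. -/
lemma join_natural {Z Z' : LinearProduct k A B} (f : Z.fst ⟶ Z'.fst) (g : Z.snd ⟶ Z'.snd) :
    ((inl k A B).map f ⊗ₘ (inr k A B).map g) ≫ (join Z'.fst Z'.snd).hom =
      (join Z.fst Z.snd).hom ≫ homMk f g := by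
  change tensorHom _ _ _ _ (pair (k := k) f (𝟙 (𝟙_ B))) (pair (k := k) (𝟙 (𝟙_ A)) g) ≫
    pair (k := k) (ρ_ Z'.fst).hom (λ_ Z'.snd).hom =
    pair (k := k) (ρ_ Z.fst).hom (λ_ Z.snd).hom ≫ pair (k := k) f g
  rw [pair_tensor, pair_comp, pair_comp]
  congr 1 <;> simp

lemma join_unit : (λ_ (𝟙_ (LinearProduct k A B))).inv ≫
    (ε (inl k A B) ⊗ₘ ε (inr k A B)) ≫ (join (𝟙_ A) (𝟙_ B)).hom =
      𝟙 (𝟙_ (LinearProduct k A B)) := by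
  change pair (k := k) (λ_ (𝟙_ A)).inv (λ_ (𝟙_ B)).inv ≫
    tensorHom _ _ _ _ (pair (k := k) (𝟙 (𝟙_ A)) (𝟙 (𝟙_ B)))
      (pair (k := k) (𝟙 (𝟙_ A)) (𝟙 (𝟙_ B))) ≫
    pair (k := k) (ρ_ (𝟙_ A)).hom (λ_ (𝟙_ B)).hom = pair (k := k) (𝟙 (𝟙_ A)) (𝟙 (𝟙_ B))
  rw [pair_tensor, pair_comp, pair_comp]
  congr 1
  all_goals monoidal

/-- In each of the two components all morphisms are built from associators and unitors, so coherence
decides. -/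
lemma join_tensor (X X' : A) (Y Y' : B) :
    midExchange ((inl k A B).obj X) (swap (k := k) X' Y).inv ((inr k A B).obj Y') ≫
      (μ (inl k A B) X X' ⊗ₘ μ (inr k A B) Y Y') ≫ (join (k := k) (X ⊗ X') (Y ⊗ Y')).hom =
    ((join (k := k) X Y).hom ⊗ₘ (join (k := k) X' Y').hom :) := by
  change (pair (k := k) (α_ X (𝟙_ A) (X' ⊗ 𝟙_ A)).hom (α_ (𝟙_ B) Y (𝟙_ B ⊗ Y')).hom ≫
      tensorHom _ _ _ _ (pair (k := k) (𝟙 X) (𝟙 (𝟙_ B)))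
        (pair (k := k) (α_ (𝟙_ A) X' (𝟙_ A)).inv (α_ Y (𝟙_ B) Y').inv ≫
          tensorHom _ _ _ _
            (pair (k := k) ((λ_ X').hom ≫ (ρ_ X').inv) ((ρ_ Y).hom ≫ (λ_ Y).inv))
            (pair (k := k) (𝟙 (𝟙_ A)) (𝟙 Y')) ≫
          pair (k := k) (α_ X' (𝟙_ A) (𝟙_ A)).hom (α_ (𝟙_ B) Y Y').hom) ≫
      pair (k := k) (α_ X X' (𝟙_ A ⊗ 𝟙_ A)).inv (α_ (𝟙_ B) (𝟙_ B) (Y ⊗ Y')).inv) ≫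
    tensorHom _ _ _ _ (pair (k := k) (𝟙 (X ⊗ X')) (λ_ (𝟙_ B)).hom)
      (pair (k := k) (λ_ (𝟙_ A)).hom (𝟙 (Y ⊗ Y'))) ≫
    pair (k := k) (ρ_ (X ⊗ X')).hom (λ_ (Y ⊗ Y')).hom =
    tensorHom _ _ _ _ (pair (k := k) (ρ_ X).hom (λ_ Y).hom)
      (pair (k := k) (ρ_ X').hom (λ_ Y').hom)
  simp only [pair_tensor, pair_comp]
  congr 1
  all_goals monoidal

end LinearProduct

end UniversalCommutation

/-! ### Tensor functors on a linear product are the same as commuting pairs. -/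

namespace CommutingPair

variable {k : Type*} [Field k]
  {A : Type*} [Category A] [Preadditive A] [Linear k A] [MonoidalCategory A]
  [MonoidalPreadditive A] [MonoidalLinear k A]
  {B : Type*} [Category B] [Preadditive B] [Linear k B] [MonoidalCategory B]
  [MonoidalPreadditive B] [MonoidalLinear k B]
  {D : Type*} [Category D] [Preadditive D] [Linear k D] [MonoidalCategory D]

/-- The restrictions of a tensor functor on `A ⊠ B` to `A` and `B`. -/
def ofTensorFunctor (Φ : TensorFunctor k (LinearProduct k A B) D) :
    CommutingPair k A B D where
  fst := { toFunctor := LinearProduct.inr k A B ⋙ Φ.toFunctor }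
  snd := { toFunctor := LinearProduct.inl k A B ⋙ Φ.toFunctor }
  comm := (LinearProduct.universalCommutation k A B).map Φ.toFunctor

variable (k A B D) in
/-- The restrictions of tensor functors on `A ⊠ B` to `A` and `B`. -/
@[simps obj] def restriction :
    TensorFunctor k (LinearProduct k A B) D ⥤ CommutingPair k A B D where
  obj := ofTensorFunctor
  map {Φ Ψ} a :=
    { fst := ⟨Functor.whiskerLeft (LinearProduct.inr k A B) a.hom,
        NatTrans.IsMonoidal.whiskerLeft _⟩
      snd := ⟨Functor.whiskerLeft (LinearProduct.inl k A B) a.hom,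
        NatTrans.IsMonoidal.whiskerLeft _⟩
      comm X Y := by
        change (μ Φ.toFunctor _ _ ≫ Φ.map (LinearProduct.swap X Y).hom ≫ δ Φ.toFunctor _ _) ≫
          (a.hom.app _ ⊗ₘ a.hom.app _) = (a.hom.app _ ⊗ₘ a.hom.app _) ≫
          μ Ψ.toFunctor _ _ ≫ Ψ.map (LinearProduct.swap X Y).hom ≫ δ Ψ.toFunctor _ _
        -- Monoidality and naturality move `a` past the tensorator of `Φ` and the swap; composing
        -- with the invertible tensorator of `Ψ` then removes the inverse tensorators.
        rw [← NatTrans.IsMonoidal.tensor_assoc, ← NatTrans.naturality_assoc, Category.assoc,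
          Category.assoc, ← cancel_mono (μ Ψ.toFunctor _ _)]
        simp [← NatTrans.IsMonoidal.tensor] }

variable [MonoidalPreadditive D] [MonoidalLinear k D]

/-- The isomorphism `Φ (X ⊠ I) ⊗ Φ (I ⊠ Y) ≅ Φ (X ⊠ Y)`. -/
def amalgamRestrictionApp (Φ : TensorFunctor k (LinearProduct k A B) D)
    (Z : LinearProduct k A B) : (amalgam (ofTensorFunctor Φ)).obj Z ≅ Φ.obj Z :=
  letI e : Φ.obj ((LinearProduct.inl k A B).obj Z.fst) ⊗
      Φ.obj ((LinearProduct.inr k A B).obj Z.snd) ≅ Φ.obj Z :=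
    μIso Φ.toFunctor _ _ ≪≫ Φ.mapIso (LinearProduct.join Z.fst Z.snd)
  e

/-- The morphisms `f ⊠ g` generate each morphism group additively, so naturality into an additive
functor need only be checked on them. -/
lemma amalgamMap_comp (p : CommutingPair k A B D) (Φ : LinearProduct k A B ⥤ D) [Φ.Additive]
    {Z Z' : LinearProduct k A B} (n : p.snd.obj Z.fst ⊗ p.fst.obj Z.snd ⟶ Φ.obj Z)
    (n' : p.snd.obj Z'.fst ⊗ p.fst.obj Z'.snd ⟶ Φ.obj Z')
    (h : ∀ f g, (p.snd.map f ⊗ₘ p.fst.map g) ≫ n' = n ≫ Φ.map (LinearProduct.homMk f g))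
    (f : Z ⟶ Z') : amalgamMap p Z Z' f ≫ n' = n ≫ Φ.map f := by
  induction f using LinearProduct.hom_induction with
  | zero => simp
  | add _ _ h h' => simp only [map_add, Functor.map_add, Preadditive.add_comp,
      Preadditive.comp_add, h, h']
  | mk f g => rw [amalgamMap_homMk, h]

/-- The isomorphism of tensor functors `Φ (X ⊠ I) ⊗ Φ (I ⊠ Y) ≅ Φ (X ⊠ Y)`. -/
def amalgamRestrictionIso (Φ : TensorFunctor k (LinearProduct k A B) D) :
    amalgam (ofTensorFunctor Φ) ≅ Φ :=
  TensorFunctor.isoMk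
    (NatIso.ofComponents (F := (amalgam (ofTensorFunctor Φ)).toFunctor) (G := Φ.toFunctor)
      (amalgamRestrictionApp Φ) (fun {Z Z'} f =>
        amalgamMap_comp (ofTensorFunctor Φ) Φ.toFunctor
          (μ Φ.toFunctor _ _ ≫ Φ.map (LinearProduct.join Z.fst Z.snd).hom)
          (μ Φ.toFunctor _ _ ≫ Φ.map (LinearProduct.join Z'.fst Z'.snd).hom) (fun f g => by
        refine (μ_natural_assoc Φ.toFunctor ((LinearProduct.inl k A B).map f)
          ((LinearProduct.inr k A B).map g) _).trans ?_
        rw [← Φ.map_comp, LinearProduct.join_natural, Φ.map_comp]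
        exact (Category.assoc _ _ _).symm) f))
    { unit := by
        change ((λ_ (𝟙_ D)).inv ≫ ((ε Φ.toFunctor ≫ Φ.map (ε (LinearProduct.inl k A B))) ⊗ₘ
          (ε Φ.toFunctor ≫ Φ.map (ε (LinearProduct.inr k A B))))) ≫ μ Φ.toFunctor _ _ ≫
          Φ.map (LinearProduct.join (𝟙_ A) (𝟙_ B)).hom = ε Φ.toFunctor
        rw [← tensorHom_comp_tensorHom, Category.assoc, Category.assoc, μ_natural_assoc,
          tensorHom_def', Category.assoc, ← leftUnitor_inv_naturality_assoc,
          left_unitality_inv_assoc, ← Φ.map_comp, ← Φ.map_comp, LinearProduct.join_unit]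
        exact (congrArg _ (Φ.map_id _)).trans (Category.comp_id _)
      tensor Z Z' := by
        change (midExchange (Φ.obj ((LinearProduct.inl k A B).obj Z.fst))
          ((μ Φ.toFunctor _ _ ≫ Φ.map (LinearProduct.swap Z'.fst Z.snd).inv) ≫ δ Φ.toFunctor _ _)
          (Φ.obj ((LinearProduct.inr k A B).obj Z'.snd)) ≫
          ((μ Φ.toFunctor _ _ ≫ Φ.map (μ (LinearProduct.inl k A B) Z.fst Z'.fst)) ⊗ₘ
            (μ Φ.toFunctor _ _ ≫ Φ.map (μ (LinearProduct.inr k A B) Z.snd Z'.snd)))) ≫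
          μ Φ.toFunctor _ _ ≫
            Φ.map (LinearProduct.join (Z.fst ⊗ Z'.fst) (Z.snd ⊗ Z'.snd)).hom =
          ((μ Φ.toFunctor _ _ ≫ Φ.map (LinearProduct.join Z.fst Z.snd).hom) ⊗ₘ
            (μ Φ.toFunctor _ _ ≫ Φ.map (LinearProduct.join Z'.fst Z'.snd).hom)) ≫
              μ Φ.toFunctor Z Z'
        -- Naturality of the tensorator of `Φ` collects everything as the image under `Φ` of one
        -- morphism of the linear product; `join_tensor` evaluates it.
        rw [← tensorHom_comp_tensorHom, ← tensorHom_comp_tensorHom, Category.assoc,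
          Category.assoc, Category.assoc, Category.assoc, μ_natural, μ_natural_assoc,
          ← reassoc_of% (map_midExchange Φ.toFunctor _ _ _), ← Φ.map_comp, ← Φ.map_comp,
          LinearProduct.join_tensor] }

lemma amalgamRestrictionIso_natural {Φ Ψ : TensorFunctor k (LinearProduct k A B) D} (a : Φ ⟶ Ψ) :
    (amalgamation k A B D).map ((restriction k A B D).map a) ≫
      (amalgamRestrictionIso Ψ).hom = (amalgamRestrictionIso Φ).hom ≫ a := by
  refine TensorFunctor.hom_ext fun Z => ?_
  change (a.hom.app ((LinearProduct.inl k A B).obj Z.fst) ⊗ₘ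
    a.hom.app ((LinearProduct.inr k A B).obj Z.snd)) ≫ μ Ψ.toFunctor _ _ ≫
      Ψ.map (LinearProduct.join Z.fst Z.snd).hom =
    (μ Φ.toFunctor _ _ ≫ Φ.map (LinearProduct.join Z.fst Z.snd).hom) ≫ a.hom.app Z
  rw [← NatTrans.IsMonoidal.tensor_assoc, Category.assoc]
  exact congrArg (_ ≫ ·) (a.hom.naturality _).symm

variable (p : CommutingPair k A B D)

/-- The isomorphism `H X ≅ H X ⊗ F I`. -/
def restrictionSnd (X : A) : p.snd.obj X ≅ p.snd.obj X ⊗ p.fst.obj (𝟙_ B) :=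
  (ρ_ _).symm ≪≫ whiskerLeftIso _ (εIso p.fst.toFunctor)

/-- The isomorphism `F Y ≅ H I ⊗ F Y`. -/
def restrictionFst (Y : B) : p.fst.obj Y ≅ p.snd.obj (𝟙_ A) ⊗ p.fst.obj Y :=
  (λ_ _).symm ≪≫ whiskerRightIso (εIso p.snd.toFunctor) _

lemma restrictionSnd_hom (X : A) : (restrictionSnd p X).hom =
    (ρ_ _).inv ≫ p.snd.obj X ◁ ε p.fst.toFunctor := rfl

lemma restrictionFst_hom (Y : B) : (restrictionFst p Y).hom =
    (λ_ _).inv ≫ ε p.snd.toFunctor ▷ p.fst.obj Y := rfl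

/-- Two inserted units merge into one. This makes the insertion of `F I` after `H X`, and of `H I`
before `F Y`, compatible with tensor products. -/
lemma ε_tensor_ε_μ (H : A ⥤ D) [H.Monoidal] :
    (ε H ⊗ₘ ε H) ≫ μ H (𝟙_ A) (𝟙_ A) ≫ H.map (λ_ (𝟙_ A)).hom = (λ_ (𝟙_ D)).hom ≫ ε H := by
  rw [tensorHom_def', Category.assoc, ← Functor.LaxMonoidal.left_unitality,
    leftUnitor_naturality]

/-- The isomorphism of tensor functors `H X ≅ H X ⊗ F I`. -/
def restrictionSndIso : p.snd ≅ (ofTensorFunctor (amalgam p)).snd :=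
  TensorFunctor.isoMk
    (NatIso.ofComponents (F := p.snd.toFunctor) (G := (ofTensorFunctor (amalgam p)).snd.toFunctor)
      (restrictionSnd p) (fun {X X'} f => by
        change p.snd.map f ≫ (ρ_ _).inv ≫ _ ◁ ε p.fst.toFunctor =
          ((ρ_ _).inv ≫ _ ◁ ε p.fst.toFunctor) ≫ amalgamMap p ⟨X, 𝟙_ B⟩ ⟨X', 𝟙_ B⟩
            (LinearProduct.homMk f (𝟙 (𝟙_ B)))
        rw [amalgamMap_homMk, CategoryTheory.Functor.map_id, tensorHom_id,
          rightUnitor_inv_naturality_assoc,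
          Category.assoc, whisker_exchange]))
    { unit := by
        change ε p.snd.toFunctor ≫ (ρ_ _).inv ≫ _ ◁ ε p.fst.toFunctor =
          ((λ_ (𝟙_ D)).inv ≫ (ε p.snd.toFunctor ⊗ₘ ε p.fst.toFunctor)) ≫
            amalgamMap p ⟨𝟙_ A, 𝟙_ B⟩ ⟨𝟙_ A, 𝟙_ B⟩
              (LinearProduct.homMk (𝟙 (𝟙_ A)) (𝟙 (𝟙_ B)))
        rw [amalgamMap_homMk, CategoryTheory.Functor.map_id, CategoryTheory.Functor.map_id,
          id_tensorHom_id, Category.comp_id,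
          rightUnitor_inv_naturality_assoc, MonoidalCategory.tensorHom_def, unitors_inv_equal]
      tensor X X' := by
        change μ p.snd.toFunctor X X' ≫ (ρ_ _).inv ≫ _ ◁ ε p.fst.toFunctor =
          (((ρ_ _).inv ≫ _ ◁ ε p.fst.toFunctor) ⊗ₘ ((ρ_ _).inv ≫ _ ◁ ε p.fst.toFunctor)) ≫
          (midExchange (p.snd.obj X) (p.comm.iso X' (𝟙_ B)).inv (p.fst.obj (𝟙_ B)) ≫
            (μ p.snd.toFunctor X X' ⊗ₘ μ p.fst.toFunctor (𝟙_ B) (𝟙_ B))) ≫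
          amalgamMap p ⟨X ⊗ X', 𝟙_ B ⊗ 𝟙_ B⟩ ⟨X ⊗ X', 𝟙_ B⟩
            (LinearProduct.homMk (𝟙 (X ⊗ X')) (λ_ (𝟙_ B)).hom)
        -- The copy of `F I` inserted after `H X` has to cross `H X'`; by `comm_inv_unit_right` it
        -- does so trivially, and the two copies then merge.
        rw [amalgamMap_homMk, CategoryTheory.Functor.map_id, ← id_tensorHom, ← id_tensorHom,
          ← id_tensorHom,
          ← tensorHom_comp_tensorHom, Category.assoc, Category.assoc,
          reassoc_of% (midExchange_natural _ _ _ _ _ _ (comm_inv_unit_right p X')),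
          tensorHom_comp_tensorHom, tensorHom_comp_tensorHom, Category.comp_id, ε_tensor_ε_μ,
          id_tensorHom_id, Category.id_comp,
          MonoidalCategory.tensorHom_def (μ p.snd.toFunctor X X'), id_tensorHom, midExchange]
        monoidal }

/-- The isomorphism of tensor functors `F Y ≅ H I ⊗ F Y`. -/
def restrictionFstIso : p.fst ≅ (ofTensorFunctor (amalgam p)).fst :=
  TensorFunctor.isoMk
    (NatIso.ofComponents (F := p.fst.toFunctor) (G := (ofTensorFunctor (amalgam p)).fst.toFunctor)
      (restrictionFst p) (fun {Y Y'} f => by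
        change p.fst.map f ≫ (λ_ _).inv ≫ ε p.snd.toFunctor ▷ _ =
          ((λ_ _).inv ≫ ε p.snd.toFunctor ▷ _) ≫ amalgamMap p ⟨𝟙_ A, Y⟩ ⟨𝟙_ A, Y'⟩
            (LinearProduct.homMk (𝟙 (𝟙_ A)) f)
        rw [amalgamMap_homMk, CategoryTheory.Functor.map_id, id_tensorHom,
          leftUnitor_inv_naturality_assoc,
          Category.assoc, whisker_exchange]))
    { unit := by
        change ε p.fst.toFunctor ≫ (λ_ _).inv ≫ ε p.snd.toFunctor ▷ _ =
          ((λ_ (𝟙_ D)).inv ≫ (ε p.snd.toFunctor ⊗ₘ ε p.fst.toFunctor)) ≫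
            amalgamMap p ⟨𝟙_ A, 𝟙_ B⟩ ⟨𝟙_ A, 𝟙_ B⟩
              (LinearProduct.homMk (𝟙 (𝟙_ A)) (𝟙 (𝟙_ B)))
        rw [amalgamMap_homMk, CategoryTheory.Functor.map_id, CategoryTheory.Functor.map_id,
          id_tensorHom_id, Category.comp_id,
          leftUnitor_inv_naturality_assoc, tensorHom_def']
      tensor Y Y' := by
        change μ p.fst.toFunctor Y Y' ≫ (λ_ _).inv ≫ ε p.snd.toFunctor ▷ _ =
          (((λ_ _).inv ≫ ε p.snd.toFunctor ▷ _) ⊗ₘ ((λ_ _).inv ≫ ε p.snd.toFunctor ▷ _)) ≫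
          (midExchange (p.snd.obj (𝟙_ A)) (p.comm.iso (𝟙_ A) Y).inv (p.fst.obj Y') ≫
            (μ p.snd.toFunctor (𝟙_ A) (𝟙_ A) ⊗ₘ μ p.fst.toFunctor Y Y')) ≫
          amalgamMap p ⟨𝟙_ A ⊗ 𝟙_ A, Y ⊗ Y'⟩ ⟨𝟙_ A, Y ⊗ Y'⟩
            (LinearProduct.homMk (λ_ (𝟙_ A)).hom (𝟙 (Y ⊗ Y')))
        rw [amalgamMap_homMk, CategoryTheory.Functor.map_id, ← tensorHom_id, ← tensorHom_id,
          ← tensorHom_id,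
          ← tensorHom_comp_tensorHom, Category.assoc, Category.assoc,
          reassoc_of% (midExchange_natural _ _ _ _ _ _ (comm_inv_unit_left p Y)),
          tensorHom_comp_tensorHom, tensorHom_comp_tensorHom, Category.comp_id, ε_tensor_ε_μ,
          id_tensorHom_id, Category.id_comp,
          tensorHom_def' (_ ≫ ε p.snd.toFunctor), tensorHom_id, midExchange]
        monoidal }

lemma midExchange_unit {X Y : D} (b : X ⊗ Y ⟶ Y ⊗ X) :
    ((λ_ X).inv ⊗ₘ (ρ_ Y).inv) ≫ midExchange (𝟙_ D) b (𝟙_ D) =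
      b ≫ ((λ_ Y).inv ⊗ₘ (ρ_ X).inv) := by
  rw [midExchange]
  monoidal

/-- Once units are inserted on both sides, the middle of `H X ⊗ F I ⊗ H I ⊗ F Y` is a crossing of
two units, which is trivial. -/
lemma ε_tensor_ε_comm_inv : (ε p.fst.toFunctor ⊗ₘ ε p.snd.toFunctor) ≫
    (p.comm.iso (𝟙_ A) (𝟙_ B)).inv = 𝟙 (𝟙_ D ⊗ 𝟙_ D) ≫
      (ε p.snd.toFunctor ⊗ₘ ε p.fst.toFunctor) := by
  have h := comm_inv_unit_left p (𝟙_ B)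
  rw [id_tensorHom] at h
  rw [MonoidalCategory.tensorHom_def, Category.assoc, h, Category.assoc,
    rightUnitor_naturality_assoc, leftUnitor_inv_naturality_assoc, tensorHom_id, tensorHom_def',
    ← unitors_equal, Iso.hom_inv_id_assoc, Category.id_comp]

lemma comp_comp_retraction {V W X Y Z : D} (a : V ⟶ W) (b : W ⟶ X) (c : X ⟶ Y) (r : Y ⟶ Z)
    (s : Z ⟶ Y) (h : r ≫ s = 𝟙 Y) : a ≫ b ≫ c = (a ≫ b ≫ c ≫ r) ≫ s := by
  simp [h]

/-- Inserting the units makes both exchanges explicit. On the left the exchange becomes the inverse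
commutation and cancels against `p.comm`; on the right it crosses only units. Both sides thus reduce
to unitors. -/
lemma restriction_comm (X : A) (Y : B) :
    (p.comm.iso X Y).hom ≫ ((restrictionFst p Y).hom ⊗ₘ (restrictionSnd p X).hom) ≫
      midExchange (p.snd.obj (𝟙_ A)) (p.comm.iso X Y).inv (p.fst.obj (𝟙_ B)) ≫
        (μ p.snd.toFunctor (𝟙_ A) X ⊗ₘ μ p.fst.toFunctor Y (𝟙_ B)) =
    ((restrictionSnd p X).hom ⊗ₘ (restrictionFst p Y).hom) ≫
      (midExchange (p.snd.obj X) (p.comm.iso (𝟙_ A) (𝟙_ B)).inv (p.fst.obj Y) ≫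
        (μ p.snd.toFunctor X (𝟙_ A) ⊗ₘ μ p.fst.toFunctor (𝟙_ B) Y)) ≫
      (p.snd.map ((ρ_ X).hom ≫ (λ_ X).inv) ⊗ₘ p.fst.map ((λ_ Y).hom ≫ (ρ_ Y).inv)) := by
  have h₁ := midExchange_natural (ε p.snd.toFunctor) (𝟙 (p.fst.obj Y)) (𝟙 (p.snd.obj X))
    (ε p.fst.toFunctor) (p.comm.iso X Y).inv (p.comm.iso X Y).inv (by simp)
  have h₂ := midExchange_natural (𝟙 (p.snd.obj X)) (ε p.fst.toFunctor) (ε p.snd.toFunctor)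
    (𝟙 (p.fst.obj Y)) _ _ (ε_tensor_ε_comm_inv p)
  rw [restrictionFst_hom, restrictionSnd_hom, ← tensorHom_id, ← id_tensorHom,
    ← tensorHom_comp_tensorHom, ← tensorHom_comp_tensorHom,
    Category.assoc, Category.assoc, Category.assoc, reassoc_of% h₁, reassoc_of% h₂,
    reassoc_of% (midExchange_unit (p.comm.iso X Y).inv), Iso.hom_inv_id_assoc]
  simp only [tensorHom_comp_tensorHom, id_tensorHom, tensorHom_id, Functor.map_comp,
    left_unitality_inv,
    right_unitality_inv, ← Functor.LaxMonoidal.right_unitality_assoc,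
    ← Functor.LaxMonoidal.left_unitality_assoc]
  rw [← tensorHom_comp_tensorHom (ρ_ (p.snd.obj X)).hom, midExchange]
  monoidal

/-- The isomorphism of a commuting pair with the restrictions of its amalgam. -/
def restrictionAmalgamIso : p ≅ ofTensorFunctor (amalgam p) :=
  isoMk (restrictionFstIso p) (restrictionSndIso p) fun X Y => by
    have h := restriction_comm p X Y
    rw [← amalgamMap_homMk p (Z := ⟨X ⊗ 𝟙_ A, 𝟙_ B ⊗ Y⟩) (Z' := ⟨𝟙_ A ⊗ X, Y ⊗ 𝟙_ B⟩)] at h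
    change (p.comm.iso X Y).hom ≫ ((restrictionFst p Y).hom ⊗ₘ (restrictionSnd p X).hom) =
      ((restrictionSnd p X).hom ⊗ₘ (restrictionFst p Y).hom) ≫
      μ (amalgam p).toFunctor ((LinearProduct.inl k A B).obj X) ((LinearProduct.inr k A B).obj Y) ≫
        (amalgam p).map (LinearProduct.swap X Y).hom ≫
        δ (amalgam p).toFunctor ((LinearProduct.inr k A B).obj Y) ((LinearProduct.inl k A B).obj X)
    refine (cancel_mono (μ (amalgam p).toFunctor ((LinearProduct.inr k A B).obj Y)
      ((LinearProduct.inl k A B).obj X))).1 (Eq.trans ?_ (h.trans ?_))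
    · exact Category.assoc _ _ _
    · exact comp_comp_retraction _ _ _ _ _ (Functor.Monoidal.δ_μ _ _ _)

lemma restrictionAmalgamIso_natural {p q : CommutingPair k A B D} (a : p ⟶ q) :
    a ≫ (restrictionAmalgamIso q).hom =
      (restrictionAmalgamIso p).hom ≫ (restriction k A B D).map ((amalgamation k A B D).map a) := by
  refine hom_ext (TensorFunctor.hom_ext fun Y => ?_) (TensorFunctor.hom_ext fun X => ?_)
  · change a.fst.hom.app Y ≫ (λ_ _).inv ≫ ε q.snd.toFunctor ▷ q.fst.obj Y =
      ((λ_ _).inv ≫ ε p.snd.toFunctor ▷ p.fst.obj Y) ≫ (a.snd.hom.app (𝟙_ A) ⊗ₘ a.fst.hom.app Y)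
    rw [MonoidalCategory.tensorHom_def, Category.assoc, ← comp_whiskerRight_assoc,
      NatTrans.IsMonoidal.unit, ← whisker_exchange, leftUnitor_inv_naturality_assoc]
  · change a.snd.hom.app X ≫ (ρ_ _).inv ≫ q.snd.obj X ◁ ε q.fst.toFunctor =
      ((ρ_ _).inv ≫ p.snd.obj X ◁ ε p.fst.toFunctor) ≫ (a.snd.hom.app X ⊗ₘ a.fst.hom.app (𝟙_ B))
    rw [tensorHom_def', Category.assoc, ← whiskerLeft_comp_assoc,
      NatTrans.IsMonoidal.unit, whisker_exchange, rightUnitor_inv_naturality_assoc]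

variable (k A B D) in
/-- Tensor functors on `A ⊠ B` are commuting pairs of tensor functors. -/
def equivalence : TensorFunctor k (LinearProduct k A B) D ≌ CommutingPair k A B D :=
  CategoryTheory.Equivalence.mk (restriction k A B D) (amalgamation k A B D)
    (NatIso.ofComponents (F := restriction k A B D ⋙ amalgamation k A B D) (G := 𝟭 _)
      amalgamRestrictionIso amalgamRestrictionIso_natural).symm
    (NatIso.ofComponents (F := 𝟭 _) (G := amalgamation k A B D ⋙ restriction k A B D)
      restrictionAmalgamIso restrictionAmalgamIso_natural).symm

instance : (restriction k A B D).IsEquivalence :=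
  (equivalence k A B D).isEquivalence_functor

end CommutingPair

/-! ### Bending strands: half-braidings versus morphisms into conjugates. -/

section HalfBraidings

variable {D : Type*} [Category D] [MonoidalCategory D]

/-- The morphism `X ⊗ P ⟶ P ⊗ Z` obtained from `x : X ⟶ P ⊗ Z ⊗ Q` and `e : Q ⊗ P ⟶ I`. -/
def braidOfStr {P Q : D} (e : Q ⊗ P ⟶ 𝟙_ D) {X Z : D} (x : X ⟶ P ⊗ (Z ⊗ Q)) : X ⊗ P ⟶ P ⊗ Z :=
  x ▷ P ⊗≫ (P ⊗ Z) ◁ e ≫ (ρ_ _).hom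

/-- The morphism `X ⟶ P ⊗ Z ⊗ Q` obtained from `b : X ⊗ P ⟶ P ⊗ Z` and `c : I ⟶ P ⊗ Q`. -/
def strOfBraid {P Q : D} (c : 𝟙_ D ⟶ P ⊗ Q) {X Z : D} (b : X ⊗ P ⟶ P ⊗ Z) : X ⟶ P ⊗ (Z ⊗ Q) :=
  𝟙 _ ⊗≫ X ◁ c ⊗≫ b ▷ Q ⊗≫ 𝟙 _

instance {P Q : D} (c : 𝟙_ D ⟶ P ⊗ Q) {X Z : D} (b : X ⊗ P ⟶ P ⊗ Z) [IsIso c] [IsIso b] :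
    IsIso (strOfBraid c b) := by
  dsimp only [strOfBraid, monoidalComp]
  infer_instance

instance {P Q : D} (e : Q ⊗ P ⟶ 𝟙_ D) {X Z : D} (x : X ⟶ P ⊗ (Z ⊗ Q)) [IsIso e] [IsIso x] :
    IsIso (braidOfStr e x) := by
  dsimp only [braidOfStr, monoidalComp]
  infer_instance

/-- One operation creates the cup `c`, the other closes it with the cap `e`. The interchange law
brings them together and the zigzag identity for `P` removes them; the opposite composite uses the
zigzag identity for `Q`. -/
lemma braidOfStr_strOfBraid {P Q : D} (e : Q ⊗ P ⟶ 𝟙_ D) (c : 𝟙_ D ⟶ P ⊗ Q)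
    (h : c ▷ P ≫ (α_ P Q P).hom ≫ P ◁ e = (λ_ P).hom ≫ (ρ_ P).inv) {X Z : D}
    (b : X ⊗ P ⟶ P ⊗ Z) : braidOfStr e (strOfBraid c b) = b := by
  dsimp only [braidOfStr, strOfBraid]
  calc _ = 𝟙 _ ⊗≫ X ◁ c ▷ P ⊗≫ (b ▷ (Q ⊗ P) ≫ (P ⊗ Z) ◁ e) ⊗≫ 𝟙 _ := by monoidal
    _ = 𝟙 _ ⊗≫ X ◁ (c ▷ P ≫ (α_ P Q P).hom ≫ P ◁ e) ⊗≫ b ⊗≫ 𝟙 _ := by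
        rw [← whisker_exchange]; monoidal
    _ = _ := by rw [h]; monoidal

lemma strOfBraid_braidOfStr {P Q : D} (e : Q ⊗ P ⟶ 𝟙_ D) (c : 𝟙_ D ⟶ P ⊗ Q)
    (h : Q ◁ c ≫ (α_ Q P Q).inv ≫ e ▷ Q = (ρ_ Q).hom ≫ (λ_ Q).inv) {X Z : D}
    (x : X ⟶ P ⊗ (Z ⊗ Q)) : strOfBraid c (braidOfStr e x) = x := by
  dsimp only [braidOfStr, strOfBraid]
  calc _ = 𝟙 _ ⊗≫ (X ◁ c ≫ x ▷ (P ⊗ Q)) ⊗≫ (P ⊗ Z) ◁ e ▷ Q ⊗≫ 𝟙 _ := by monoidal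
    _ = 𝟙 _ ⊗≫ x ⊗≫ (P ⊗ Z) ◁ (Q ◁ c ≫ (α_ Q P Q).inv ≫ e ▷ Q) ⊗≫ 𝟙 _ := by
        rw [whisker_exchange]; monoidal
    _ = _ := by rw [h]; monoidal

/-- Bending is natural in source and target. Where it is also injective, a morphism is therefore
equivariant if and only if it commutes with the braidings. -/
lemma braidOfStr_comp_left {P Q : D} (e : Q ⊗ P ⟶ 𝟙_ D) {W X Z : D} (f : W ⟶ X)
    (x : X ⟶ P ⊗ (Z ⊗ Q)) : braidOfStr e (f ≫ x) = f ▷ P ≫ braidOfStr e x := by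
  dsimp only [braidOfStr]
  monoidal

lemma braidOfStr_comp_right {P Q : D} (e : Q ⊗ P ⟶ 𝟙_ D) {X Z W : D} (x : X ⟶ P ⊗ (Z ⊗ Q))
    (f : Z ⟶ W) : braidOfStr e (x ≫ P ◁ (f ▷ Q)) = braidOfStr e x ≫ P ◁ f := by
  dsimp only [braidOfStr]
  calc _ = x ▷ P ⊗≫ P ◁ (f ▷ (Q ⊗ P) ≫ W ◁ e) ≫ P ◁ (ρ_ _).hom := by monoidal
    _ = _ := by rw [← whisker_exchange]; monoidal

/-- The contraction in `conjμ` joins the strand `Q` leaving `x` to the strand `P` leaving `y`, which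
has the effect of crossing `Y` and then `X`. -/
lemma braidOfStr_tensor {P Q : D} (e : Q ⊗ P ⟶ 𝟙_ D) {X Y : D} (x : X ⟶ P ⊗ (X ⊗ Q))
    (y : Y ⟶ P ⊗ (Y ⊗ Q)) : braidOfStr e ((x ⊗ₘ y) ≫ conjμ e X Y) =
      (α_ _ _ _).hom ≫ X ◁ braidOfStr e y ≫ (α_ _ _ _).inv ≫ braidOfStr e x ▷ Y ≫
        (α_ _ _ _).hom := by
  rw [tensorHom_def']
  dsimp only [braidOfStr, conjμ]
  calc _ = 𝟙 _ ⊗≫ X ◁ y ▷ P ⊗≫ x ▷ (P ⊗ Y ⊗ Q ⊗ P) ⊗≫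
        (P ⊗ X) ◁ (e ▷ (Y ⊗ (Q ⊗ P)) ≫ 𝟙_ D ◁ (Y ◁ e)) ⊗≫ 𝟙 _ := by monoidal
    _ = 𝟙 _ ⊗≫ X ◁ y ▷ P ⊗≫ (x ▷ (P ⊗ Y ⊗ Q ⊗ P) ≫ (P ⊗ X ⊗ Q) ◁ (P ◁ (Y ◁ e))) ⊗≫
        (P ⊗ X) ◁ (e ▷ Y) ⊗≫ 𝟙 _ := by rw [← whisker_exchange]; monoidal
    _ = _ := by rw [← whisker_exchange]; monoidal

lemma braidOfStr_unit {P Q : D} (e : Q ⊗ P ⟶ 𝟙_ D) (c : 𝟙_ D ⟶ P ⊗ Q)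
    (h : c ▷ P ≫ (α_ P Q P).hom ≫ P ◁ e = (λ_ P).hom ≫ (ρ_ P).inv) :
    braidOfStr e (c ≫ P ◁ (λ_ Q).inv) = (λ_ P).hom ≫ (ρ_ P).inv := by
  rw [← h]
  dsimp only [braidOfStr]
  monoidal

/-- By `h` the cap of the product is the nest of the two caps `e` and `e'`, so the strand of the
product splits into two parallel strands crossing `X` in turn. This translates the condition on
`x_{gh}` into multiplicativity of the braiding. -/
lemma braidOfStr_mul {P P' P'' Q Q' Q'' : D} (m : P ⊗ P' ⟶ P'') (n : Q' ⊗ Q ⟶ Q'')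
    (e : Q ⊗ P ⟶ 𝟙_ D) (e' : Q' ⊗ P' ⟶ 𝟙_ D) (e'' : Q'' ⊗ P'' ⟶ 𝟙_ D)
    (h : (n ▷ (P ⊗ P') ≫ Q'' ◁ m) ≫ e'' = 𝟙 _ ⊗≫ Q' ◁ e ▷ P' ⊗≫ e') {X : D}
    (x : X ⟶ P ⊗ (X ⊗ Q)) (x' : X ⟶ P' ⊗ (X ⊗ Q')) :
    X ◁ m ≫ braidOfStr e'' (x ≫ P ◁ (x' ▷ Q) ≫ conjMul m n X) =
      ((α_ _ _ _).inv ≫ braidOfStr e x ▷ P' ≫ (α_ _ _ _).hom ≫ P ◁ braidOfStr e' x' ≫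
        (α_ _ _ _).inv) ≫ m ▷ X := by
  dsimp only [braidOfStr, conjMul]
  calc _ = 𝟙 _ ⊗≫ (X ◁ m ≫ (x ≫ P ◁ (x' ▷ Q)) ▷ P'') ⊗≫ m ▷ (X ⊗ (Q' ⊗ Q) ⊗ P'') ⊗≫
        (P'' ⊗ X) ◁ (n ▷ P'' ≫ e'') ⊗≫ 𝟙 _ := by monoidal
    _ = 𝟙 _ ⊗≫ (x ≫ P ◁ (x' ▷ Q)) ▷ (P ⊗ P') ⊗≫ ((P ⊗ P') ◁ (X ◁ (Q' ⊗ Q) ◁ m) ≫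
        m ▷ (X ⊗ (Q' ⊗ Q) ⊗ P'')) ⊗≫ (P'' ⊗ X) ◁ (n ▷ P'' ≫ e'') ⊗≫ 𝟙 _ := by
        rw [whisker_exchange]; monoidal
    _ = 𝟙 _ ⊗≫ (x ≫ P ◁ (x' ▷ Q)) ▷ (P ⊗ P') ⊗≫ m ▷ (X ⊗ (Q' ⊗ Q) ⊗ (P ⊗ P')) ⊗≫
        (P'' ⊗ X) ◁ ((Q' ⊗ Q) ◁ m ≫ n ▷ P'' ≫ e'') ⊗≫ 𝟙 _ := by
        rw [whisker_exchange]; monoidal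
    _ = 𝟙 _ ⊗≫ (x ≫ P ◁ (x' ▷ Q)) ▷ (P ⊗ P') ⊗≫ m ▷ (X ⊗ (Q' ⊗ Q) ⊗ (P ⊗ P')) ⊗≫
        P'' ◁ (X ◁ ((n ▷ (P ⊗ P') ≫ Q'' ◁ m) ≫ e'')) ⊗≫ 𝟙 _ := by
        rw [whisker_exchange_assoc]; monoidal
    -- Here the cap `e''` is replaced by the nested caps; the moves before and after are
    -- interchanges.
    _ = 𝟙 _ ⊗≫ (x ≫ P ◁ (x' ▷ Q)) ▷ (P ⊗ P') ⊗≫ (m ▷ (X ⊗ (Q' ⊗ Q) ⊗ (P ⊗ P')) ≫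
        P'' ◁ (X ◁ (𝟙 _ ⊗≫ Q' ◁ e ▷ P' ⊗≫ e'))) ⊗≫ 𝟙 _ := by
        rw [h]; monoidal
    _ = 𝟙 _ ⊗≫ x ▷ (P ⊗ P') ⊗≫ P ◁ ((x' ▷ (Q ⊗ P) ≫ (P' ⊗ X ⊗ Q') ◁ e) ▷ P') ⊗≫
        (P ⊗ P' ⊗ X) ◁ e' ⊗≫ m ▷ X ⊗≫ 𝟙 _ := by
        rw [← whisker_exchange]; monoidal
    _ = _ := by rw [← whisker_exchange]; monoidal

/-- Transformations which preserve the caps may be applied before or after bending. The next lemma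
is the counterpart for cups; between them they match the morphisms of equivariant pairs with those
of commuting pairs. -/
lemma braidOfStr_map {P P' Q Q' : D} (e : Q ⊗ P ⟶ 𝟙_ D) (e' : Q' ⊗ P' ⟶ 𝟙_ D) (a : P ⟶ P')
    (a' : Q ⟶ Q') (h : (a' ⊗ₘ a) ≫ e' = e) {X Z Z' : D} (b : Z ⟶ Z')
    (x : X ⟶ P ⊗ (Z ⊗ Q)) :
    X ◁ a ≫ braidOfStr e' (x ≫ (a ⊗ₘ (b ⊗ₘ a'))) = braidOfStr e x ≫ (a ⊗ₘ b) := by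
  rw [← h]
  rw [MonoidalCategory.tensorHom_def (b), MonoidalCategory.tensorHom_def a,
    MonoidalCategory.tensorHom_def a', MonoidalCategory.tensorHom_def a]
  dsimp only [braidOfStr]
  calc _ = (X ◁ a ≫ x ▷ P') ⊗≫ a ▷ (Z ⊗ Q ⊗ P') ⊗≫ P' ◁ (b ▷ (Q ⊗ P')) ⊗≫
        (P' ⊗ Z') ◁ (a' ▷ P' ≫ e') ⊗≫ 𝟙 _ := by monoidal
    _ = x ▷ P ⊗≫ (P ◁ ((Z ⊗ Q) ◁ a) ≫ a ▷ ((Z ⊗ Q) ⊗ P')) ⊗≫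
        P' ◁ (b ▷ (Q ⊗ P') ≫ Z' ◁ (a' ▷ P' ≫ e')) ⊗≫ 𝟙 _ := by
        rw [whisker_exchange]; monoidal
    _ = x ▷ P ⊗≫ a ▷ (Z ⊗ Q ⊗ P) ⊗≫ P' ◁ (Z ◁ (Q ◁ a ≫ a' ▷ P' ≫ e')) ⊗≫
        P' ◁ b ⊗≫ 𝟙 _ := by
        rw [whisker_exchange a, ← whisker_exchange b]; monoidal
    _ = x ▷ P ⊗≫ (a ▷ (Z ⊗ Q ⊗ P) ≫ P' ◁ (Z ◁ (a' ▷ P ≫ Q' ◁ a ≫ e'))) ⊗≫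
        P' ◁ b ⊗≫ 𝟙 _ := by
        rw [whisker_exchange_assoc]; monoidal
    _ = _ := by rw [← whisker_exchange]; monoidal

lemma strOfBraid_map {P P' Q Q' : D} (c : 𝟙_ D ⟶ P ⊗ Q) (c' : 𝟙_ D ⟶ P' ⊗ Q') (a : P ⟶ P')
    (a' : Q ⟶ Q') (h : c ≫ (a ⊗ₘ a') = c') {X X' : D} (f : X ⟶ X')
    (b : X ⊗ P ⟶ P ⊗ X) (b' : X' ⊗ P' ⟶ P' ⊗ X') (hb : b ≫ (a ⊗ₘ f) = (f ⊗ₘ a) ≫ b') :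
    strOfBraid c b ≫ (a ⊗ₘ (f ⊗ₘ a')) = f ≫ strOfBraid c' b' := by
  rw [← h]
  dsimp only [strOfBraid]
  calc _ = 𝟙 _ ⊗≫ X ◁ c ⊗≫ (b ≫ (a ⊗ₘ f)) ▷ Q ⊗≫ P' ◁ (X' ◁ a') ⊗≫ 𝟙 _ := by
        rw [MonoidalCategory.tensorHom_def (f), MonoidalCategory.tensorHom_def a,
          MonoidalCategory.tensorHom_def a]
        monoidal
    _ = 𝟙 _ ⊗≫ (X ◁ c ≫ f ▷ (P ⊗ Q)) ⊗≫ X' ◁ (a ▷ Q) ⊗≫ (b' ▷ Q ≫ (P' ⊗ X') ◁ a') ⊗≫ 𝟙 _ := by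
        rw [hb, MonoidalCategory.tensorHom_def f]
        monoidal
    _ = _ := by
        rw [whisker_exchange f, ← whisker_exchange b', MonoidalCategory.tensorHom_def a]
        monoidal

end HalfBraidings

/-! ### From commutations to functors with values in equivariant objects. -/

section EquivariantFunctors

variable {k : Type*} [Field k] {G : Type*} [Group G]
  {B' : Type*} [Category B'] [MonoidalCategory B']
  {B : Type*} [Category B] [MonoidalCategory B]
  {C : Type*} [Category C] [MonoidalCategory C]

section

variable {D : Type*} [Category D] [MonoidalCategory D]

/-- The restriction of a commutation along a monoidal functor. -/
@[simps] def Commutation.compRight {H : C ⥤ D} {F : B ⥤ D} [H.Monoidal] [F.Monoidal]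
    (c : Commutation H F) (I : B' ⥤ B) [I.Monoidal] : Commutation H (I ⋙ F) where
  iso X Y := c.iso X (I.obj Y)
  natural_left f Y := c.natural_left f (I.obj Y)
  natural_right X _ _ f := c.natural_right X (I.map f)
  tensor_left X X' Y := c.tensor_left X X' (I.obj Y)
  tensor_right X Y Y' := by
    rw [comp_μ]
    dsimp only [Functor.comp_obj]
    rw [whiskerLeft_comp, Category.assoc, c.natural_right, reassoc_of% (c.tensor_right X),
      comp_whiskerRight]
    simp only [Category.assoc]

variable (P : Discrete G ⥤ D) [P.Monoidal]

lemma braidOfStr_ev_injective (g : Discrete G) {X Z : D} : Function.Injective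
    (fun x : X ⟶ P.obj g ⊗ (Z ⊗ P.obj (ginv g)) => braidOfStr (evIso P g).hom x) :=
  Function.LeftInverse.injective (g := strOfBraid (coevIso P g).hom)
    (strOfBraid_braidOfStr _ _ (ev_coev_right P g))

variable {P} {P' : Discrete G ⥤ D} [P'.Monoidal] (τ : P ⟶ P') [NatTrans.IsMonoidal τ]

lemma mulIso_natural {a b c : Discrete G} (h : a.as * b.as = c.as) :
    (mulIso P h).hom ≫ τ.app c = (τ.app a ⊗ₘ τ.app b) ≫ (mulIso P' h).hom := by
  simp only [mulIso, Iso.trans_hom, μIso_hom, Functor.mapIso_hom, Category.assoc]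
  rw [τ.naturality, NatTrans.IsMonoidal.tensor_assoc]

/-- Evaluation and coevaluation are made from the monoidal structure alone, so every monoidal
transformation preserves them. -/
lemma ev_natural (g : Discrete G) :
    (τ.app (ginv g) ⊗ₘ τ.app g) ≫ (evIso P' g).hom = (evIso P g).hom := by
  rw [← cancel_mono (ε P'), Category.assoc, ev_ε, ← mulIso_natural, ← ev_ε, Category.assoc,
    NatTrans.IsMonoidal.unit]

lemma coev_natural (g : Discrete G) :
    (coevIso P g).hom ≫ (τ.app g ⊗ₘ τ.app (ginv g)) = (coevIso P' g).hom := by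
  rw [← cancel_mono (mulIso P' (c := 𝟙_ (Discrete G)) (mul_inv_cancel g.as)).hom, coev_mulIso,
    Category.assoc, ← mulIso_natural, reassoc_of% (coev_mulIso P g), NatTrans.IsMonoidal.unit]

end

variable {D : Type*} [Category D] [Preadditive D] [Linear k D] [MonoidalCategory D]
  [MonoidalPreadditive D] [MonoidalLinear k D]
  {P : Discrete G ⥤ D} [P.Monoidal] {H : C ⥤ D} [H.Monoidal]

namespace Commutation

variable (c : Commutation H P)

/-- The isomorphism `H X ≅ P g ⊗ H X ⊗ P g⁻¹` corresponding to the commutation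
`H X ⊗ P g ≅ P g ⊗ H X`. -/
def str (X : C) (g : Discrete G) : H.obj X ≅ P.obj g ⊗ (H.obj X ⊗ P.obj (ginv g)) :=
  asIso (strOfBraid (coevIso P g).hom (c.iso X g).hom)

lemma braidOfStr_str (X : C) (g : Discrete G) :
    braidOfStr (evIso P g).hom (c.str X g).hom = (c.iso X g).hom :=
  braidOfStr_strOfBraid _ _ (ev_coev_left P g) _

variable (k) in
/-- The equivariant object `H X`. -/
@[simps] def equivariantObj (X : C) : EquivariantObj (innerAction k P) where
  obj := H.obj X
  iso g := c.str X g
  iso_mul g h := braidOfStr_ev_injective P (g ⊗ h) (by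
    -- After bending, and up to the invertible `μ P g h`, the condition on the structure at `g ⊗ h`
    -- is the axiom `tensor_right`.
    refine (cancel_epi (H.obj X ◁ μ P g h)).1 ?_
    refine Eq.trans ?_ (braidOfStr_mul _ _ _ _ _ (invMul_ev P g h) (c.str X g).hom
      (c.str X h).hom).symm
    dsimp only
    rw [braidOfStr_str, braidOfStr_str, braidOfStr_str, c.tensor_right])

variable (k) in
/-- The functor `H` with values in equivariant objects. -/
@[simps] def equivariantFunctor : C ⥤ EquivariantObj (innerAction k P) where
  obj X := c.equivariantObj k X
  map {X Y} f := ⟨H.map f, fun g => braidOfStr_ev_injective P g (by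
    -- Bent, the equivariance of `H f` is naturality of the commutation in `X`.
    refine (braidOfStr_comp_right _ (c.str X g).hom (H.map f)).trans (Eq.trans ?_
      (braidOfStr_comp_left _ (H.map f) (c.str Y g).hom).symm)
    rw [braidOfStr_str, braidOfStr_str, c.natural_left])⟩
  map_id X := EquivariantObj.hom_ext (H.map_id X)
  map_comp f g := EquivariantObj.hom_ext (H.map_comp f g)

/-- The unit and the tensorator of `H` are equivariant because of `unit_left` and `tensor_left`
after bending. The coherence axioms are equations between underlying morphisms and hold for `H`. -/
instance : (c.equivariantFunctor k).Monoidal := Functor.CoreMonoidal.toMonoidal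
  { εIso := EquivariantObj.isoMk (εIso H) fun g => braidOfStr_ev_injective P g (by
      refine (braidOfStr_comp_right _ ((coevIso P g).hom ≫ P.obj g ◁ (λ_ _).inv)
        (ε H)).trans (Eq.trans ?_ (braidOfStr_comp_left _ (ε H) (c.str (𝟙_ C) g).hom).symm)
      rw [braidOfStr_unit _ _ (ev_coev_left P g), braidOfStr_str, c.unit_left, Category.assoc])
    μIso X Y := EquivariantObj.isoMk (μIso H X Y) fun g => braidOfStr_ev_injective P g (by
      refine (braidOfStr_comp_right _ (((c.str X g).hom ⊗ₘ (c.str Y g).hom) ≫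
        conjμ (evIso P g).hom (H.obj X) (H.obj Y)) (μ H X Y)).trans (Eq.trans ?_
        (braidOfStr_comp_left _ (μ H X Y) (c.str (X ⊗ Y) g).hom).symm)
      rw [braidOfStr_tensor, braidOfStr_str, braidOfStr_str, braidOfStr_str, c.tensor_left])
    μIso_hom_natural_left f Z := EquivariantObj.hom_ext (μ_natural_left H f Z)
    μIso_hom_natural_right Z f := EquivariantObj.hom_ext (μ_natural_right H Z f)
    associativity X Y Z := EquivariantObj.hom_ext (Functor.LaxMonoidal.associativity H X Y Z)
    left_unitality X := EquivariantObj.hom_ext (Functor.LaxMonoidal.left_unitality H X)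
    right_unitality X := EquivariantObj.hom_ext (Functor.LaxMonoidal.right_unitality H X) }

instance [Preadditive C] [H.Additive] : (c.equivariantFunctor k).Additive where
  map_add := EquivariantObj.hom_ext H.map_add

instance [Preadditive C] [Linear k C] [H.Linear k] : (c.equivariantFunctor k).Linear k where
  map_smul f r := EquivariantObj.hom_ext (H.map_smul r f)

end Commutation

end EquivariantFunctors

/-! ### Commutations with graded vector spaces are determined at the objects `δ g`. -/

section GradedCommutations

section

variable {D : Type*} [Category D] [MonoidalCategory D]

/-- Composite crossings inherit naturality from their parts. This and the next lemma let a hexagon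
for graded spaces be pulled back along the inclusions of their summands. -/
lemma hexagon_left_natural {X X' P P' : D} (f : P ⟶ P') (b : X ⊗ P ⟶ P ⊗ X)
    (b₁ : X ⊗ P' ⟶ P' ⊗ X) (h : X ◁ f ≫ b₁ = b ≫ f ▷ X) (b' : X' ⊗ P ⟶ P ⊗ X')
    (b₁' : X' ⊗ P' ⟶ P' ⊗ X') (h' : X' ◁ f ≫ b₁' = b' ≫ f ▷ X') :
    (X ⊗ X') ◁ f ≫ (α_ _ _ _).hom ≫ X ◁ b₁' ≫ (α_ _ _ _).inv ≫ b₁ ▷ X' ≫ (α_ _ _ _).hom =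
      ((α_ _ _ _).hom ≫ X ◁ b' ≫ (α_ _ _ _).inv ≫ b ▷ X' ≫ (α_ _ _ _).hom) ≫ f ▷ (X ⊗ X') := by
  calc _ = 𝟙 _ ⊗≫ X ◁ (X' ◁ f ≫ b₁') ⊗≫ b₁ ▷ X' ⊗≫ 𝟙 _ := by monoidal
    _ = 𝟙 _ ⊗≫ X ◁ b' ⊗≫ (X ◁ f ≫ b₁) ▷ X' ⊗≫ 𝟙 _ := by rw [h']; monoidal
    _ = _ := by rw [h]; monoidal

lemma hexagon_right_natural {X P P' Q Q' : D} (f : P ⟶ P') (g : Q ⟶ Q') (b : X ⊗ P ⟶ P ⊗ X)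
    (b₁ : X ⊗ P' ⟶ P' ⊗ X) (h : X ◁ f ≫ b₁ = b ≫ f ▷ X) (b' : X ⊗ Q ⟶ Q ⊗ X)
    (b₁' : X ⊗ Q' ⟶ Q' ⊗ X) (h' : X ◁ g ≫ b₁' = b' ≫ g ▷ X) :
    X ◁ (f ⊗ₘ g) ≫ (α_ _ _ _).inv ≫ b₁ ▷ Q' ≫ (α_ _ _ _).hom ≫ P' ◁ b₁' ≫ (α_ _ _ _).inv =
      ((α_ _ _ _).inv ≫ b ▷ Q ≫ (α_ _ _ _).hom ≫ P ◁ b' ≫ (α_ _ _ _).inv) ≫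
        (f ⊗ₘ g) ▷ X := by
  calc _ = 𝟙 _ ⊗≫ X ◁ f ▷ Q ⊗≫ ((X ⊗ P') ◁ g ≫ b₁ ▷ Q') ⊗≫ P' ◁ b₁' ⊗≫ 𝟙 _ := by
        rw [MonoidalCategory.tensorHom_def]
        monoidal
    _ = 𝟙 _ ⊗≫ (X ◁ f ≫ b₁) ▷ Q ⊗≫ P' ◁ (X ◁ g ≫ b₁') ⊗≫ 𝟙 _ := by
        rw [whisker_exchange]; monoidal
    _ = 𝟙 _ ⊗≫ b ▷ Q ⊗≫ (f ▷ (X ⊗ Q) ≫ P' ◁ b') ⊗≫ P' ◁ g ▷ X ⊗≫ 𝟙 _ := by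
        rw [h, h']; monoidal
    _ = _ := by
        rw [← whisker_exchange, MonoidalCategory.tensorHom_def]; monoidal

end

variable {k : Type*} [Field k] {G : Type*} [Group G]
  {C : Type*} [Category C] [MonoidalCategory C]
  {D : Type*} [Category D] [Preadditive D] [Linear k D] [MonoidalCategory D]
  [MonoidalPreadditive D] [MonoidalLinear k D]

section

variable (F : GradedVect k G ⥤ D) [F.Additive] (X : D)

instance : (F ⋙ tensorLeft X).Additive where
  map_add {_ _ f g} := by
    change X ◁ F.map (f + g) = X ◁ F.map f + X ◁ F.map g
    rw [F.map_add, MonoidalPreadditive.whiskerLeft_add]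

instance : (F ⋙ tensorRight X).Additive where
  map_add {_ _ f g} := by
    change F.map (f + g) ▷ X = F.map f ▷ X + F.map g ▷ X
    rw [F.map_add, MonoidalPreadditive.add_whiskerRight]

variable [F.Linear k]

/-- The extension of isomorphisms `X ⊗ F (δ g) ≅ F (δ g) ⊗ X` to graded vector spaces. -/
def extendBraiding (b : ∀ g : LinearDiscrete k G, X ⊗ F.obj ((Mat_.embedding _).obj g) ≅
    F.obj ((Mat_.embedding _).obj g) ⊗ X) :
    F ⋙ tensorLeft X ≅ F ⋙ tensorRight X :=
  Mat.extendIso (NatIso.ofComponents b (by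
    rintro ⟨g⟩ ⟨h⟩ f
    change X ◁ F.map ((Mat_.embedding _).map f) ≫ (b _).hom =
      (b _).hom ≫ F.map ((Mat_.embedding _).map f) ▷ X
    -- Between `δ g` and `δ h` there are only scalars, zero if `g ≠ h`; linearity of `F` therefore
    -- makes any family of isomorphisms natural.
    by_cases e : g = h
    · subst e
      have : f = f.coeff • 𝟙 _ := LinearDiscrete.hom_ext (mul_one _).symm
      rw [this, Functor.map_smul, Functor.map_smul, CategoryTheory.Functor.map_id,
        CategoryTheory.Functor.map_id, MonoidalLinear.whiskerLeft_smul,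
        MonoidalLinear.smul_whiskerRight, MonoidalCategory.whiskerLeft_id, id_whiskerRight,
        Linear.smul_comp, Linear.comp_smul]
      exact congrArg _ ((Category.id_comp _).trans (Category.comp_id _).symm)
    · have : f = 0 := LinearDiscrete.hom_ext (f.coeff_eq_zero e)
      rw [this, Functor.map_zero, Functor.map_zero, MonoidalPreadditive.whiskerLeft_zero,
        MonoidalPreadditive.zero_whiskerRight, Limits.zero_comp, Limits.comp_zero]))

variable (b : ∀ g : LinearDiscrete k G, X ⊗ F.obj ((Mat_.embedding _).obj g) ≅
    F.obj ((Mat_.embedding _).obj g) ⊗ X)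

lemma extendBraiding_embedding (g : LinearDiscrete k G) :
    (extendBraiding F X b).hom.app ((Mat_.embedding _).obj g) = (b g).hom :=
  Mat.extend_app_embedding _ _

lemma extendBraiding_natural {M N : GradedVect k G} (f : M ⟶ N) :
    X ◁ F.map f ≫ (extendBraiding F X b).hom.app N =
      (extendBraiding F X b).hom.app M ≫ F.map f ▷ X :=
  (extendBraiding F X b).hom.naturality f

end

namespace Commutation

variable {H : C ⥤ D} [H.Monoidal] {F : GradedVect k G ⥤ D} [F.Additive] [F.Linear k] [F.Monoidal]

/-- The isomorphisms of a commutation with the objects `F (δ g)`. -/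
def deltaIso (c : Commutation H (delta k G ⋙ F)) (X : C) (g : LinearDiscrete k G) :
    H.obj X ⊗ F.obj ((Mat_.embedding _).obj g) ≅ F.obj ((Mat_.embedding _).obj g) ⊗ H.obj X :=
  c.iso X ⟨g.as⟩

lemma extendBraiding_tensor (c : Commutation H (delta k G ⋙ F)) (X : C)
    (g h : LinearDiscrete k G) :
    H.obj X ◁ μ F ((Mat_.embedding _).obj g) ((Mat_.embedding _).obj h) ≫
      (extendBraiding F (H.obj X) (c.deltaIso X)).hom.app _ =
    ((α_ _ _ _).inv ≫ (c.deltaIso X g).hom ▷ F.obj ((Mat_.embedding _).obj h) ≫ (α_ _ _ _).hom ≫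
      F.obj ((Mat_.embedding _).obj g) ◁ (c.deltaIso X h).hom ≫ (α_ _ _ _).inv) ≫
        μ F ((Mat_.embedding _).obj g) ((Mat_.embedding _).obj h) ▷ H.obj X := by
  -- In the envelope `δ g ⊗ δ h` is a family indexed by pairs, and the braiding is prescribed only
  -- at the embedded objects. Naturality along the isomorphism `m` moves the question to `δ (g h)`.
  let m : (Mat_.embedding (LinearDiscrete k G)).obj g ⊗ (Mat_.embedding _).obj h ⟶
    (Mat_.embedding (LinearDiscrete k G)).obj (g ⊗ h) := μ (delta k G) ⟨g.as⟩ ⟨h.as⟩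
  have : IsIso m := inferInstanceAs (IsIso (μ (delta k G) ⟨g.as⟩ ⟨h.as⟩))
  rw [← cancel_mono (F.map m ▷ H.obj X), Category.assoc, Category.assoc,
    ← extendBraiding_natural, extendBraiding_embedding, ← comp_whiskerRight,
    ← whiskerLeft_comp_assoc]
  exact c.tensor_right X ⟨g.as⟩ ⟨h.as⟩

/-- The extension of a commutation with the objects `F (δ g)` to graded vector spaces. -/
def extendDelta (c : Commutation H (delta k G ⋙ F)) : Commutation H F where
  iso X M := (extendBraiding F (H.obj X) (c.deltaIso X)).app M
  natural_left {X X'} f M := by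
    -- Tested on a summand of `M`, the claim becomes the given axiom of `c` at the corresponding `δ
    -- g`.
    refine Mat.hom_ext_incl (F ⋙ tensorLeft (H.obj X)) fun i => ?_
    change H.obj X ◁ F.map (Mat.incl M i) ≫ H.map f ▷ F.obj M ≫
      (extendBraiding F (H.obj X') (c.deltaIso X')).hom.app M =
      H.obj X ◁ F.map (Mat.incl M i) ≫ (extendBraiding F (H.obj X) (c.deltaIso X)).hom.app M ≫
        F.obj M ◁ H.map f
    rw [whisker_exchange_assoc, extendBraiding_natural, reassoc_of% (extendBraiding_natural F),
      extendBraiding_embedding, extendBraiding_embedding, ← whisker_exchange]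
    exact ((Category.assoc _ _ _).symm.trans (eq_whisker (c.natural_left f ⟨(M.X i).as⟩) _)).trans
      (Category.assoc _ _ _)
  natural_right X _ _ f := extendBraiding_natural F _ _ f
  tensor_left X X' M := by
    refine Mat.hom_ext_incl (F ⋙ tensorLeft (H.obj X ⊗ H.obj X')) fun i => ?_
    change (H.obj X ⊗ H.obj X') ◁ F.map (Mat.incl M i) ≫ μ H X X' ▷ F.obj M ≫
      (extendBraiding F (H.obj (X ⊗ X')) (c.deltaIso (X ⊗ X'))).hom.app M =
      (H.obj X ⊗ H.obj X') ◁ F.map (Mat.incl M i) ≫ ((α_ _ _ _).hom ≫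
        H.obj X ◁ (extendBraiding F (H.obj X') (c.deltaIso X')).hom.app M ≫ (α_ _ _ _).inv ≫
          (extendBraiding F (H.obj X) (c.deltaIso X)).hom.app M ▷ H.obj X' ≫ (α_ _ _ _).hom) ≫
            F.obj M ◁ μ H X X'
    rw [whisker_exchange_assoc, extendBraiding_natural, ← Category.assoc (_ ◁ _),
      hexagon_left_natural (F.map (Mat.incl M i)) _ _
        (extendBraiding_natural F (H.obj X) (c.deltaIso X) (Mat.incl M i)) _ _
        (extendBraiding_natural F (H.obj X') (c.deltaIso X') (Mat.incl M i)),
      extendBraiding_embedding, extendBraiding_embedding, extendBraiding_embedding,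
      Category.assoc, ← whisker_exchange, ← Category.assoc, ← Category.assoc]
    exact eq_whisker (c.tensor_left X X' ⟨(M.X i).as⟩) _
  tensor_right X M N := by
    -- Reassociating to `(H X ⊗ F M) ⊗ F N` presents the source as a product of two additive
    -- functors, so that summands of `M` and `N` can be treated together.
    refine (cancel_epi (α_ _ _ _).hom).1 ?_
    refine Mat.hom_ext_incl_tensor (F ⋙ tensorLeft (H.obj X)) F fun i j => ?_
    change (H.obj X ◁ F.map (Mat.incl M i) ⊗ₘ F.map (Mat.incl N j)) ≫ (α_ _ _ _).hom ≫ _ =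
      (H.obj X ◁ F.map (Mat.incl M i) ⊗ₘ F.map (Mat.incl N j)) ≫ (α_ _ _ _).hom ≫ _
    rw [← id_tensorHom, associator_naturality_assoc, associator_naturality_assoc, id_tensorHom]
    refine congrArg _ ?_
    change H.obj X ◁ (F.map (Mat.incl M i) ⊗ₘ F.map (Mat.incl N j)) ≫ H.obj X ◁ μ F M N ≫
      (extendBraiding F (H.obj X) (c.deltaIso X)).hom.app (M ⊗ N) =
      H.obj X ◁ (F.map (Mat.incl M i) ⊗ₘ F.map (Mat.incl N j)) ≫ ((α_ _ _ _).inv ≫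
        (extendBraiding F (H.obj X) (c.deltaIso X)).hom.app M ▷ F.obj N ≫ (α_ _ _ _).hom ≫
          F.obj M ◁ (extendBraiding F (H.obj X) (c.deltaIso X)).hom.app N ≫ (α_ _ _ _).inv) ≫
            μ F M N ▷ H.obj X
    rw [← whiskerLeft_comp_assoc, μ_natural, whiskerLeft_comp_assoc, extendBraiding_natural,
      ← Category.assoc (H.obj X ◁ (_ ⊗ₘ _)),
      hexagon_right_natural _ _ _ _
        (extendBraiding_natural F (H.obj X) (c.deltaIso X) (Mat.incl M i)) _ _
        (extendBraiding_natural F (H.obj X) (c.deltaIso X) (Mat.incl N j)),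
      Category.assoc, ← comp_whiskerRight, μ_natural, comp_whiskerRight,
      extendBraiding_embedding, extendBraiding_embedding, ← Category.assoc, ← Category.assoc]
    exact eq_whisker (c.extendBraiding_tensor X _ _) _

lemma extendDelta_iso_delta (c : Commutation H (delta k G ⋙ F)) (X : C) (g : Discrete G) :
    (c.extendDelta.iso X ((delta k G).obj g)).hom = (c.iso X g).hom :=
  extendBraiding_embedding F (H.obj X) (c.deltaIso X) ⟨g.as⟩

end Commutation

end GradedCommutations

/-! ### Commuting pairs with `V(G)` are the same as equivariant pairs. -/

section EquivariantPairs

variable {k : Type*} [Field k] {G : Type*} [Group G]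

section

variable {C : Type*} [Category C] [MonoidalCategory C]
  {D : Type*} [Category D] [Preadditive D] [Linear k D] [MonoidalCategory D]
  [MonoidalPreadditive D] [MonoidalLinear k D]
  {P : Discrete G ⥤ D} [P.Monoidal]

/-- The equivariant structure `X ≅ P g ⊗ X ⊗ P g⁻¹`. -/
def EquivariantObj.conjIso (X : EquivariantObj (innerAction k P)) (g : Discrete G) :
    X.obj ≅ P.obj g ⊗ (X.obj ⊗ P.obj (ginv g)) :=
  X.iso g

/-- The morphism `X ⊗ P g ⟶ P g ⊗ X` corresponding to an equivariant structure on `X`. -/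
def EquivariantObj.braiding (X : EquivariantObj (innerAction k P)) (g : Discrete G) :
    X.obj ⊗ P.obj g ⟶ P.obj g ⊗ X.obj :=
  braidOfStr (evIso P g).hom (X.conjIso g).hom

/-- The isomorphism `X ⊗ P g ≅ P g ⊗ X` corresponding to an equivariant structure on `X`. -/
def EquivariantObj.braidingIso (X : EquivariantObj (innerAction k P)) (g : Discrete G) :
    X.obj ⊗ P.obj g ≅ P.obj g ⊗ X.obj :=
  asIso (braidOfStr (evIso P g).hom (X.conjIso g).hom)

/-- This and the two lemmas after it bend, in turn, the equivariance of a morphism, the structure of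
a tensor product, and the condition on `x_{gh}`. The results are the axioms of a commutation. -/
lemma EquivariantObj.braiding_natural {X Y : EquivariantObj (innerAction k P)} (f : X ⟶ Y)
    (g : Discrete G) : f.hom ▷ P.obj g ≫ Y.braiding g = X.braiding g ≫ P.obj g ◁ f.hom :=
  (braidOfStr_comp_left _ f.hom (Y.iso g).hom).symm.trans
    ((congrArg (braidOfStr (evIso P g).hom) (f.comm g).symm).trans
      (braidOfStr_comp_right _ (X.iso g).hom f.hom))

lemma EquivariantObj.braiding_tensor (X Y : EquivariantObj (innerAction k P)) (g : Discrete G) :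
    (X ⊗ Y).braiding g = (α_ _ _ _).hom ≫ X.obj ◁ Y.braiding g ≫ (α_ _ _ _).inv ≫
      X.braiding g ▷ Y.obj ≫ (α_ _ _ _).hom :=
  braidOfStr_tensor _ _ _

lemma EquivariantObj.braiding_mul (X : EquivariantObj (innerAction k P)) (g h : Discrete G) :
    X.obj ◁ μ P g h ≫ X.braiding (g ⊗ h) = ((α_ _ _ _).inv ≫ X.braiding g ▷ P.obj h ≫
      (α_ _ _ _).hom ≫ P.obj g ◁ X.braiding h ≫ (α_ _ _ _).inv) ≫ μ P g h ▷ X.obj :=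
  (congrArg (fun x => X.obj ◁ μ P g h ≫ braidOfStr (evIso P (g ⊗ h)).hom x)
    (X.iso_mul g h)).trans (braidOfStr_mul _ _ _ _ _ (invMul_ev P g h) _ _)

variable (S : C ⥤ EquivariantObj (innerAction k P)) [S.Monoidal]

/-- A tensor functor to equivariant objects for conjugation with the objects `P g` commutes with
the objects `P g`. -/
@[simps iso] def Commutation.ofEquivariant :
    Commutation (S ⋙ (EquivariantObj.forget (innerAction k P)).toFunctor) P where
  iso X g := (S.obj X).braidingIso g
  natural_left f g := EquivariantObj.braiding_natural (S.map f) g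
  natural_right X g h f := by
    -- All morphisms of the discrete category are identities, so naturality in the group element is
    -- automatic.
    obtain rfl : g = h := Discrete.ext (Discrete.eq_of_hom f)
    rw [Subsingleton.elim f (𝟙 _)]
    simp
  tensor_left X Y g := by
    -- The tensorator of the forgetful functor is the identity, so only the morphism underlying that
    -- of `S` is left.
    have e : μ (S ⋙ (EquivariantObj.forget (innerAction k P)).toFunctor) X Y =
      (μ S X Y).hom := Category.id_comp _
    rw [e]
    refine (EquivariantObj.braiding_natural (μ S X Y) g).trans ?_
    rw [EquivariantObj.braiding_tensor]
    rfl
  tensor_right X g h := (S.obj X).braiding_mul g h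

end

variable {C : Type*} [Category C] [Preadditive C] [Linear k C] [MonoidalCategory C]
  {D : Type*} [Category D] [Preadditive D] [Linear k D] [MonoidalCategory D]
  [MonoidalPreadditive D] [MonoidalLinear k D]

namespace CommutingPair

/-- The equivariant pair of a commuting pair. -/
@[simps fst] def toEquivariantPair (p : CommutingPair k C (GradedVect k G) D) :
    EquivariantPair k C G D where
  fst := p.fst
  snd := { toFunctor := (p.comm.compRight (delta k G)).equivariantFunctor k }

/-- Bending undoes the construction of the equivariant structure. The formula for the half-braiding
in the theorem originates here. -/
lemma toEquivariantPair_halfBraiding (p : CommutingPair k C (GradedVect k G) D) (X : C)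
    (g : Discrete G) : p.toEquivariantPair.halfBraiding X g =
      (p.comm.iso X ((delta k G).obj g)).hom :=
  (p.comm.compRight (delta k G)).braidOfStr_str X g

/-- The underlying functor of the equivariant pair of a commuting pair. -/
def underlyingIso (p : CommutingPair k C (GradedVect k G) D) :
    p.toEquivariantPair.underlying ≅ p.snd :=
  TensorFunctor.isoMk (NatIso.ofComponents (F := p.toEquivariantPair.underlying.toFunctor)
    (G := p.snd.toFunctor) (fun X => Iso.refl (p.snd.obj X)) (fun f =>
      (Category.comp_id _).trans (Category.id_comp _).symm))
    { unit := (Category.comp_id _).trans (Category.id_comp _)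
      tensor X Y := by
        change (𝟙 _ ≫ μ p.snd.toFunctor X Y) ≫ 𝟙 (p.snd.obj (X ⊗ Y)) =
          (𝟙 (p.snd.obj X) ⊗ₘ 𝟙 (p.snd.obj Y)) ≫ μ p.snd.toFunctor X Y
        simp }

/-- Tensor transformations between the underlying functors of equivariant pairs. -/
def underlyingHom {p q : CommutingPair k C (GradedVect k G) D} (b : p.snd ⟶ q.snd) :
    p.toEquivariantPair.underlying ⟶ q.toEquivariantPair.underlying :=
  (underlyingIso p).hom ≫ b ≫ (underlyingIso q).inv

lemma underlyingHom_app {p q : CommutingPair k C (GradedVect k G) D} (b : p.snd ⟶ q.snd) (X : C) :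
    (underlyingHom b).hom.app X = b.hom.app X :=
  (Category.id_comp _).trans (Category.comp_id _)

/-- Tensor transformations between the tensor functors underlying equivariant pairs. -/
def homOfUnderlying {p q : CommutingPair k C (GradedVect k G) D}
    (b : p.toEquivariantPair.underlying ⟶ q.toEquivariantPair.underlying) : p.snd ⟶ q.snd :=
  (underlyingIso p).inv ≫ b ≫ (underlyingIso q).hom

lemma homOfUnderlying_app {p q : CommutingPair k C (GradedVect k G) D}
    (b : p.toEquivariantPair.underlying ⟶ q.toEquivariantPair.underlying) (X : C) :
    (homOfUnderlying b).hom.app X = b.hom.app X :=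
  (Category.id_comp _).trans (Category.comp_id _)

instance {F F' : TensorFunctor k (GradedVect k G) D} (a : F ⟶ F') :
    NatTrans.IsMonoidal (Functor.whiskerLeft (delta k G) a.hom) :=
  NatTrans.IsMonoidal.whiskerLeft _

variable (k C G D) in
/-- The functor from commuting pairs to equivariant pairs. -/
@[simps obj] def equivariantPairFunctor :
    CommutingPair k C (GradedVect k G) D ⥤ EquivariantPair k C G D where
  obj p := p.toEquivariantPair
  map {p q} a :=
    { fst := a.fst
      snd := underlyingHom a.snd
      comm X g := by
        rw [underlyingHom_app]
        -- The square of `a` at `δ g` is bent into the equivariance square; coevaluations are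
        -- preserved because `a.fst` is monoidal.
        exact strOfBraid_map _ _ _ _ (coev_natural (Functor.whiskerLeft (delta k G) a.fst.hom) g)
          _ _ _ (a.comm X _) }
  map_id p := EquivariantPair.Hom.ext rfl (TensorFunctor.hom_ext fun X => by
    rw [underlyingHom_app]
    rfl)
  map_comp a b := EquivariantPair.Hom.ext rfl (TensorFunctor.hom_ext fun X => by
    rw [underlyingHom_app]
    change _ = (underlyingHom a.snd).hom.app X ≫ (underlyingHom b.snd).hom.app X
    rw [underlyingHom_app, underlyingHom_app]
    rfl)

instance : (equivariantPairFunctor k G C D).Faithful where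
  map_injective {p q a b} h := hom_ext (congrArg EquivariantPair.Hom.fst h)
    (TensorFunctor.hom_ext fun X => by
      rw [← underlyingHom_app, ← underlyingHom_app b.snd]
      exact congrArg (fun c => (EquivariantPair.Hom.snd c).hom.app X) h)

/-- All terms are natural in `M`, and the inclusions of the homogeneous lines `δ g` remain jointly
epimorphic after `F` and tensoring. -/
lemma comm_of_delta {p q : CommutingPair k C (GradedVect k G) D} (a : p.fst ⟶ q.fst)
    (b : p.snd ⟶ q.snd) (X : C)
    (h : ∀ g : LinearDiscrete k G, (p.comm.iso X ((Mat_.embedding _).obj g)).hom ≫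
      (a.hom.app _ ⊗ₘ b.hom.app X) = (b.hom.app X ⊗ₘ a.hom.app _) ≫ (q.comm.iso X _).hom)
    (M : GradedVect k G) : (p.comm.iso X M).hom ≫ (a.hom.app M ⊗ₘ b.hom.app X) =
      (b.hom.app X ⊗ₘ a.hom.app M) ≫ (q.comm.iso X M).hom := by
  refine Mat.hom_ext_incl (p.fst.toFunctor ⋙ tensorLeft (p.snd.obj X)) fun i => ?_
  change p.snd.obj X ◁ p.fst.map (Mat.incl M i) ≫ (p.comm.iso X M).hom ≫
      (a.hom.app M ⊗ₘ b.hom.app X) =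
    p.snd.obj X ◁ p.fst.map (Mat.incl M i) ≫ (b.hom.app X ⊗ₘ a.hom.app M) ≫
      (q.comm.iso X M).hom
  rw [reassoc_of% (p.comm.natural_right X (Mat.incl M i)), whiskerRight_comp_tensorHom,
    a.hom.naturality, whiskerLeft_comp_tensorHom_assoc, a.hom.naturality,
    ← tensorHom_comp_whiskerLeft_assoc, q.comm.natural_right, ← reassoc_of% (h (M.X i)),
    tensorHom_comp_whiskerRight]

/-- Gives fullness: bending the equivariance square, with evaluations preserved by `a`, yields
compatibility at `δ g`, and `comm_of_delta` extends it to all graded spaces. -/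
lemma comm_of_equivariant {p q : CommutingPair k C (GradedVect k G) D} (a : p.fst ⟶ q.fst)
    (b : p.toEquivariantPair.underlying ⟶ q.toEquivariantPair.underlying) (X : C)
    (h : ∀ g : Discrete G, (p.toEquivariantPair.str X g).hom ≫
      (a.hom.app ((delta k G).obj g) ⊗ₘ
        (b.hom.app X ⊗ₘ a.hom.app ((delta k G).obj (ginv g)))) =
          b.hom.app X ≫ (q.toEquivariantPair.str X g).hom) (M : GradedVect k G) :
    (p.comm.iso X M).hom ≫ (a.hom.app M ⊗ₘ (homOfUnderlying b).hom.app X) =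
      ((homOfUnderlying b).hom.app X ⊗ₘ a.hom.app M) ≫ (q.comm.iso X M).hom := by
  refine comm_of_delta _ _ X (fun g => ?_) M
  rw [tensorHom_def' ((homOfUnderlying b).hom.app X), Category.assoc, homOfUnderlying_app]
  have e := braidOfStr_map _ _ _ _ (ev_natural (Functor.whiskerLeft (delta k G) a.hom) ⟨g.as⟩)
    (b.hom.app X) (p.toEquivariantPair.str X ⟨g.as⟩).hom
  refine (eq_whisker (p.toEquivariantPair_halfBraiding X ⟨g.as⟩).symm _).trans
    (e.symm.trans (whisker_eq _ ?_))
  refine (congrArg (braidOfStr _) (h ⟨g.as⟩)).trans ((braidOfStr_comp_left _ (b.hom.app X)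
    (q.toEquivariantPair.str X ⟨g.as⟩).hom).trans ?_)
  exact whisker_eq _ (q.toEquivariantPair_halfBraiding X ⟨g.as⟩)

instance : (equivariantPairFunctor k G C D).Full where
  map_surjective b :=
    ⟨{ fst := b.fst
       snd := homOfUnderlying b.snd
       comm X := comm_of_equivariant _ _ X fun g => b.comm X g },
      EquivariantPair.Hom.ext rfl (TensorFunctor.hom_ext fun X =>
        (underlyingHom_app _ X).trans (homOfUnderlying_app _ X))⟩

variable (q : EquivariantPair k C G D)

/-- The commuting pair of an equivariant pair. -/
@[simps] def ofEquivariantPair : CommutingPair k C (GradedVect k G) D where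
  fst := q.fst
  snd := q.underlying
  comm := (Commutation.ofEquivariant q.snd.toFunctor).extendDelta

/-- The extended commutation has the original braiding at `δ g`, and bending this back returns the
original structure. The round trip thus changes nothing but the presentation of the underlying
functor. -/
lemma ofEquivariantPair_str (X : C) (g : Discrete G) :
    ((ofEquivariantPair q).toEquivariantPair.str X g).hom = (q.str X g).hom := by
  refine Eq.trans ?_ (strOfBraid_braidOfStr (evIso _ g).hom (coevIso _ g).hom
    (ev_coev_right _ g) (q.str X g).hom)
  exact congrArg (strOfBraid _) (Commutation.extendDelta_iso_delta
    (Commutation.ofEquivariant q.snd.toFunctor) X g)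

/-- The isomorphism of an equivariant pair with that of its commuting pair. -/
def ofEquivariantPairIso : (ofEquivariantPair q).toEquivariantPair ≅ q where
  hom := ⟨𝟙 q.fst, (underlyingIso (ofEquivariantPair q)).hom, fun X g => by
    rw [ofEquivariantPair_str]
    exact (whisker_eq (q.str X g).hom (by simp : (𝟙 (q.pt g) ⊗ₘ
      (𝟙 (q.underlying.obj X) ⊗ₘ 𝟙 (q.pt (ginv g)))) = 𝟙 _)).trans
        ((Category.comp_id _).trans (Category.id_comp _).symm)⟩
  inv := ⟨𝟙 q.fst, (underlyingIso (ofEquivariantPair q)).inv, fun X g => by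
    rw [ofEquivariantPair_str]
    exact (whisker_eq (q.str X g).hom (by simp : (𝟙 (q.pt g) ⊗ₘ
      (𝟙 (q.underlying.obj X) ⊗ₘ 𝟙 (q.pt (ginv g)))) = 𝟙 _)).trans
        ((Category.comp_id _).trans (Category.id_comp _).symm)⟩
  hom_inv_id := EquivariantPair.Hom.ext (Category.comp_id _) (Iso.hom_inv_id _)
  inv_hom_id := EquivariantPair.Hom.ext (Category.comp_id _) (Iso.inv_hom_id _)

instance : (equivariantPairFunctor k G C D).EssSurj where
  mem_essImage q := ⟨ofEquivariantPair q, ⟨ofEquivariantPairIso q⟩⟩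

instance : (equivariantPairFunctor k G C D).IsEquivalence where

end CommutingPair

end EquivariantPairs

/-! ### The composite equivalence and its compatibility with the exchange. -/

section Main

variable (k : Type*) [Field k]
  (C : Type*) [Category C] [Preadditive C] [Linear k C] [MonoidalCategory C]
  [MonoidalPreadditive C] [MonoidalLinear k C] (G : Type*) [Group G]
  (D : Type*) [Category D] [Preadditive D] [Linear k D] [HasFiniteBiproducts D]
  [MonoidalCategory D] [MonoidalPreadditive D] [MonoidalLinear k D]

namespace DeligneProduct

/-- The functor from tensor functors on `C ⊠ V(G)` to equivariant pairs. -/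
def equivariantPairFunctor :
    TensorFunctor k (DeligneProduct k C (GradedVect k G)) D ⥤ EquivariantPair k C G D :=
  Mat.restriction (LinearProduct k C (GradedVect k G)) D k ⋙
    CommutingPair.restriction k C (GradedVect k G) D ⋙
      CommutingPair.equivariantPairFunctor k G C D

/-- Each factor is an equivalence: extension to the additive envelope, amalgamation of commuting
pairs, and bending of half-braidings. -/
instance : (equivariantPairFunctor k C G D).IsEquivalence :=
  inferInstanceAs (Functor.IsEquivalence (_ ⋙ _ ⋙ _))

/-- The first component of the pair of `Φ` is `Φ (I ⊠ -)`. -/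
def fstIso : equivariantPairFunctor k C G D ⋙ EquivariantPair.fstFunctor k C G D ≅
    TensorFunctor.precomp (inr k C (GradedVect k G)) D :=
  NatIso.ofComponents (fun Φ => TensorFunctor.isoMk
    (Functor.associator (LinearProduct.inr k C (GradedVect k G)) (Mat_.embedding _)
      Φ.toFunctor).symm
    (inferInstanceAs (NatTrans.IsMonoidal (Functor.associator _ _ _).inv)))
    fun _ => TensorFunctor.hom_ext fun _ =>
      (Category.comp_id _).trans (Category.id_comp _).symm

lemma fstIso_app (Φ : TensorFunctor k (DeligneProduct k C (GradedVect k G)) D)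
    (M : GradedVect k G) : ((fstIso k C G D).hom.app Φ).hom.app M =
      𝟙 (Φ.obj ((inr k C (GradedVect k G)).obj M)) := rfl

/-- The functor underlying the second component of the pair of `Φ` is `Φ (- ⊠ I)`. -/
def underlyingIso : equivariantPairFunctor k C G D ⋙ EquivariantPair.underlyingFunctor k C G D ≅
    TensorFunctor.precomp (inl k C (GradedVect k G)) D :=
  NatIso.ofComponents (fun Φ =>
    CommutingPair.underlyingIso (CommutingPair.ofTensorFunctor
      ((Mat.restriction (LinearProduct k C (GradedVect k G)) D k).obj Φ)) ≪≫
    TensorFunctor.isoMk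
      (Functor.associator (LinearProduct.inl k C (GradedVect k G)) (Mat_.embedding _)
        Φ.toFunctor).symm
      (inferInstanceAs (NatTrans.IsMonoidal (Functor.associator _ _ _).inv)))
    fun {Φ Ψ} a => TensorFunctor.hom_ext fun X => by
      change (𝟙 _ ≫ a.hom.app _ ≫ 𝟙 _) ≫ 𝟙 _ ≫ 𝟙 _ = (𝟙 _ ≫ 𝟙 _) ≫ a.hom.app _
      simp only [Category.id_comp, Category.comp_id]

lemma underlyingIso_app (Φ : TensorFunctor k (DeligneProduct k C (GradedVect k G)) D) (X : C) :
    ((underlyingIso k C G D).hom.app Φ).hom.app X =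
      𝟙 (Φ.obj ((inl k C (GradedVect k G)).obj X)) :=
  Category.id_comp _

/-- The half-braiding is the commutation at `δ g`, hence the canonical swap transported first along
the embedding and then along `Φ`. -/
lemma halfBraiding_comp_μ (Φ : TensorFunctor k (DeligneProduct k C (GradedVect k G)) D) (X : C)
    (g : Discrete G) :
    ((equivariantPairFunctor k C G D).obj Φ).halfBraiding X g ≫
      μ Φ.toFunctor ((inr k C (GradedVect k G)).obj ((delta k G).obj g))
        ((inl k C (GradedVect k G)).obj X) =
    μ Φ.toFunctor ((inl k C (GradedVect k G)).obj X)
        ((inr k C (GradedVect k G)).obj ((delta k G).obj g)) ≫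
      Φ.map (exchange k X ((delta k G).obj g)).hom := by
  refine (eq_whisker (CommutingPair.toEquivariantPair_halfBraiding _ X g) _).trans ?_
  let E := Mat_.embedding (LinearProduct k C (GradedVect k G))
  let Y := (LinearProduct.inl k C (GradedVect k G)).obj X
  let Z := (LinearProduct.inr k C (GradedVect k G)).obj ((delta k G).obj g)
  -- The tensorator of the restricted functor is that of `Φ` followed by the image of that of `E`,
  -- and `exchange` is the swap conjugated by the tensorators of `E`. Only the outer pair of `δ` and
  -- `μ` has to cancel.
  change ((μ Φ.toFunctor (E.obj Y) (E.obj Z) ≫ Φ.map (μ E Y Z)) ≫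
    Φ.map (E.map (LinearProduct.swap X ((delta k G).obj g)).hom) ≫
      Φ.map (δ E Z Y) ≫ δ Φ.toFunctor (E.obj Z) (E.obj Y)) ≫
        μ Φ.toFunctor (E.obj Z) (E.obj Y) =
    μ Φ.toFunctor (E.obj Y) (E.obj Z) ≫ Φ.map (μ E Y Z ≫
      E.map (LinearProduct.swap X ((delta k G).obj g)).hom ≫ δ E Z Y)
  simp

end DeligneProduct

end Main

end TensorCategory

end

theorem mainTheorem5 (k : Type*) [Field k] [IsAlgClosed k]
    (C : Type*) [Category C] [Abelian C] [Linear k C] [MonoidalCategory C]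
    [MonoidalPreadditive C] [MonoidalLinear k C] (hC : IsFusion k C)
    (G : Type*) [Group G] [Finite G]
    (D : Type*) [Category D] [Preadditive D] [Linear k D] [HasFiniteBiproducts D]
    [MonoidalCategory D] [MonoidalPreadditive D] [MonoidalLinear k D] :
    ∃ (e : TensorFunctor k (DeligneProduct k C (GradedVect k G)) D ≌ EquivariantPair k C G D)
      (φ : e.functor ⋙ EquivariantPair.fstFunctor k C G D ≅
        TensorFunctor.precomp (DeligneProduct.inr k C (GradedVect k G)) D)
      (ψ : e.functor ⋙ EquivariantPair.underlyingFunctor k C G D ≅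
        TensorFunctor.precomp (DeligneProduct.inl k C (GradedVect k G)) D),
      ∀ (Φ : TensorFunctor k (DeligneProduct k C (GradedVect k G)) D) (X : C) (g : Discrete G),
        (e.functor.obj Φ).halfBraiding X g ≫
          ((φ.hom.app Φ).hom.app ((delta k G).obj g) ⊗ₘ (ψ.hom.app Φ).hom.app X) ≫
            Functor.LaxMonoidal.μ Φ.toFunctor
              ((DeligneProduct.inr k C (GradedVect k G)).obj ((delta k G).obj g))
              ((DeligneProduct.inl k C (GradedVect k G)).obj X) =
        ((ψ.hom.app Φ).hom.app X ⊗ₘ (φ.hom.app Φ).hom.app ((delta k G).obj g)) ≫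
          Functor.LaxMonoidal.μ Φ.toFunctor
              ((DeligneProduct.inl k C (GradedVect k G)).obj X)
              ((DeligneProduct.inr k C (GradedVect k G)).obj ((delta k G).obj g)) ≫
            Φ.map (DeligneProduct.exchange k X ((delta k G).obj g)).hom := by
  refine ⟨(DeligneProduct.equivariantPairFunctor k C G D).asEquivalence,
    DeligneProduct.fstIso k C G D, DeligneProduct.underlyingIso k C G D, fun Φ X g => ?_⟩
  rw [DeligneProduct.fstIso_app, DeligneProduct.underlyingIso_app]
  -- The components of both comparison isomorphisms are identities, so the required formula is
  -- `halfBraiding_comp_μ` with identities inserted.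
  refine Eq.trans ?_ ((DeligneProduct.halfBraiding_comp_μ k C G D Φ X g).trans ?_)
  · exact whisker_eq _ ((eq_whisker (id_tensorHom_id _ _) _).trans (Category.id_comp _))
  · exact ((eq_whisker (id_tensorHom_id _ _) _).trans (Category.id_comp _)).symm
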